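/- **Setting.** Fix a finite dimension $d$. For a full-rank matrix $\rho$ let $\mathbb L_\rho[A]=\rho A$, $\mathbb R_\rho[A]=A\rho$ on $d\times d$ complex matrices; functions of $\mathbb L_\sigma\mathbb R_\rho^{-1}$ are taken in the sense of functional calculus, and $\Phi^\dagger$ is the Hilbert–Schmidt adjoint of a superoperator $\Phi$. A *standard monotone* is a function $f:(0,\infty)\to(0,\infty)$ that is matrix monotone, satisfies $f(x)=x f(1/x)$ and $f(1)=1$. For such $f$ and a full-rank state $\pi$ put $$\mathbb J_f|_\pi=\mathbb R_\pi f(\mathbb L_\pi\mathbb R_\pi^{-1}),\qquad \mathbb J_f^{-1}|_\pi=\mathbb R_\pi^{-1}\tfrac1f(\mathbb L_\pi\mathbb R_\pi^{-1}),\qquad \mathcal F_{f,\pi}(A)=\mathrm{Tr}\big(A\,\mathbb J_f^{-1}|_\pi[A]\big).$$ For a smooth matrix convex function $g:(0,\infty)\to\mathbb R$ with $g(1)=0$ the contrast function is $H_g(\rho\|\sigma)=\mathrm{Tr}\big(g(\mathbb L_\sigma\mathbb R_\rho^{-1})[\rho]\big)$. A *divisible dynamics* is a family $(\Phi_t)_{t\ge0}$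 of completely positive trace-preserving maps, smooth in $t$, such that for all $t\ge s\ge0$ there is a linear map $\Phi_{t,s}$ with $\Phi_t=\Phi_{t,s}\circ\Phi_s$. It is *Markovian* if all the maps $\Phi_{t,s}$ can be taken completely positive and trace preserving. Time derivatives are on $[0,\infty)$, hence one-sided at $t=0$. **Theorem.** Let $\Phi_t$ be a divisible dynamics, $\pi$ a full-rank state, and $f',f$ standard monotones with $f'(x)\le f(x)$ for all $x>0$. Let $$\widetilde\Phi_t=\mathbb J_{f'}|_\pi\circ\Phi_t^\dagger\circ\mathbb J_f^{-1}|_{\Phi_t(\pi)}$$ be the generalised Petz map, and let $g=g(f')$ be any function defining a contrast function as above such that $f'(x)=(x-1)^2/\big(g(x)+x\,g(1/x)\big)$ for $x\neq1$. Let $t\ge0$ be a time at which $\Phi_t(\pi)$ has full rank. Suppose that there is a traceless Hermitian $\delta\rho$ with $$\frac{\mathrm d}{\mathrm dt}\mathcal F_{f,\Phi_t(\pi)}\big(\Phi_t(\delta\rho)\big)>0 .$$ Then: 1. There is a traceless Hermitian $\delta\rho$ (possibly different from the given one) which satisfies the same inequality and for which retrodiction improves at time $t$: for all sufficiently small real $\varepsilon\neq0$,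 $$\frac{\mathrm d}{\mathrm dt}H_{g}\big(\pi+\varepsilon\,\delta\rho\,\big\|\,\widetilde\Phi_t\Phi_t(\pi+\varepsilon\,\delta\rho)\big)<0 .$$ More precisely, as $\varepsilon\to0$ this derivative equals $q\,\varepsilon^2+O(\varepsilon^3)$ with $$q=\frac12\frac{\mathrm d}{\mathrm dt}\mathcal F_{f',\pi}\big(\delta\rho-\widetilde\Phi_t\Phi_t(\delta\rho)\big)<0 .$$ 2. The dynamics is non-Markovian; indeed, it is so right after time $t$: there is no $\eta>0$ such that for every $u\in(t,t+\eta)$ one can write $\Phi_u=\Lambda\circ\Phi_t$ with $\Lambda$ completely positive and trace preserving. -/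

import Mathlib

open Matrix Set Filter Topology Asymptotics
open scoped ContDiff ComplexOrder

noncomputable section

namespace QFisher

/-- Complex `d × d` matrices. -/
abbrev Mat (d : ℕ) := Matrix (Fin d) (Fin d) ℂ

/-- Superoperators: complex linear maps on the space of `d × d` matrices. -/
abbrev SuperOp (d : ℕ) := Mat d →ₗ[ℂ] Mat d

/-- Left multiplication `A ↦ ρ A`. -/
def leftMul {d : ℕ} (ρ : Mat d) : SuperOp d := LinearMap.mulLeft ℂ ρ

/-- Right multiplication `A ↦ A ρ`. -/
def rightMul {d : ℕ} (ρ : Mat d) : SuperOp d := LinearMap.mulRight ℂ ρ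

/-- The matrix of a superoperator in the basis of the matrix units `|i⟩⟨j|`, which is orthonormal
for the Hilbert-Schmidt scalar product `⟨A, B⟩ = Tr (Aᴴ B)`. -/
def superMatrix {d : ℕ} (T : SuperOp d) : Matrix (Fin d × Fin d) (Fin d × Fin d) ℂ :=
  LinearMap.toMatrix (Matrix.stdBasis ℂ (Fin d) (Fin d)) (Matrix.stdBasis ℂ (Fin d) (Fin d)) T

/-- The superoperator with a given matrix in the basis of the matrix units. -/
def ofSuperMatrix {d : ℕ} (M : Matrix (Fin d × Fin d) (Fin d × Fin d) ℂ) : SuperOp d :=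
  Matrix.toLin (Matrix.stdBasis ℂ (Fin d) (Fin d)) (Matrix.stdBasis ℂ (Fin d) (Fin d)) M

/-- The Hilbert-Schmidt adjoint `Φ†` of a superoperator: `Tr (Φ†(A)ᴴ B) = Tr (Aᴴ Φ(B))`
(see `trace_superAdjoint`). -/
def superAdjoint {d : ℕ} (Φ : SuperOp d) : SuperOp d := ofSuperMatrix (superMatrix Φ)ᴴ

theorem trace_superAdjoint {d : ℕ} (Φ : SuperOp d) (A B : Mat d) :
    ((superAdjoint Φ A)ᴴ * B).trace = (Aᴴ * Φ B).trace := by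
  have key : ∀ X Y : Mat d, (Xᴴ * Y).trace =
      star ((Matrix.stdBasis ℂ (Fin d) (Fin d)).repr X : Fin d × Fin d → ℂ) ⬝ᵥ
        ((Matrix.stdBasis ℂ (Fin d) (Fin d)).repr Y : Fin d × Fin d → ℂ) := by
    intro X Y
    have hr : ∀ (Z : Mat d) (p : Fin d × Fin d),
        (Matrix.stdBasis ℂ (Fin d) (Fin d)).repr Z p = Z p.1 p.2 := by
      intro Z p
      simp [Matrix.stdBasis, Pi.basis_repr]
    simp only [dotProduct, Matrix.trace, Matrix.diag, Matrix.mul_apply, Fintype.sum_prod_type,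
      Pi.star_apply, hr, Matrix.conjTranspose_apply]
    exact Finset.sum_comm
  rw [key, key]
  have h1 : ((Matrix.stdBasis ℂ (Fin d) (Fin d)).repr (superAdjoint Φ A) : Fin d × Fin d → ℂ) =
      (superMatrix Φ)ᴴ *ᵥ (Matrix.stdBasis ℂ (Fin d) (Fin d)).repr A := by
    rw [superAdjoint, ofSuperMatrix, Matrix.repr_toLin]
  have h2 : ((Matrix.stdBasis ℂ (Fin d) (Fin d)).repr (Φ B) : Fin d × Fin d → ℂ) =
      superMatrix Φ *ᵥ (Matrix.stdBasis ℂ (Fin d) (Fin d)).repr B := by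
    rw [superMatrix, LinearMap.toMatrix_mulVec_repr]
  rw [h1, h2, Matrix.star_mulVec, Matrix.conjTranspose_conjTranspose, Matrix.dotProduct_mulVec]

/-- The functional calculus `f(T)` of a superoperator `T` that is self-adjoint for the
Hilbert-Schmidt scalar product. -/
def superFun {d : ℕ} (f : ℝ → ℝ) (T : SuperOp d) : SuperOp d :=
  ofSuperMatrix (cfc f (superMatrix T))

/-- The relative modular operator `L_σ R_ρ⁻¹`. -/
def modularOp {d : ℕ} (σ ρ : Mat d) : SuperOp d := leftMul σ ∘ₗ rightMul ρ⁻¹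

/-- The quantum Fisher operator `J_f|_π = R_π f(L_π R_π⁻¹)`. -/
def fisherOp {d : ℕ} (f : ℝ → ℝ) (π : Mat d) : SuperOp d :=
  rightMul π ∘ₗ superFun f (modularOp π π)

/-- The inverse quantum Fisher operator `J_f⁻¹|_π = R_π⁻¹ (1/f)(L_π R_π⁻¹)`
(see `fisherOpInv_comp_fisherOp`). -/
def fisherOpInv {d : ℕ} (f : ℝ → ℝ) (π : Mat d) : SuperOp d :=
  rightMul π⁻¹ ∘ₗ superFun (fun x => 1 / f x) (modularOp π π)

theorem fisherOpInv_comp_fisherOp {d : ℕ} (f : ℝ → ℝ) (hf : ∀ x, 0 < x → 0 < f x)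
    (π : Mat d) (h : π.PosDef) :
    fisherOpInv f π ∘ₗ fisherOp f π = LinearMap.id := by
  set M := superMatrix (modularOp π π)
  have hu : IsUnit π.det := (Matrix.isUnit_iff_isUnit_det _).1 h.isUnit
  have hM : M = kroneckerMap (· * ·) π (π⁻¹)ᵀ := by
    ext ⟨i, j⟩ ⟨k, l⟩
    have hr : ∀ (Z : Mat d) (p : Fin d × Fin d),
        (Matrix.stdBasis ℂ (Fin d) (Fin d)).repr Z p = Z p.1 p.2 := by
      intro Z p
      simp [Matrix.stdBasis, Pi.basis_repr]
    simp only [M, superMatrix, LinearMap.toMatrix_apply, hr, Matrix.stdBasis_eq_single, modularOp,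
      leftMul, rightMul, LinearMap.comp_apply, LinearMap.mulLeft_apply, LinearMap.mulRight_apply,
      kroneckerMap_apply, transpose_apply]
    rw [← Matrix.mul_assoc, Matrix.mul_apply, Finset.sum_eq_single l]
    · rw [Matrix.mul_single_apply_same]; simp
    · intro m _ hm
      rw [Matrix.mul_single_apply_of_ne _ _ _ _ _ hm]; simp
    · simp
  have hpd : M.PosDef := by
    rw [hM]; exact h.kronecker h.inv.transpose
  have hcf : cfc (fun x => 1 / f x) M * cfc f M = 1 := by
    rw [← cfc_mul _ _ M (Set.Finite.continuousOn (Matrix.finite_real_spectrum) _) (Set.Finite.continuousOn (Matrix.finite_real_spectrum) _)]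
    rw [cfc_congr (g := fun _ => 1), cfc_const_one ℝ M hpd.isHermitian.isSelfAdjoint]
    intro x hx
    have : 0 < x := by
      rw [hpd.isHermitian.spectrum_real_eq_range_eigenvalues] at hx
      obtain ⟨i, rfl⟩ := hx
      exact hpd.eigenvalues_pos i
    simp [(hf x this).ne']
  have hcom : Commute (superMatrix (rightMul π)) M := by
    have : Commute (rightMul π) (modularOp π π) := by
      ext1 A
      simp [modularOp, leftMul, rightMul, Module.End.mul_apply, Matrix.mul_assoc, Matrix.nonsing_inv_mul _ hu, Matrix.mul_nonsing_inv _ hu]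
    simp only [M, superMatrix]
    unfold Commute SemiconjBy
    rw [← LinearMap.toMatrix_mul, ← LinearMap.toMatrix_mul, this.eq]
  have hcc : Commute (superMatrix (rightMul π)) (cfc (fun x => 1/f x) M) := by
    exact (Commute.cfc_real hcom.symm _).symm
  have e1 : superFun (fun x => 1 / f x) (modularOp π π) ∘ₗ rightMul π =
      rightMul π ∘ₗ superFun (fun x => 1 / f x) (modularOp π π) := by
    have hR : rightMul π = ofSuperMatrix (superMatrix (rightMul π)) := by
      simp [ofSuperMatrix, superMatrix]
    rw [hR]
    simp only [superFun, ofSuperMatrix]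
    rw [← Matrix.toLin_mul, ← Matrix.toLin_mul]
    exact congrArg _ hcc.eq.symm
  have e2 : superFun (fun x => 1 / f x) (modularOp π π) ∘ₗ superFun f (modularOp π π) =
      LinearMap.id := by
    simp only [superFun, ofSuperMatrix]
    rw [← Matrix.toLin_mul, hcf, Matrix.toLin_one]
  have e3 : rightMul π⁻¹ ∘ₗ rightMul π = LinearMap.id := by
    ext1 A
    simp [rightMul, Matrix.mul_assoc, Matrix.mul_nonsing_inv _ hu]
  calc fisherOpInv f π ∘ₗ fisherOp f π
      = rightMul π⁻¹ ∘ₗ (superFun (fun x => 1 / f x) (modularOp π π) ∘ₗ rightMul π) ∘ₗ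
          superFun f (modularOp π π) := rfl
    _ = (rightMul π⁻¹ ∘ₗ rightMul π) ∘ₗ
          (superFun (fun x => 1 / f x) (modularOp π π) ∘ₗ superFun f (modularOp π π)) := by
        rw [e1]; rfl
    _ = LinearMap.id := by rw [e2, e3]; rfl

/-- The quantum Fisher information `Tr (A J_f⁻¹|_π [A])` of the perturbation `A` at the state `π`.
It is a real number for the Hermitian `A` to which it is applied. -/
def fisherInfo {d : ℕ} (f : ℝ → ℝ) (π A : Mat d) : ℝ :=
  (Matrix.trace (A * fisherOpInv f π A)).re

/-- The contrast function `H_g(ρ‖σ) = Tr (g(L_σ R_ρ⁻¹)[ρ])`, a real number for states. -/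
def contrast {d : ℕ} (g : ℝ → ℝ) (ρ σ : Mat d) : ℝ :=
  (Matrix.trace (superFun g (modularOp σ ρ) ρ)).re

/-- The generalised Petz recovery map `J_{f₀}|_π ∘ Φ† ∘ J_f⁻¹|_{Φ(π)}`. -/
def petzMap {d : ℕ} (f₀ f : ℝ → ℝ) (Φ : SuperOp d) (π : Mat d) : SuperOp d :=
  fisherOp f₀ π ∘ₗ superAdjoint Φ ∘ₗ fisherOpInv f (Φ π)

/-- Standard monotone functions on `(0, ∞)`: positive, matrix monotone (of every order), with
`f(x) = x f(1/x)` and `f(1) = 1`. Values outside `(0, ∞)` are irrelevant. -/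
structure IsStandardMonotone (f : ℝ → ℝ) : Prop where
  pos : ∀ x : ℝ, 0 < x → 0 < f x
  monotone : ∀ (n : ℕ) (A B : Mat n), A.PosDef → B.PosDef → (B - A).PosSemidef →
    (cfc f B - cfc f A).PosSemidef
  symm : ∀ x : ℝ, 0 < x → f x = x * f x⁻¹
  normalized : f 1 = 1

/-- Functions `g` on `(0, ∞)` that define a contrast function `H_g`: smooth, matrix convex
(of every order) and with `g(1) = 0`. -/
structure IsContrastGenerator (g : ℝ → ℝ) : Prop where
  smooth : ContDiffOn ℝ ∞ g (Ioi 0)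
  convex : ∀ (n : ℕ) (A B : Mat n), A.PosDef → B.PosDef → ∀ r : ℝ, 0 ≤ r → r ≤ 1 →
    (r • cfc g A + (1 - r) • cfc g B - cfc g (r • A + (1 - r) • B)).PosSemidef
  map_one : g 1 = 0

/-- `g` and `f` are related by `f(x) = (x - 1)² / (g(x) + x g(1/x))` (in a form without division,
which is trivially true at `x = 1`). -/
def Corresponds (g f : ℝ → ℝ) : Prop :=
  ∀ x : ℝ, 0 < x → f x * (g x + x * g x⁻¹) = (x - 1) ^ 2

/-- Complete positivity: `id_n ⊗ Φ` preserves positive semidefiniteness for every `n`. -/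
def IsCompletelyPositive {d : ℕ} (Φ : SuperOp d) : Prop :=
  ∀ (n : ℕ) (X : Matrix (Fin n × Fin d) (Fin n × Fin d) ℂ), X.PosSemidef →
    (Matrix.of fun p q : Fin n × Fin d =>
      Φ (Matrix.of fun i j : Fin d => X (p.1, i) (q.1, j)) p.2 q.2).PosSemidef

/-- Quantum channels: completely positive and trace preserving maps. -/
structure IsChannel {d : ℕ} (Φ : SuperOp d) : Prop where
  cp : IsCompletelyPositive Φ
  tp : ∀ A : Mat d, (Φ A).trace = A.trace

/-- Divisible dynamics on the time axis `[0, ∞)`: a smooth family of channels for which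
there are intermediate linear maps `Φ_{t,s}` with `Φ_t = Φ_{t,s} ∘ Φ_s` for all `t ≥ s ≥ 0`. -/
structure IsDivisible {d : ℕ} (Φ : ℝ → SuperOp d) : Prop where
  channel : ∀ t : ℝ, 0 ≤ t → IsChannel (Φ t)
  smooth : ∀ (A : Mat d) (i j : Fin d), ContDiffOn ℝ ∞ (fun t => Φ t A i j) (Ici 0)
  divisible : ∀ s t : ℝ, 0 ≤ s → s ≤ t → ∃ Λ : SuperOp d, Φ t = Λ ∘ₗ Φ s

/-- Markovian (CP-divisible) dynamics: the intermediate maps `Φ_{t,s}` can be taken to be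
channels. -/
def IsMarkovian {d : ℕ} (Φ : ℝ → SuperOp d) : Prop :=
  ∀ s t : ℝ, 0 ≤ s → s ≤ t → ∃ Λ : SuperOp d, IsChannel Λ ∧ Φ t = Λ ∘ₗ Φ s

/-- The dynamics is Markovian right after time `t`: for some `η > 0` the intermediate maps
`Φ_{u,t}` with `t < u < t + η` can be taken to be channels. -/
def IsMarkovianAfter {d : ℕ} (Φ : ℝ → SuperOp d) (t : ℝ) : Prop :=
  ∃ η : ℝ, 0 < η ∧ ∀ u : ℝ, t < u → u < t + η →
    ∃ Λ : SuperOp d, IsChannel Λ ∧ Φ u = Λ ∘ₗ Φ t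

theorem IsMarkovian.after {d : ℕ} {Φ : ℝ → SuperOp d} (h : IsMarkovian Φ) {t : ℝ} (ht : 0 ≤ t) :
    IsMarkovianAfter Φ t :=
  ⟨1, one_pos, fun u hu _ => h t u ht hu.le⟩

/-- The time derivative at `t` on the time axis `[0, ∞)` (one-sided at `t = 0`). -/
def timeDeriv (F : ℝ → ℝ) (t : ℝ) : ℝ := derivWithin F (Ici 0) t

end QFisher

end

open Matrix Set Filter Topology Asymptotics
open scoped ContDiff ComplexOrder

noncomputable section

namespace QFisher
set_option linter.unusedSectionVars false

/-! ### Functional calculus of Hermitian matrices and perturbation bounds in the Frobenius norm. -/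

section CfcToolkit

variable {n m : Type*} [Fintype n] [DecidableEq n] [Fintype m] [DecidableEq m]

/-! Let `G` be the matrix of `J_{f₀}⁻¹|_π` and `N(s) = Φ_s† J_f⁻¹|_{Φ_s(π)} Φ_s` the Fisher form
pulled back along `Φ_s` (`pullMat`). Then the Fisher information of `Φ_s(A)` is `⟨A, N(s) A⟩`, and
the Petz map after `Φ_s` is `G⁻¹ N(s)` (`superMatrix_petzMap_comp`). With `u = A - G⁻¹ N(t) A` and
`N' = N'(t)`, half the Fisher information of the retrodiction error has time derivative `-Re ⟨u, N'
A⟩`.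

This has no sign for a general `A`. But if `N'` is positive in some direction, let `v` maximise `⟨v,
N' v⟩ / ⟨v, G v⟩` over the traceless Hermitian matrices. There `Re ⟨x, N' v⟩ = r Re ⟨x, G v⟩` with
`r > 0` for every traceless Hermitian `x` (`exists_max_rayleigh`). With `A = v` and `x = u` the
derivative becomes `-r (⟨v, G v⟩ - ⟨v, N(t) v⟩)`. Since `f₀ ≤ f` and the Fisher information
contracts under channels, `N(s) ≤ G` for `s` near `t`. Equality on `v` at time `t` would make `t` a
maximum of `⟨v, N(s) v⟩` from the right, contradicting its positive derivative
(`IsDivisible.form_lt`). Hence the derivative is negative. The same contraction gives `N(u) ≤ N(t)`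
whenever `Φ_u = Λ Φ_t` with a channel `Λ`, which excludes Markovianity after `t`.

To pass to the contrast function, write `g(x) = c (x - 1) + (x - 1)² k(x)` with `k` of class `C¹`.
The Petz map fixes `π` and preserves traces on the image of `Φ_s`, so the contrast is exactly `ε²`
times the form of `R⁻¹ k(L R⁻¹)` at base points within `O(ε)` of `π`. These base points also move in
time with speed `O(ε)`, so the error is `O(ε³)`. At `π` the form is half the Fisher information,
because `k(x) + x⁻¹ k(x⁻¹) = 1 / f₀(x)`.

The analytic inputs are derived from matrix monotonicity itself: Hansen's inequality
(`IsStandardMonotone.hansen`), from which the contraction `IsChannel.formMat_le` follows; `C¹`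
regularity (`IsStandardMonotone.contDiffOn`); and differentiability of the functional calculus of
`C¹` functions along curves (`HasMatDeriv.cfc`). -/

theorem continuousOn_spectrum (f : ℝ → ℝ) (A : Matrix n n ℂ) : ContinuousOn f (spectrum ℝ A) :=
  Matrix.finite_real_spectrum.continuousOn _

theorem cfc_eq_aeval {f : ℝ → ℝ} {A : Matrix n n ℂ} (hA : A.IsHermitian) (p : Polynomial ℝ)
    (h : ∀ x ∈ spectrum ℝ A, p.eval x = f x) : cfc f A = Polynomial.aeval A p := by
  rw [← cfc_polynomial p A hA.isSelfAdjoint]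
  exact cfc_congr fun x hx => (h x hx).symm

/-- The functional calculus of two Hermitian matrices is given by a common real polynomial. -/
theorem exists_polynomial_cfc (f : ℝ → ℝ) {A : Matrix n n ℂ} (hA : A.IsHermitian)
    {B : Matrix m m ℂ} (hB : B.IsHermitian) :
    ∃ p : Polynomial ℝ, cfc f A = Polynomial.aeval A p ∧ cfc f B = Polynomial.aeval B p := by
  classical
  let S : Finset ℝ := (Matrix.finite_real_spectrum (A := A)).toFinset ∪
    (Matrix.finite_real_spectrum (A := B)).toFinset
  have key : ∀ x ∈ S, (Lagrange.interpolate S id f).eval x = f x := fun x hx =>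
    Lagrange.eval_interpolate_at_node (v := id) f Function.injective_id.injOn hx
  exact ⟨_, cfc_eq_aeval hA _ fun x hx => key x (by simp [S, hx]),
    cfc_eq_aeval hB _ fun x hx => key x (by simp [S, hx])⟩

theorem aeval_mul_of_intertwines {B : Matrix m m ℂ} {C : Matrix n n ℂ} {W : Matrix m n ℂ}
    (h : B * W = W * C) (p : Polynomial ℝ) :
    Polynomial.aeval B p * W = W * Polynomial.aeval C p := by
  induction p using Polynomial.induction_on' with
  | add p q hp hq => simp [Matrix.add_mul, Matrix.mul_add, hp, hq]
  | monomial j a =>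
    have hj : B ^ j * W = W * C ^ j := by
      induction j with
      | zero => simp
      | succ j ih => rw [pow_succ, Matrix.mul_assoc, h, ← Matrix.mul_assoc, ih, Matrix.mul_assoc,
          ← pow_succ]
    simp only [Polynomial.aeval_monomial, ← Algebra.smul_def, Matrix.smul_mul, Matrix.mul_smul, hj]

/-- The main tool for transporting a functional calculus: with `B = C` it gives commutation, with an
isometry `W` it restricts to an invariant subspace, with a single column it evaluates on an
eigenvector. -/
theorem cfc_mul_of_intertwines (f : ℝ → ℝ) {B : Matrix m m ℂ} (hB : B.IsHermitian)
    {C : Matrix n n ℂ} (hC : C.IsHermitian) {W : Matrix m n ℂ} (h : B * W = W * C) :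
    cfc f B * W = W * cfc f C := by
  obtain ⟨p, h1, h2⟩ := exists_polynomial_cfc f hB hC
  rw [h1, h2, aeval_mul_of_intertwines h]

theorem isHermitian_cfc (f : ℝ → ℝ) (A : Matrix n n ℂ) : (cfc f A).IsHermitian :=
  cfc_predicate f A

theorem spectrum_pos {A : Matrix n n ℂ} (hA : A.PosDef) {x : ℝ} (hx : x ∈ spectrum ℝ A) :
    0 < x := by
  rw [hA.isHermitian.spectrum_real_eq_range_eigenvalues] at hx
  obtain ⟨i, rfl⟩ := hx
  exact hA.eigenvalues_pos i

theorem cfc_eq_mul_diagonal_mul {A : Matrix n n ℂ} (hA : A.IsHermitian) (f : ℝ → ℝ) :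
    cfc f A = (hA.eigenvectorUnitary : Matrix n n ℂ) *
      diagonal (fun i => (f (hA.eigenvalues i) : ℂ)) *
      (hA.eigenvectorUnitary : Matrix n n ℂ)ᴴ := by
  rw [hA.cfc_eq, Matrix.IsHermitian.cfc, Unitary.conjStarAlgAut_apply]
  rfl

theorem posDef_mul_mul_conjTranspose {D U : Matrix n n ℂ} (hD : D.PosDef) (hU : U * Uᴴ = 1) :
    (U * D * Uᴴ).PosDef := by
  have := (Matrix.IsUnit.posDef_star_right_conjugate_iff (U := U) (x := D)
    (IsUnit.of_mul_eq_one _ hU)).2 hD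
  simpa [Matrix.star_eq_conjTranspose] using this

theorem posDef_cfc {f : ℝ → ℝ} {A : Matrix n n ℂ} (hA : A.PosDef) (hf : ∀ x, 0 < x → 0 < f x) :
    (cfc f A).PosDef := by
  rw [cfc_eq_mul_diagonal_mul hA.isHermitian]
  refine posDef_mul_mul_conjTranspose (Matrix.PosDef.diagonal fun i => ?_)
    (Unitary.coe_mul_star_self hA.isHermitian.eigenvectorUnitary)
  exact_mod_cast hf _ (hA.eigenvalues_pos i)

theorem posSemidef_cfc {f : ℝ → ℝ} {A : Matrix n n ℂ} (hA : A.IsHermitian)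
    (hf : ∀ x ∈ spectrum ℝ A, 0 ≤ f x) : (cfc f A).PosSemidef := by
  rw [cfc_eq_mul_diagonal_mul hA]
  refine (Matrix.PosSemidef.diagonal fun i => ?_).mul_mul_conjTranspose_same _
  have := hf _ (hA.eigenvalues_mem_spectrum_real i)
  simpa using this

theorem posSemidef_cfc_sub {f g : ℝ → ℝ} {A : Matrix n n ℂ} (hA : A.PosDef)
    (hfg : ∀ x, 0 < x → f x ≤ g x) : (cfc g A - cfc f A).PosSemidef := by
  rw [← cfc_sub g f A (continuousOn_spectrum _ _) (continuousOn_spectrum _ _)]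
  exact posSemidef_cfc hA.isHermitian fun x hx => sub_nonneg.2 (hfg x (spectrum_pos hA hx))

theorem cfc_sqrt_mul_self {A : Matrix n n ℂ} (hA : A.PosSemidef) :
    cfc Real.sqrt A * cfc Real.sqrt A = A := by
  rw [← cfc_mul _ _ A (continuousOn_spectrum _ _) (continuousOn_spectrum _ _)]
  conv_rhs => rw [← cfc_id ℝ A hA.isHermitian.isSelfAdjoint]
  refine cfc_congr fun x hx => Real.mul_self_sqrt ?_
  rw [hA.isHermitian.spectrum_real_eq_range_eigenvalues] at hx
  obtain ⟨i, rfl⟩ := hx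
  exact hA.eigenvalues_nonneg i

/-- The product equals `√B A √B`, a congruence of `A`. -/
theorem posDef_mul_of_commute {A B : Matrix n n ℂ} (hA : A.PosDef) (hB : B.PosDef)
    (h : Commute A B) : (A * B).PosDef := by
  set C := cfc Real.sqrt B with hC
  have hCpd : C.PosDef := posDef_cfc hB fun x hx => Real.sqrt_pos.2 hx
  have hCC : C * C = B := cfc_sqrt_mul_self hB.posSemidef
  have hcom : C * A = A * C := cfc_mul_of_intertwines _ hB.isHermitian hB.isHermitian h.eq.symm
  have : A * B = Cᴴ * A * C := by
    rw [hCpd.isHermitian.eq, hcom, Matrix.mul_assoc, hCC]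
  rw [this]
  exact hA.conjTranspose_mul_mul_same (Matrix.mulVec_injective_of_isUnit hCpd.isUnit)

theorem posSemidef_mul_of_commute {A B : Matrix n n ℂ} (hA : A.PosDef) (hB : B.PosSemidef)
    (h : Commute A B) : (A * B).PosSemidef := by
  set C := cfc Real.sqrt A with hC
  have hCh : C.IsHermitian := isHermitian_cfc _ _
  have hCC : C * C = A := cfc_sqrt_mul_self hA.posSemidef
  have hcom : C * B = B * C := cfc_mul_of_intertwines _ hA.isHermitian hA.isHermitian h.eq
  have : A * B = Cᴴ * B * C := by
    rw [hCh.eq, Matrix.mul_assoc, ← hcom, ← Matrix.mul_assoc, hCC]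
  rw [this]
  exact hB.conjTranspose_mul_mul_same _

/-- The squared Frobenius norm. -/
def frobSq (A : Matrix m n ℂ) : ℝ := ∑ i, ∑ j, ‖A i j‖ ^ 2

theorem frobSq_eq_trace (A : Matrix m n ℂ) : (frobSq A : ℂ) = (Aᴴ * A).trace := by
  simp only [frobSq, Matrix.trace, Matrix.diag, Matrix.mul_apply, conjTranspose_apply]
  rw [Finset.sum_comm]
  push_cast
  refine Finset.sum_congr rfl fun j _ => Finset.sum_congr rfl fun i _ => ?_
  rw [← Complex.conj_mul']; rfl

theorem norm_apply_le_sqrt_frobSq (A : Matrix m n ℂ) (i : m) (j : n) : ‖A i j‖ ≤ √(frobSq A) := by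
  apply Real.le_sqrt_of_sq_le
  calc ‖A i j‖ ^ 2 ≤ ∑ j, ‖A i j‖ ^ 2 :=
        Finset.single_le_sum (f := fun j => ‖A i j‖ ^ 2) (fun _ _ => sq_nonneg _)
          (Finset.mem_univ j)
    _ ≤ _ := Finset.single_le_sum (f := fun i => ∑ j, ‖A i j‖ ^ 2)
          (fun _ _ => Finset.sum_nonneg fun _ _ => sq_nonneg _) (Finset.mem_univ i)

theorem frobSq_mul_mul {U : Matrix m m ℂ} {V : Matrix n n ℂ} (hU : Uᴴ * U = 1) (hV : Vᴴ * V = 1)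
    (A : Matrix m n ℂ) : frobSq (U * A * Vᴴ) = frobSq A := by
  have h : ((frobSq (U * A * Vᴴ) : ℝ) : ℂ) = frobSq A := by
    rw [frobSq_eq_trace, frobSq_eq_trace]
    calc ((U * A * Vᴴ)ᴴ * (U * A * Vᴴ)).trace = (V * (Aᴴ * (Uᴴ * U) * A) * Vᴴ).trace := by
          simp only [conjTranspose_mul, conjTranspose_conjTranspose, Matrix.mul_assoc]
      _ = (Aᴴ * A).trace := by
          rw [hU, Matrix.trace_mul_comm, ← Matrix.mul_assoc, hV]; simp
  exact_mod_cast h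

/-- The overlap of the eigenbases of two Hermitian matrices. -/
def overlap {A B : Matrix n n ℂ} (hA : A.IsHermitian) (hB : B.IsHermitian) : Matrix n n ℂ :=
  (hA.eigenvectorUnitary : Matrix n n ℂ)ᴴ * (hB.eigenvectorUnitary : Matrix n n ℂ)

/-- Between the two eigenbases `f(A) - g(B)` has the entries `(f(λ_i) - g(μ_j)) U_ij` with `U` the
overlap matrix, and the Frobenius norm is unitarily invariant. All perturbation bounds are read off
termwise from this identity. -/
theorem frobSq_cfc_sub_cfc {A B : Matrix n n ℂ} (hA : A.IsHermitian) (hB : B.IsHermitian)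
    (f g : ℝ → ℝ) : frobSq (cfc f A - cfc g B) =
      ∑ i, ∑ j, |f (hA.eigenvalues i) - g (hB.eigenvalues j)| ^ 2 * ‖overlap hA hB i j‖ ^ 2 := by
  set U : Matrix n n ℂ := (hA.eigenvectorUnitary : Matrix n n ℂ) with hU
  set V : Matrix n n ℂ := (hB.eigenvectorUnitary : Matrix n n ℂ) with hV
  have hU1 : U * Uᴴ = 1 := Unitary.coe_mul_star_self hA.eigenvectorUnitary
  have hU2 : Uᴴ * U = 1 := Unitary.coe_star_mul_self hA.eigenvectorUnitary
  have hV1 : V * Vᴴ = 1 := Unitary.coe_mul_star_self hB.eigenvectorUnitary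
  have hV2 : Vᴴ * V = 1 := Unitary.coe_star_mul_self hB.eigenvectorUnitary
  set D := diagonal (fun i => (f (hA.eigenvalues i) : ℂ))
  set E := diagonal (fun i => (g (hB.eigenvalues i) : ℂ))
  have e : cfc f A - cfc g B = U * (D * (Uᴴ * V) - (Uᴴ * V) * E) * Vᴴ := by
    rw [cfc_eq_mul_diagonal_mul hA, cfc_eq_mul_diagonal_mul hB]
    change U * D * Uᴴ - V * E * Vᴴ = _
    simp only [Matrix.mul_sub, Matrix.sub_mul]
    refine congrArg₂ _ ?_ ?_
    · simp only [Matrix.mul_assoc, hV1, Matrix.mul_one]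
    · simp only [← Matrix.mul_assoc, hU1, Matrix.one_mul]
  rw [e, frobSq_mul_mul hU2 hV2]
  refine Finset.sum_congr rfl fun i _ => Finset.sum_congr rfl fun j _ => ?_
  rw [← mul_pow]
  refine congrArg (fun x : ℝ => x ^ 2) ?_
  rw [Matrix.sub_apply, Matrix.diagonal_mul, Matrix.mul_diagonal, mul_comm _ ((g _ : ℝ) : ℂ),
    ← sub_mul, norm_mul, ← Complex.ofReal_sub, Complex.norm_real, Real.norm_eq_abs]
  rfl

theorem sum_overlap_col {A B : Matrix n n ℂ} (hA : A.IsHermitian) (hB : B.IsHermitian) (j : n) :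
    ∑ i, ‖overlap hA hB i j‖ ^ 2 = 1 := by
  have hU1 : (hA.eigenvectorUnitary : Matrix n n ℂ) * (hA.eigenvectorUnitary : Matrix n n ℂ)ᴴ = 1 :=
    Unitary.coe_mul_star_self hA.eigenvectorUnitary
  have hV2 : (hB.eigenvectorUnitary : Matrix n n ℂ)ᴴ * (hB.eigenvectorUnitary : Matrix n n ℂ) = 1 :=
    Unitary.coe_star_mul_self hB.eigenvectorUnitary
  have h : (overlap hA hB)ᴴ * overlap hA hB = 1 := by
    simp only [overlap, conjTranspose_mul, conjTranspose_conjTranspose]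
    rw [Matrix.mul_assoc, ← Matrix.mul_assoc (hA.eigenvectorUnitary : Matrix n n ℂ)]
    rw [hU1, Matrix.one_mul, hV2]
  have h2 := congrFun (congrFun h j) j
  rw [Matrix.mul_apply, Matrix.one_apply_eq] at h2
  have : ((∑ i, ‖overlap hA hB i j‖ ^ 2 : ℝ) : ℂ) = 1 := by
    rw [← h2]
    push_cast
    refine Finset.sum_congr rfl fun i _ => ?_
    rw [← Complex.conj_mul', conjTranspose_apply]; rfl
  exact_mod_cast this

theorem frobSq_sub {A B : Matrix n n ℂ} (hA : A.IsHermitian) (hB : B.IsHermitian) :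
    frobSq (A - B) = ∑ i, ∑ j, |hA.eigenvalues i - hB.eigenvalues j| ^ 2 *
      ‖overlap hA hB i j‖ ^ 2 := by
  conv_lhs => rw [← cfc_id ℝ A hA.isSelfAdjoint, ← cfc_id ℝ B hB.isSelfAdjoint]
  exact frobSq_cfc_sub_cfc hA hB id id

/-- The functional calculus is Lipschitz for the Frobenius norm, with the same constant. -/
theorem frobSq_cfc_sub_le {A B : Matrix n n ℂ} (hA : A.IsHermitian) (hB : B.IsHermitian)
    {f : ℝ → ℝ} {s : Set ℝ} {L : ℝ} (hAs : spectrum ℝ A ⊆ s) (hBs : spectrum ℝ B ⊆ s)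
    (hf : ∀ x ∈ s, ∀ y ∈ s, |f x - f y| ≤ L * |x - y|) :
    frobSq (cfc f A - cfc f B) ≤ L ^ 2 * frobSq (A - B) := by
  rw [frobSq_cfc_sub_cfc hA hB, frobSq_sub hA hB, Finset.mul_sum]
  refine Finset.sum_le_sum fun i _ => ?_
  rw [Finset.mul_sum]
  refine Finset.sum_le_sum fun j _ => ?_
  have h := pow_le_pow_left₀ (abs_nonneg _) (hf _ (hAs (hA.eigenvalues_mem_spectrum_real i)) _
    (hBs (hB.eigenvalues_mem_spectrum_real j))) 2
  rw [mul_pow] at h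
  rw [← mul_assoc]
  exact mul_le_mul_of_nonneg_right h (sq_nonneg _)

/-- Every eigenvalue of `B` is within `‖A - B‖` of an eigenvalue of `A`. -/
theorem exists_spectrum_near {A B : Matrix n n ℂ} (hA : A.IsHermitian) (hB : B.IsHermitian)
    {y : ℝ} (hy : y ∈ spectrum ℝ B) : ∃ x ∈ spectrum ℝ A, |x - y| ^ 2 ≤ frobSq (A - B) := by
  rw [hB.spectrum_real_eq_range_eigenvalues] at hy
  obtain ⟨j, rfl⟩ := hy
  by_contra! hcon
  have h1 : ∀ i, frobSq (A - B) < |hA.eigenvalues i - hB.eigenvalues j| ^ 2 := fun i =>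
    hcon _ (hA.eigenvalues_mem_spectrum_real i)
  -- Only column `j` is kept. Its weights sum to one, so a weighted mean of the squared distances to
  -- the `j`-th eigenvalue of `B` is at most `‖A - B‖²`.
  have h2 : ∑ i, |hA.eigenvalues i - hB.eigenvalues j| ^ 2 * ‖overlap hA hB i j‖ ^ 2 ≤
      frobSq (A - B) := by
    rw [frobSq_sub hA hB]
    exact Finset.sum_le_sum fun i _ => Finset.single_le_sum
      (f := fun j => |hA.eigenvalues i - hB.eigenvalues j| ^ 2 * ‖overlap hA hB i j‖ ^ 2)
      (fun _ _ => by positivity) (Finset.mem_univ j)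
  have h3 : frobSq (A - B) < ∑ i, |hA.eigenvalues i - hB.eigenvalues j| ^ 2 *
      ‖overlap hA hB i j‖ ^ 2 := by
    calc frobSq (A - B) = ∑ i, frobSq (A - B) * ‖overlap hA hB i j‖ ^ 2 := by
          rw [← Finset.mul_sum, sum_overlap_col, mul_one]
      _ < _ := by
          obtain ⟨i, -, hi⟩ : ∃ i ∈ Finset.univ, 0 < ‖overlap hA hB i j‖ ^ 2 := by
            by_contra! h0
            have := Finset.sum_nonpos h0
            rw [sum_overlap_col] at this
            linarith
          exact Finset.sum_lt_sum (fun i _ => by gcongr; exact (h1 i).le)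
            ⟨i, Finset.mem_univ i, by gcongr; exact h1 i⟩
  linarith

end CfcToolkit

/-! ### Differentiability of matrix curves and of their functional calculus. -/

section Curves

variable {n m k : Type*} [Fintype n] [DecidableEq n] [Fintype m] [DecidableEq m]
  [Fintype k] [DecidableEq k]

/-- Entrywise derivative of a curve of matrices. -/
def HasMatDeriv (M : ℝ → Matrix m n ℂ) (M' : Matrix m n ℂ) (S : Set ℝ) (t : ℝ) : Prop :=
  ∀ i j, HasDerivWithinAt (fun s => M s i j) (M' i j) S t

theorem HasMatDeriv.of_differentiable {M : ℝ → Matrix m n ℂ} {S : Set ℝ} {t : ℝ}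
    (h : ∀ i j, DifferentiableWithinAt ℝ (fun s => M s i j) S t) :
    ∃ M', HasMatDeriv M M' S t :=
  ⟨Matrix.of fun i j => derivWithin (fun s => M s i j) S t, fun i j => (h i j).hasDerivWithinAt⟩

theorem hasMatDeriv_const (A : Matrix m n ℂ) (S : Set ℝ) (t : ℝ) :
    HasMatDeriv (fun _ => A) 0 S t := fun i j => hasDerivWithinAt_const t S (A i j)

theorem HasMatDeriv.tendsto {M : ℝ → Matrix m n ℂ} {M' : Matrix m n ℂ} {S : Set ℝ} {t : ℝ}
    (h : HasMatDeriv M M' S t) : Tendsto M (𝓝[S] t) (𝓝 (M t)) :=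
  tendsto_pi_nhds.2 fun i => tendsto_pi_nhds.2 fun j => (h i j).continuousWithinAt

theorem HasMatDeriv.add {M N : ℝ → Matrix m n ℂ} {M' N' : Matrix m n ℂ} {S : Set ℝ} {t : ℝ}
    (hM : HasMatDeriv M M' S t) (hN : HasMatDeriv N N' S t) :
    HasMatDeriv (fun s => M s + N s) (M' + N') S t := fun i j => (hM i j).add (hN i j)

theorem HasMatDeriv.sub {M N : ℝ → Matrix m n ℂ} {M' N' : Matrix m n ℂ} {S : Set ℝ} {t : ℝ}
    (hM : HasMatDeriv M M' S t) (hN : HasMatDeriv N N' S t) :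
    HasMatDeriv (fun s => M s - N s) (M' - N') S t := fun i j => (hM i j).sub (hN i j)

theorem HasMatDeriv.const_smul {M : ℝ → Matrix m n ℂ} {M' : Matrix m n ℂ} {S : Set ℝ} {t : ℝ}
    (c : ℂ) (hM : HasMatDeriv M M' S t) :
    HasMatDeriv (fun s => c • M s) (c • M') S t := fun i j => (hM i j).const_mul c

theorem HasMatDeriv.transpose {M : ℝ → Matrix m n ℂ} {M' : Matrix m n ℂ} {S : Set ℝ} {t : ℝ}
    (hM : HasMatDeriv M M' S t) : HasMatDeriv (fun s => (M s)ᵀ) M'ᵀ S t := fun i j => hM j i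

theorem HasMatDeriv.conjTranspose {M : ℝ → Matrix m n ℂ} {M' : Matrix m n ℂ} {S : Set ℝ} {t : ℝ}
    (hM : HasMatDeriv M M' S t) : HasMatDeriv (fun s => (M s)ᴴ) M'ᴴ S t := fun i j => (hM j i).star

theorem HasMatDeriv.mul {M : ℝ → Matrix m n ℂ} {N : ℝ → Matrix n k ℂ} {M' : Matrix m n ℂ}
    {N' : Matrix n k ℂ} {S : Set ℝ} {t : ℝ}
    (hM : HasMatDeriv M M' S t) (hN : HasMatDeriv N N' S t) :
    HasMatDeriv (fun s => M s * N s) (M' * N t + M t * N') S t := fun i j => by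
  simp only [Matrix.add_apply, Matrix.mul_apply, ← Finset.sum_add_distrib]
  exact HasDerivWithinAt.fun_sum fun l _ => (hM i l).mul (hN l j)

theorem HasMatDeriv.kronecker {M : ℝ → Matrix m m ℂ} {N : ℝ → Matrix n n ℂ} {M' : Matrix m m ℂ}
    {N' : Matrix n n ℂ} {S : Set ℝ} {t : ℝ}
    (hM : HasMatDeriv M M' S t) (hN : HasMatDeriv N N' S t) :
    HasMatDeriv (fun s => kroneckerMap (· * ·) (M s) (N s))
      (kroneckerMap (· * ·) M' (N t) + kroneckerMap (· * ·) (M t) N') S t :=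
  fun i j => (hM i.1 j.1).mul (hN i.2 j.2)

theorem differentiableWithinAt_det {M : ℝ → Matrix n n ℂ} {S : Set ℝ} {t : ℝ}
    (hM : ∀ i j, DifferentiableWithinAt ℝ (fun s => M s i j) S t) :
    DifferentiableWithinAt ℝ (fun s => (M s).det) S t := by
  simp only [Matrix.det_apply']
  refine DifferentiableWithinAt.fun_sum fun σ _ => DifferentiableWithinAt.const_mul ?_ _
  exact DifferentiableWithinAt.fun_finsetProd fun i _ => hM _ _

theorem HasMatDeriv.inv {M : ℝ → Matrix n n ℂ} {M' : Matrix n n ℂ} {S : Set ℝ} {t : ℝ}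
    (hM : HasMatDeriv M M' S t) (h0 : (M t).det ≠ 0) :
    ∃ N', HasMatDeriv (fun s => (M s)⁻¹) N' S t := by
  refine HasMatDeriv.of_differentiable fun i j => ?_
  have hd := differentiableWithinAt_det fun i j => (hM i j).differentiableWithinAt
  simp only [Matrix.inv_def, Matrix.smul_apply, smul_eq_mul, Ring.inverse_eq_inv',
    Matrix.adjugate_apply]
  refine (hd.inv h0).mul (differentiableWithinAt_det fun p q => ?_)
  by_cases hp : p = j
  · subst hp
    simpa using differentiableWithinAt_const _
  · simpa [Matrix.updateRow_ne hp] using (hM p q).differentiableWithinAt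

theorem hasDerivWithinAt_dotProduct_mulVec {v : ℝ → m → ℂ} {M : ℝ → Matrix m n ℂ} {w : ℝ → n → ℂ}
    {v' : m → ℂ} {M' : Matrix m n ℂ} {w' : n → ℂ} {S : Set ℝ} {t : ℝ}
    (hv : ∀ i, HasDerivWithinAt (fun s => v s i) (v' i) S t) (hM : HasMatDeriv M M' S t)
    (hw : ∀ i, HasDerivWithinAt (fun s => w s i) (w' i) S t) :
    HasDerivWithinAt (fun s => (star (v s) ⬝ᵥ M s *ᵥ w s).re)
      (star v' ⬝ᵥ M t *ᵥ w t + star (v t) ⬝ᵥ M' *ᵥ w t + star (v t) ⬝ᵥ M t *ᵥ w').re S t := by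
  have h : HasDerivWithinAt (fun s => star (v s) ⬝ᵥ M s *ᵥ w s)
      (star v' ⬝ᵥ M t *ᵥ w t + star (v t) ⬝ᵥ M' *ᵥ w t + star (v t) ⬝ᵥ M t *ᵥ w') S t := by
    simp only [dotProduct, mulVec, ← Finset.sum_add_distrib]
    refine HasDerivWithinAt.fun_sum fun i _ => ?_
    have h1 : HasDerivWithinAt (fun s => ∑ j, M s i j * w s j)
        (∑ j, (M' i j * w t j + M t i j * w' j)) S t :=
      HasDerivWithinAt.fun_sum fun j _ => (hM i j).mul (hw j)
    refine ((hv i).star.mul h1).congr_deriv ?_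
    simp only [Pi.star_apply, Finset.sum_add_distrib]
    ring
  exact Complex.reCLM.hasFDerivAt.comp_hasDerivWithinAt t h

/-- The slopes of `φ` stay within `η` of the convergent slopes of `ψ`, hence form a Cauchy filter.
Completeness supplies the derivative without a formula for it, so no divided differences are needed
for the functional calculus. -/
theorem differentiableWithinAt_of_approx {φ : ℝ → ℂ} {S : Set ℝ} {t : ℝ}
    (h : ∀ η > 0, ∃ ψ : ℝ → ℂ, DifferentiableWithinAt ℝ ψ S t ∧
      ∀ᶠ s in 𝓝[S] t, ‖(φ s - ψ s) - (φ t - ψ t)‖ ≤ η * |s - t|) :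
    DifferentiableWithinAt ℝ φ S t := by
  rcases (𝓝[S \ {t}] t).eq_or_neBot with hbot | hne
  · have h0 : HasDerivWithinAt φ 0 S t :=
      hasDerivWithinAt_iff_tendsto_slope.2 (by rw [hbot]; exact tendsto_bot)
    exact h0.differentiableWithinAt
  have hc : Cauchy (map (slope φ t) (𝓝[S \ {t}] t)) := by
    refine Metric.cauchy_iff.2 ⟨inferInstance, fun ε hε => ?_⟩
    obtain ⟨ψ, hψ, hap⟩ := h (ε / 8) (by positivity)
    have h1 := hasDerivWithinAt_iff_tendsto_slope.1 hψ.hasDerivWithinAt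
    refine ⟨Metric.ball (derivWithin ψ S t) (ε / 3), ?_, fun x hx y hy => ?_⟩
    · have h2 := h1 (Metric.ball_mem_nhds _ (show 0 < ε / 8 by positivity))
      rw [Filter.mem_map] at h2 ⊢
      filter_upwards [h2, self_mem_nhdsWithin, hap.filter_mono (nhdsWithin_mono _ sdiff_subset)]
        with s hs hsS hs2
      have hst : 0 < |s - t| := abs_pos.2 (sub_ne_zero.2 hsS.2)
      have h3 : ‖slope φ t s - slope ψ t s‖ ≤ ε / 8 := by
        rw [slope_def_module, slope_def_module, ← smul_sub, norm_smul, norm_inv, Real.norm_eq_abs,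
          inv_mul_le_iff₀ hst]
        calc _ = ‖(φ s - ψ s) - (φ t - ψ t)‖ := by congr 1; ring
          _ ≤ _ := hs2.trans_eq (mul_comm _ _)
      have h4 : dist (slope ψ t s) (derivWithin ψ S t) < ε / 8 := hs
      have h5 : dist (slope φ t s) (slope ψ t s) ≤ ε / 8 := by rwa [dist_eq_norm]
      have := dist_triangle (slope φ t s) (slope ψ t s) (derivWithin ψ S t)
      change dist _ _ < _
      linarith
    · have := dist_triangle_right x y (derivWithin ψ S t)
      simp only [Metric.mem_ball] at hx hy
      linarith
  obtain ⟨c, hc⟩ := CompleteSpace.complete hc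
  exact (hasDerivWithinAt_iff_tendsto_slope.2 hc).differentiableWithinAt

theorem tendsto_frobSq_sub {α : Type*} {l : Filter α} {M : α → Matrix n n ℂ} {M₀ : Matrix n n ℂ}
    (h : Tendsto M l (𝓝 M₀)) : Tendsto (fun x => frobSq (M₀ - M x)) l (𝓝 0) := by
  have : Continuous fun A : Matrix n n ℂ => frobSq (M₀ - A) := by
    unfold frobSq
    exact continuous_finsetSum _ fun i _ => continuous_finsetSum _ fun j _ =>
      ((continuous_const.sub (continuous_apply_apply i j)).norm.pow 2)
  have h2 := (this.tendsto M₀).comp h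
  simpa [frobSq, Function.comp_def] using h2

/-- The spectrum of Hermitian matrices is upper semicontinuous. -/
theorem eventually_spectrum_subset {α : Type*} {l : Filter α} {M : α → Matrix n n ℂ}
    {M₀ : Matrix n n ℂ} (h : Tendsto M l (𝓝 M₀)) (h0 : M₀.IsHermitian)
    (hM : ∀ᶠ x in l, (M x).IsHermitian) {a b : ℝ} (hs : spectrum ℝ M₀ ⊆ Ioo a b) :
    ∀ᶠ x in l, spectrum ℝ (M x) ⊆ Ioo a b := by
  obtain ⟨δ, hδ, hball⟩ : ∃ δ > 0, ∀ x ∈ spectrum ℝ M₀, ∀ y, |x - y| < δ → y ∈ Ioo a b := by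
    obtain ⟨δ, hδ, hsub⟩ := (Matrix.finite_real_spectrum (A := M₀)).isCompact.exists_thickening_subset_open
      isOpen_Ioo hs
    exact ⟨δ, hδ, fun x hx y hxy => hsub (Metric.mem_thickening_iff.2
      ⟨x, hx, by rwa [dist_comm, Real.dist_eq]⟩)⟩
  filter_upwards [hM, (tendsto_frobSq_sub h).eventually_lt_const (show 0 < δ ^ 2 by positivity)]
    with x hx hlt y hy
  obtain ⟨z, hz, hzy⟩ := exists_spectrum_near h0 hx hy
  exact hball z hz y (lt_of_pow_lt_pow_left₀ 2 hδ.le (hzy.trans_lt hlt))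

/-- An open window away from `0` also captures the spectra of all nearby Hermitian matrices, and on
its closure `C¹` functions are Lipschitz. -/
theorem exists_spectrum_subset_Ioo {A : Matrix n n ℂ} (hA : A.PosDef) :
    ∃ a b : ℝ, 0 < a ∧ a < b ∧ spectrum ℝ A ⊆ Ioo a b := by
  have hfin := Matrix.finite_real_spectrum (A := A)
  obtain ⟨δ, hδ, hsub⟩ := hfin.isCompact.exists_cthickening_subset_open isOpen_Ioi
    (fun x hx => spectrum_pos hA hx : spectrum ℝ A ⊆ Ioi 0)
  obtain ⟨b, hb⟩ := hfin.bddAbove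
  refine ⟨δ / 2, max b δ + 1, by positivity, ?_, fun x hx => ⟨?_, ?_⟩⟩
  · have := le_max_right b δ; linarith
  · have : x - δ ∈ Metric.cthickening δ (spectrum ℝ A) :=
      Metric.mem_cthickening_of_dist_le _ x _ _ hx (by simp [abs_of_pos hδ])
    have := hsub this
    simp only [mem_Ioi] at this
    linarith
  · have := hb hx
    have := le_max_left b δ
    linarith

theorem exists_derivative_eq (q : Polynomial ℝ) : ∃ p : Polynomial ℝ, p.derivative = q := by
  induction q using Polynomial.induction_on' with
  | add p q hp hq =>
    obtain ⟨a, ha⟩ := hp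
    obtain ⟨b, hb⟩ := hq
    exact ⟨a + b, by simp [ha, hb]⟩
  | monomial j a =>
    refine ⟨Polynomial.monomial (j + 1) (a / (j + 1)), ?_⟩
    rw [Polynomial.derivative_monomial]
    congr 1
    push_cast
    field_simp

/-- Weierstrass approximation in `C¹`. -/
theorem exists_polynomial_lipschitz_sub {f : ℝ → ℝ} (hf : ContDiffOn ℝ 1 f (Ioi 0)) {a b : ℝ}
    (ha : 0 < a) {η : ℝ} (hη : 0 < η) :
    ∃ p : Polynomial ℝ, ∀ x ∈ Icc a b, ∀ y ∈ Icc a b,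
      |(f x - p.eval x) - (f y - p.eval y)| ≤ η * |x - y| := by
  have hsub : Icc a b ⊆ Ioi 0 := fun x hx => ha.trans_le hx.1
  have hd := (contDiffOn_succ_iff_deriv_of_isOpen (n := 0) isOpen_Ioi).1 (by simpa using hf)
  -- The derivative is approximated uniformly and then integrated; the mean value inequality
  -- controls the increments.
  obtain ⟨q, hq⟩ := exists_polynomial_near_of_continuousOn a b (deriv f)
    (hd.2.2.continuousOn.mono hsub) η hη
  obtain ⟨p, rfl⟩ := exists_derivative_eq q
  refine ⟨p, fun x hx y hy => ?_⟩
  have := (convex_Icc a b).norm_image_sub_le_of_norm_hasDerivWithin_le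
    (f := fun x => f x - p.eval x) (f' := fun x => deriv f x - p.derivative.eval x) (C := η)
    (fun z hz => (((hd.1 z (hsub hz)).differentiableAt
      (isOpen_Ioi.mem_nhds (hsub hz))).hasDerivAt.sub (p.hasDerivAt z)).hasDerivWithinAt)
    (fun z hz => by rw [norm_sub_rev]; exact (hq z hz).le) hy hx
  simpa [Real.norm_eq_abs] using this

theorem exists_lipschitz {f : ℝ → ℝ} (hf : ContDiffOn ℝ 1 f (Ioi 0)) {a b : ℝ} (ha : 0 < a) :
    ∃ L, 0 ≤ L ∧ ∀ x ∈ Icc a b, ∀ y ∈ Icc a b, |f x - f y| ≤ L * |x - y| := by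
  have hsub : Icc a b ⊆ Ioi 0 := fun x hx => ha.trans_le hx.1
  have hd := (contDiffOn_succ_iff_deriv_of_isOpen (n := 0) isOpen_Ioi).1 (by simpa using hf)
  obtain ⟨L, hL⟩ := isCompact_Icc.exists_bound_of_continuousOn (hd.2.2.continuousOn.mono hsub)
  refine ⟨max L 0, le_max_right _ _, fun x hx y hy => ?_⟩
  have := (convex_Icc a b).norm_image_sub_le_of_norm_hasDerivWithin_le (C := max L 0)
    (fun z hz => ((hd.1 z (hsub hz)).differentiableAt
      (isOpen_Ioi.mem_nhds (hsub hz))).hasDerivAt.hasDerivWithinAt)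
    (fun z hz => (hL z hz).trans (le_max_left _ _)) hy hx
  simpa [Real.norm_eq_abs] using this

theorem HasMatDeriv.aeval {M : ℝ → Matrix n n ℂ} {M' : Matrix n n ℂ} {S : Set ℝ} {t : ℝ}
    (hM : HasMatDeriv M M' S t) (p : Polynomial ℝ) :
    ∃ N', HasMatDeriv (fun s => Polynomial.aeval (M s) p) N' S t := by
  induction p using Polynomial.induction_on' with
  | add p q hp hq =>
    obtain ⟨a, ha⟩ := hp
    obtain ⟨b, hb⟩ := hq
    exact ⟨a + b, by simpa using ha.add hb⟩
  | monomial j c =>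
    have hj : ∃ N', HasMatDeriv (fun s => M s ^ j) N' S t := by
      induction j with
      | zero => exact ⟨0, by simpa using hasMatDeriv_const (1 : Matrix n n ℂ) S t⟩
      | succ j ih =>
        obtain ⟨a, ha⟩ := ih
        simp only [pow_succ]
        exact ⟨_, ha.mul hM⟩
    obtain ⟨a, ha⟩ := hj
    refine ⟨(c : ℂ) • a, ?_⟩
    have := ha.const_smul (c : ℂ)
    simpa only [Polynomial.aeval_monomial, ← Algebra.smul_def, Complex.coe_smul] using this

theorem HasMatDeriv.eventually_sqrt_frobSq_le {M : ℝ → Matrix n n ℂ} {M' : Matrix n n ℂ}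
    {S : Set ℝ} {t : ℝ} (hM : HasMatDeriv M M' S t) {C : ℝ} (hC : √(frobSq M') < C) :
    ∀ᶠ s in 𝓝[S] t, √(frobSq (M s - M t)) ≤ C * |s - t| := by
  have h1 : Tendsto (fun s => √(frobSq (Matrix.of fun i j => slope (fun s => M s i j) t s)))
      (𝓝[S \ {t}] t) (𝓝 (√(frobSq M'))) := by
    refine (Real.continuous_sqrt.tendsto _).comp ?_
    unfold frobSq
    exact tendsto_finsetSum _ fun i _ => tendsto_finsetSum _ fun j _ =>
      (hasDerivWithinAt_iff_tendsto_slope.1 (hM i j)).norm.pow 2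
  have h2 := h1.eventually_lt_const hC
  rw [eventually_nhdsWithin_iff] at h2 ⊢
  filter_upwards [h2] with s hs hsS
  by_cases hst : s = t
  · subst hst; simp [frobSq]
  have hpos : 0 < |s - t| := abs_pos.2 (sub_ne_zero.2 hst)
  have h3 := hs ⟨hsS, hst⟩
  have h4 : frobSq (M s - M t) =
      |s - t| ^ 2 * frobSq (Matrix.of fun i j => slope (fun s => M s i j) t s) := by
    simp only [frobSq, Finset.mul_sum]
    refine Finset.sum_congr rfl fun i _ => Finset.sum_congr rfl fun j _ => ?_
    rw [Matrix.of_apply, slope_def_module, norm_smul, norm_inv, Real.norm_eq_abs, ← mul_pow,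
      mul_inv_cancel_left₀ hpos.ne', Matrix.sub_apply]
  rw [h4, Real.sqrt_mul (sq_nonneg _), Real.sqrt_sq hpos.le, mul_comm]
  exact mul_le_mul_of_nonneg_right h3.le hpos.le

theorem norm_cfc_apply_sub_le {A B : Matrix n n ℂ} (hA : A.IsHermitian) (hB : B.IsHermitian)
    {f : ℝ → ℝ} {s : Set ℝ} {L : ℝ} (hL : 0 ≤ L) (hAs : spectrum ℝ A ⊆ s) (hBs : spectrum ℝ B ⊆ s)
    (hf : ∀ x ∈ s, ∀ y ∈ s, |f x - f y| ≤ L * |x - y|) (i j : n) :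
    ‖cfc f A i j - cfc f B i j‖ ≤ L * √(frobSq (A - B)) := by
  rw [← Matrix.sub_apply]
  refine (norm_apply_le_sqrt_frobSq _ i j).trans ?_
  refine (Real.sqrt_le_sqrt (frobSq_cfc_sub_le hA hB hAs hBs hf)).trans_eq ?_
  rw [Real.sqrt_mul (sq_nonneg _), Real.sqrt_sq hL]

/-- Polynomials of `M s` are differentiable. If `f - p` has Lipschitz constant `η / C` on the
window, its functional calculus moves by at most `η |s - t|`, because `M` moves by at most `C |s -
t|`. -/
theorem HasMatDeriv.cfc {M : ℝ → Matrix n n ℂ} {M' : Matrix n n ℂ} {S : Set ℝ} {t : ℝ}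
    (hM : HasMatDeriv M M' S t) (hpd : (M t).PosDef) (hh : ∀ᶠ s in 𝓝[S] t, (M s).IsHermitian)
    {f : ℝ → ℝ} (hf : ContDiffOn ℝ 1 f (Ioi 0)) :
    ∃ N', HasMatDeriv (fun s => _root_.cfc f (M s)) N' S t := by
  refine HasMatDeriv.of_differentiable fun i j => differentiableWithinAt_of_approx fun η hη => ?_
  obtain ⟨a, b, ha, -, hab⟩ := exists_spectrum_subset_Ioo hpd
  set C := √(frobSq M') + 1
  have hC : 0 < C := by positivity
  obtain ⟨p, hp⟩ := exists_polynomial_lipschitz_sub hf (b := b) ha (div_pos hη hC)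
  obtain ⟨N', hN⟩ := hM.aeval p
  refine ⟨fun s => Polynomial.aeval (M s) p i j, (hN i j).differentiableWithinAt, ?_⟩
  filter_upwards [hh, eventually_spectrum_subset hM.tendsto hpd.isHermitian hh hab,
    hM.eventually_sqrt_frobSq_le (lt_add_one _ : _ < C)] with s hs hsp hle
  have e : ∀ A : Matrix n n ℂ, A.IsHermitian → _root_.cfc f A i j - Polynomial.aeval A p i j =
      _root_.cfc (fun x => f x - p.eval x) A i j := fun A hA => by
    rw [cfc_sub f (fun x => p.eval x) A (continuousOn_spectrum _ _) (continuousOn_spectrum _ _),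
      cfc_polynomial p A hA.isSelfAdjoint]
    rfl
  rw [e _ hs, e _ hpd.isHermitian]
  refine (norm_cfc_apply_sub_le hs hpd.isHermitian (div_pos hη hC).le (hsp.trans Ioo_subset_Icc_self)
    (hab.trans Ioo_subset_Icc_self) hp i j).trans ?_
  calc η / C * √(frobSq (M s - M t)) ≤ η / C * (C * |s - t|) := by gcongr
    _ = η * |s - t| := by field_simp

/-- The bound is linear in the velocity `M'`, with a constant that depends only on the window. It
later makes the derivative along a curve of speed `O(ε)` itself `O(ε)`. -/
theorem HasMatDeriv.norm_cfc_le {M : ℝ → Matrix n n ℂ} {M' N' : Matrix n n ℂ} {S : Set ℝ} {t : ℝ}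
    [NeBot (𝓝[S \ {t}] t)]
    (hM : HasMatDeriv M M' S t) (hpd : (M t).PosDef) (hh : ∀ᶠ s in 𝓝[S] t, (M s).IsHermitian)
    {f : ℝ → ℝ} (hN : HasMatDeriv (fun s => _root_.cfc f (M s)) N' S t) {a b L : ℝ} (hL : 0 ≤ L)
    (hab : spectrum ℝ (M t) ⊆ Ioo a b)
    (hf : ∀ x ∈ Icc a b, ∀ y ∈ Icc a b, |f x - f y| ≤ L * |x - y|) (i j : n) :
    ‖N' i j‖ ≤ L * √(frobSq M') := by
  refine le_of_forall_gt_imp_ge_of_dense fun c hc => ?_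
  obtain ⟨C, hC1, hC2⟩ : ∃ C, √(frobSq M') < C ∧ L * C ≤ c := by
    rcases hL.eq_or_lt with h0 | h0
    · exact ⟨√(frobSq M') + 1, lt_add_one _, by subst h0; simp at hc ⊢; exact hc.le⟩
    · exact ⟨c / L, by rwa [lt_div_iff₀ h0, mul_comm], by field_simp; exact le_rfl⟩
  have h1 := (hasDerivWithinAt_iff_tendsto_slope.1 (hN i j)).norm
  refine le_of_tendsto h1 ?_
  have hmono : 𝓝[S \ {t}] t ≤ 𝓝[S] t := nhdsWithin_mono _ sdiff_subset
  filter_upwards [hh.filter_mono hmono, (eventually_spectrum_subset hM.tendsto hpd.isHermitian hh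
    hab).filter_mono hmono, (hM.eventually_sqrt_frobSq_le hC1).filter_mono hmono,
    self_mem_nhdsWithin] with s hs hsp hle hsS
  have hst : 0 < |s - t| := abs_pos.2 (sub_ne_zero.2 hsS.2)
  rw [slope_def_module, norm_smul, norm_inv, Real.norm_eq_abs, inv_mul_le_iff₀ hst]
  refine (norm_cfc_apply_sub_le hs hpd.isHermitian hL (hsp.trans Ioo_subset_Icc_self)
    (hab.trans Ioo_subset_Icc_self) hf i j).trans ?_
  calc L * √(frobSq (M s - M t)) ≤ L * (C * |s - t|) := by gcongr
    _ = |s - t| * (L * C) := by ring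
    _ ≤ |s - t| * c := by gcongr

end Curves

/-! ### Hansen's inequality and monotonicity of operator means. -/

section Hansen

variable {n m k : Type*} [Fintype n] [DecidableEq n] [Fintype m] [DecidableEq m]
  [Fintype k] [DecidableEq k]

theorem cfc_reindex (e : n ≃ m) (f : ℝ → ℝ) {A : Matrix n n ℂ} (hA : A.IsHermitian) :
    cfc f (reindexAlgEquiv ℝ ℂ e A) = reindexAlgEquiv ℝ ℂ e (cfc f A) := by
  have hB : (reindexAlgEquiv ℝ ℂ e A).IsHermitian := by
    rw [coe_reindexAlgEquiv, reindex_apply]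
    exact hA.submatrix _
  obtain ⟨p, h1, h2⟩ := exists_polynomial_cfc f hA hB
  rw [h1, h2]
  exact Polynomial.aeval_algHom_apply (reindexAlgEquiv ℝ ℂ e).toAlgHom A p

/-- The defining property speaks of `Fin n` only; block matrices and superoperators need other index
types. -/
theorem IsStandardMonotone.monotone_fintype {f : ℝ → ℝ} (hf : IsStandardMonotone f)
    {A B : Matrix n n ℂ} (hA : A.PosDef) (hAB : (B - A).PosSemidef) :
    (cfc f B - cfc f A).PosSemidef := by
  have hB : B.PosDef := by simpa using hA.add_posSemidef hAB
  let e := Fintype.equivFin n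
  have hpd : ∀ {X : Matrix n n ℂ}, X.PosDef → (reindexAlgEquiv ℝ ℂ e X).PosDef := fun h => by
    rw [coe_reindexAlgEquiv, reindex_apply]
    exact h.submatrix e.symm.injective
  have h := hf.monotone (Fintype.card n) _ _ (hpd hA) (hpd hB) (by
    rw [← map_sub, coe_reindexAlgEquiv, reindex_apply]
    exact hAB.submatrix _)
  rw [cfc_reindex e f hA.isHermitian, cfc_reindex e f hB.isHermitian, ← map_sub,
    coe_reindexAlgEquiv, reindex_apply] at h
  exact (posSemidef_submatrix_equiv e.symm).1 h

theorem cfc_diagonal (f : ℝ → ℝ) (x : n → ℝ) :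
    cfc f (diagonal (fun i => (x i : ℂ))) = diagonal (fun i => (f (x i) : ℂ)) := by
  have hA : (diagonal (fun i => (x i : ℂ))).IsHermitian := by
    rw [Matrix.isHermitian_diagonal_iff]
    intro i
    simp [IsSelfAdjoint]
  classical
  -- Interpolating on the spectrum together with the diagonal entries avoids having to identify the
  -- two sets.
  let S : Finset ℝ := (Matrix.finite_real_spectrum (A := diagonal (fun i => (x i : ℂ)))).toFinset ∪
    Finset.univ.image x
  have key : ∀ y ∈ S, (Lagrange.interpolate S id f).eval y = f y := fun y hy =>
    Lagrange.eval_interpolate_at_node (v := id) f Function.injective_id.injOn hy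
  rw [cfc_eq_aeval hA (Lagrange.interpolate S id f) fun y hy => key y (by simp [S, hy])]
  have h2 : ∀ p : Polynomial ℝ, Polynomial.aeval (diagonal (fun i => (x i : ℂ))) p =
      diagonal (fun i => ((p.eval (x i) : ℝ) : ℂ)) := by
    intro p
    induction p using Polynomial.induction_on' with
    | add p q hp hq => simp [hp, hq, Matrix.diagonal_add]
    | monomial j c =>
      rw [Polynomial.aeval_monomial, ← Algebra.smul_def, Matrix.diagonal_pow, ← Matrix.diagonal_smul]
      congr 1
      ext i
      simp
  rw [h2]
  congr 1
  ext i
  rw [key (x i) (by simp [S])]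

theorem IsStandardMonotone.mono {f : ℝ → ℝ} (hf : IsStandardMonotone f) {x y : ℝ} (hx : 0 < x)
    (hxy : x ≤ y) : f x ≤ f y := by
  have h := hf.monotone_fintype (n := Unit) (A := diagonal fun _ => (x : ℂ))
    (B := diagonal fun _ => (y : ℂ)) (PosDef.diagonal fun _ => by exact_mod_cast hx) (by
      rw [Matrix.diagonal_sub]
      refine PosSemidef.diagonal fun _ => ?_
      rw [← Complex.ofReal_sub]
      exact Complex.zero_le_real.2 (sub_nonneg.2 hxy))
  rw [cfc_diagonal f (fun _ => x), cfc_diagonal f (fun _ => y), Matrix.diagonal_sub,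
    posSemidef_diagonal_iff] at h
  have := h ()
  rw [← Complex.ofReal_sub] at this
  exact sub_nonneg.1 (by exact_mod_cast this)

/-- By the symmetry `f(x) / x = f(1 / x)`, so monotonicity of `f` makes `f(x) / x` decreasing. -/
theorem IsStandardMonotone.map_mul_le {f : ℝ → ℝ} (hf : IsStandardMonotone f) {c x : ℝ}
    (hc : 1 ≤ c) (hx : 0 < x) : f (c * x) ≤ c * f x := by
  have hc0 : 0 < c := one_pos.trans_le hc
  have hle : f (c * x)⁻¹ ≤ f x⁻¹ := hf.mono (by positivity) (by
    rw [mul_inv]; exact mul_le_of_le_one_left (by positivity) (inv_le_one_of_one_le₀ hc))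
  rw [hf.symm (c * x) (by positivity), hf.symm x hx, mul_assoc]
  gcongr

theorem IsStandardMonotone.cfc_smul_le {f : ℝ → ℝ} (hf : IsStandardMonotone f) {c : ℝ}
    (hc : 1 ≤ c) {A : Matrix n n ℂ} (hA : A.PosDef) : (c • cfc f A - cfc f (c • A)).PosSemidef := by
  rw [← cfc_comp_const_mul c f A ((Matrix.finite_real_spectrum.image _).continuousOn _)
    hA.isHermitian.isSelfAdjoint, ← cfc_const_mul c f A (continuousOn_spectrum _ _)]
  exact posSemidef_cfc_sub hA fun x hx => hf.map_mul_le hc hx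

theorem posSemidef_of_forall_one_lt {X Y : Matrix n n ℂ} (hX : X.IsHermitian) (hY : Y.IsHermitian)
    (h : ∀ c : ℝ, 1 < c → (c • X - Y).PosSemidef) : (X - Y).PosSemidef := by
  refine PosSemidef.of_dotProduct_mulVec_nonneg (hX.sub hY) fun x => ?_
  have h1 : Tendsto (fun c : ℝ => star x ⬝ᵥ (c • X - Y) *ᵥ x) (𝓝[>] 1)
      (𝓝 (star x ⬝ᵥ ((1 : ℝ) • X - Y) *ᵥ x)) := by
    have : Continuous fun c : ℝ => star x ⬝ᵥ (c • X - Y) *ᵥ x := by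
      simp only [Matrix.sub_mulVec, Matrix.smul_mulVec, dotProduct_sub, dotProduct_smul]
      fun_prop
    exact (this.tendsto 1).mono_left nhdsWithin_le_nhds
  rw [one_smul] at h1
  exact ge_of_tendsto h1 (eventually_nhdsWithin_of_forall fun c hc =>
    (h c hc).dotProduct_mulVec_nonneg x)

/-- Jensen's operator inequality for isometries, up to a factor. -/
theorem IsStandardMonotone.hansen_isometry {f : ℝ → ℝ} (hf : IsStandardMonotone f)
    {A : Matrix m m ℂ} (hA : A.PosDef) {W : Matrix m n ℂ} (hW : Wᴴ * W = 1) {c : ℝ} (hc : 1 < c) :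
    (c • cfc f (Wᴴ * A * W) - Wᴴ * cfc f A * W).PosSemidef := by
  obtain ⟨a, ha, rfl⟩ : ∃ a : ℝ, 0 < a ∧ c = 1 + a ^ 2 :=
    ⟨√(c - 1), Real.sqrt_pos.2 (by linarith), by rw [Real.sq_sqrt (by linarith)]; ring⟩
  have hpd : (Wᴴ * A * W).PosDef := hA.conjTranspose_mul_mul_same fun x y hxy => by
    have := congrArg (fun z => Wᴴ *ᵥ z) hxy
    simpa [Matrix.mulVec_mulVec, hW] using this
  set P := W * Wᴴ with hP
  have hPW : P * W = W := by rw [hP, Matrix.mul_assoc, hW, Matrix.mul_one]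
  have hPh : Pᴴ = P := by simp [hP]
  -- The weights `a` and `-a⁻¹` have product `-1`, so the off-diagonal blocks of `T A T` with
  -- respect to `P` cancel those of `A`. Thus `B ≥ A` leaves the range of `W` invariant and acts
  -- there as `(1 + a²) Wᴴ A W`; the price is the factor `1 + a² = c`.
  set T := a • P - a⁻¹ • (1 - P) with hT
  have hTh : Tᴴ = T := by simp [hT, hPh]
  set B := A + Tᴴ * A * T with hB
  have hBA : (B - A).PosSemidef := by
    rw [hB, add_sub_cancel_left]; exact hA.posSemidef.conjTranspose_mul_mul_same T
  have hBpd : B.PosDef := hA.add_posSemidef (hA.posSemidef.conjTranspose_mul_mul_same T)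
  have hTW : T * W = a • W := by
    simp [hT, Matrix.sub_mul, hPW]
  have hBW : B * W = W * ((1 + a ^ 2) • (Wᴴ * A * W)) := by
    have e1 : T * (A * W) = a • (P * (A * W)) - a⁻¹ • (A * W - P * (A * W)) := by
      simp [hT, Matrix.sub_mul]
    rw [hB, hTh, Matrix.add_mul, Matrix.mul_assoc _ T W, hTW, Matrix.mul_smul, Matrix.mul_smul,
      Matrix.mul_assoc T, e1, hP]
    simp only [Matrix.mul_assoc, smul_sub, smul_smul, mul_inv_cancel₀ ha.ne', one_smul]
    rw [add_smul, one_smul, pow_two]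
    abel
  have h1 := (hf.monotone_fintype hA hBA).conjTranspose_mul_mul_same W
  have hCh : ((1 + a ^ 2) • (Wᴴ * A * W)).IsHermitian := by
    have := hpd.isHermitian.eq
    simp [Matrix.IsHermitian, this]
  have h2 : Wᴴ * cfc f B * W = cfc f ((1 + a ^ 2) • (Wᴴ * A * W)) := by
    rw [Matrix.mul_assoc, cfc_mul_of_intertwines f hBpd.isHermitian hCh hBW, ← Matrix.mul_assoc, hW,
      Matrix.one_mul]
  rw [Matrix.mul_sub, Matrix.sub_mul, h2] at h1
  simpa using (hf.cfc_smul_le (by nlinarith : (1 : ℝ) ≤ 1 + a ^ 2) hpd).add h1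

theorem exists_posSemidef_sub_smul_one {A : Matrix n n ℂ} (hA : A.PosDef) :
    ∃ a : ℝ, 0 < a ∧ (A - a • (1 : Matrix n n ℂ)).PosSemidef := by
  obtain ⟨a, b, ha, -, hab⟩ := exists_spectrum_subset_Ioo hA
  refine ⟨a, ha, ?_⟩
  have hs := hA.isHermitian.isSelfAdjoint
  have : A - a • (1 : Matrix n n ℂ) = cfc (fun x => x - a) A := by
    rw [cfc_sub _ _ A (continuousOn_spectrum _ _) (continuousOn_spectrum _ _), cfc_id' ℝ A hs,
      cfc_const a A hs, Algebra.algebraMap_eq_smul_one]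
  rw [this]
  exact posSemidef_cfc hA.isHermitian fun x hx => sub_nonneg.2 (hab hx).1.le

theorem posDef_fromBlocks_diagonal {X : Matrix n n ℂ} (hX : X.PosDef) {Z : Matrix m m ℂ}
    (hZ : Z.PosDef) : (fromBlocks X 0 0 Z).PosDef := by
  refine PosDef.of_dotProduct_mulVec_pos (hX.isHermitian.fromBlocks (by simp) hZ.isHermitian)
    fun {x} hx => ?_
  have e : star x ⬝ᵥ fromBlocks X 0 0 Z *ᵥ x = star (x ∘ Sum.inl) ⬝ᵥ X *ᵥ (x ∘ Sum.inl) +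
      star (x ∘ Sum.inr) ⬝ᵥ Z *ᵥ (x ∘ Sum.inr) := by
    rw [fromBlocks_mulVec]
    simp [dotProduct, Fintype.sum_sum_type]
  rw [e]
  by_cases h : x ∘ Sum.inl = 0
  · have h2 : x ∘ Sum.inr ≠ 0 := fun h2 => hx (by
      ext (i | i)
      · exact congrFun h i
      · exact congrFun h2 i)
    exact add_pos_of_nonneg_of_pos (hX.posSemidef.dotProduct_mulVec_nonneg _)
      (hZ.dotProduct_mulVec_pos h2)
  · exact add_pos_of_pos_of_nonneg (hX.dotProduct_mulVec_pos h)
      (hZ.posSemidef.dotProduct_mulVec_nonneg _)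

/-- Each coordinate embedding intertwines the block matrix with one of its blocks, and the two
embeddings side by side form the identity. -/
theorem cfc_fromBlocks_diagonal (f : ℝ → ℝ) {X : Matrix n n ℂ} (hX : X.IsHermitian)
    {Z : Matrix m m ℂ} (hZ : Z.IsHermitian) :
    cfc f (fromBlocks X 0 0 Z) = fromBlocks (cfc f X) 0 0 (cfc f Z) := by
  have hA : (fromBlocks X 0 0 Z).IsHermitian := hX.fromBlocks (by simp) hZ
  have h1 := cfc_mul_of_intertwines f hA hX (W := fromRows 1 0) (by
    rw [fromBlocks_mul_fromRows, fromRows_mul]; simp)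
  have h2 := cfc_mul_of_intertwines f hA hZ (W := fromRows 0 1) (by
    rw [fromBlocks_mul_fromRows, fromRows_mul]; simp)
  have e : fromCols (fromRows 1 0) (fromRows 0 1) = (1 : Matrix (n ⊕ m) (n ⊕ m) ℂ) := by
    rw [fromCols_fromRows_eq_fromBlocks, fromBlocks_one]
  rw [← Matrix.mul_one (cfc f (fromBlocks X 0 0 Z)), ← e, mul_fromCols, h1, h2, fromRows_mul,
    fromRows_mul, fromCols_fromRows_eq_fromBlocks]
  simp

/-- Hansen's inequality. -/
theorem IsStandardMonotone.hansen {f : ℝ → ℝ} (hf : IsStandardMonotone f)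
    {X : Matrix n n ℂ} (hX : X.PosDef) {Y : Matrix m m ℂ} (hY : Y.PosDef) {V : Matrix n m ℂ}
    (hV : (1 - Vᴴ * V).PosSemidef) (hXY : (Y - Vᴴ * X * V).PosSemidef) :
    (cfc f Y - Vᴴ * cfc f X * V).PosSemidef := by
  have hVh : (Vᴴ * cfc f X * V).IsHermitian :=
    isHermitian_conjTranspose_mul_mul V (isHermitian_cfc f X)
  obtain ⟨D, hD⟩ : ∃ D : Matrix m m ℂ, 1 - Vᴴ * V = Dᴴ * D :=
    ⟨_, by rw [(isHermitian_cfc Real.sqrt _).eq, cfc_sqrt_mul_self hV]⟩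
  have key : ∀ c : ℝ, 1 < c → ((c * c) • cfc f Y - Vᴴ * cfc f X * V).PosSemidef := by
    intro c hc
    obtain ⟨a, ha, haY⟩ := exists_posSemidef_sub_smul_one hY
    -- The contraction `V` is completed by `D` to an isometry, with `η 1` as filler block. Its
    -- contribution `η Dᴴ D ≤ η 1` is absorbed by the slack `(c - 1) Y ≥ η 1`.
    set η : ℝ := (c - 1) * a
    have hη : 0 < η := mul_pos (by linarith) ha
    set Z : Matrix m m ℂ := η • (1 : Matrix m m ℂ) with hZ
    have hZpd : Z.PosDef := Matrix.PosDef.one.smul hη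
    set A : Matrix (n ⊕ m) (n ⊕ m) ℂ := fromBlocks X 0 0 Z with hA
    set W : Matrix (n ⊕ m) m ℂ := fromRows V D with hW
    have hWW : Wᴴ * W = 1 := by
      rw [hW, conjTranspose_fromRows_eq_fromCols_conjTranspose, fromCols_mul_fromRows, ← hD]; simp
    have hApd : A.PosDef := posDef_fromBlocks_diagonal hX hZpd
    have hAh := hApd.isHermitian
    have hWAW : Wᴴ * A * W = Vᴴ * X * V + Dᴴ * Z * D := by
      rw [hW, hA, conjTranspose_fromRows_eq_fromCols_conjTranspose, fromCols_mul_fromBlocks,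
        fromCols_mul_fromRows]
      simp
    have hWfW : Wᴴ * cfc f A * W = Vᴴ * cfc f X * V + Dᴴ * cfc f Z * D := by
      rw [hA, cfc_fromBlocks_diagonal f hX.isHermitian hZpd.isHermitian, hW,
        conjTranspose_fromRows_eq_fromCols_conjTranspose, fromCols_mul_fromBlocks,
        fromCols_mul_fromRows]
      simp
    have h1 := hf.hansen_isometry hApd hWW hc
    have hpd : (Wᴴ * A * W).PosDef := hApd.conjTranspose_mul_mul_same fun x y hxy => by
      have := congrArg (fun z => Wᴴ *ᵥ z) hxy
      simpa [Matrix.mulVec_mulVec, hWW] using this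
    have h2 : (c • Y - Wᴴ * A * W).PosSemidef := by
      have e : c • Y - Wᴴ * A * W = (Y - Vᴴ * X * V) + (c - 1) • (Y - a • (1 : Matrix m m ℂ)) +
          η • (Vᴴ * V) := by
        rw [hWAW, hZ, Matrix.mul_smul, Matrix.smul_mul, Matrix.mul_one, ← hD, smul_sub η,
          smul_sub (c - 1), smul_smul, sub_smul c 1 Y, one_smul]
        abel
      rw [e]
      exact (hXY.add (haY.smul (by linarith : (0 : ℝ) ≤ c - 1))).add
        ((posSemidef_conjTranspose_mul_self V).smul hη.le)
    have h3 := (hf.monotone_fintype hpd h2).smul (by linarith : (0 : ℝ) ≤ c)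
    have h4 := (hf.cfc_smul_le hc.le hY).smul (by linarith : (0 : ℝ) ≤ c)
    -- Positivity of `f` allows this term to be dropped.
    have h5 : (Dᴴ * cfc f Z * D).PosSemidef :=
      (posDef_cfc hZpd hf.pos).posSemidef.conjTranspose_mul_mul_same D
    have e : (c * c) • cfc f Y - Vᴴ * cfc f X * V =
        c • (c • cfc f Y - cfc f (c • Y)) + c • (cfc f (c • Y) - cfc f (Wᴴ * A * W)) +
        (c • cfc f (Wᴴ * A * W) - Wᴴ * cfc f A * W) + Dᴴ * cfc f Z * D := by
      rw [hWfW, smul_sub, smul_sub, smul_smul]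
      abel
    rw [e]
    exact ((h4.add h3).add h1).add h5
  refine posSemidef_of_forall_one_lt (isHermitian_cfc f Y) hVh fun c hc => ?_
  have := key (√c) (by rw [Real.lt_sqrt zero_le_one]; simpa using hc)
  rwa [Real.mul_self_sqrt (by linarith)] at this

/-- Monotonicity of the operator mean `S f(X) S`. -/
theorem IsStandardMonotone.mean_mono {f : ℝ → ℝ} (hf : IsStandardMonotone f)
    {X S : Matrix n n ℂ} (hX : X.PosDef) (hS : S.PosDef) {Y T : Matrix m m ℂ} (hY : Y.PosDef)
    (hT : T.PosDef) {F : Matrix m n ℂ} (h1 : (T * T - F * (S * S) * Fᴴ).PosSemidef)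
    (h2 : (T * Y * T - F * (S * X * S) * Fᴴ).PosSemidef) :
    (T * cfc f Y * T - F * (S * cfc f X * S) * Fᴴ).PosSemidef := by
  have hu : IsUnit T.det := (Matrix.isUnit_iff_isUnit_det _).1 hT.isUnit
  have hTh : Tᴴ = T := hT.isHermitian
  have hSh : Sᴴ = S := hS.isHermitian
  have hTi : (T⁻¹)ᴴ = T⁻¹ := hT.inv.isHermitian
  -- The hypotheses say that `V` is a contraction and that `Vᴴ X V ≤ Y`; conjugating Hansen's
  -- inequality by `T` gives the claim.
  set V := S * Fᴴ * T⁻¹ with hV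
  have hVV : ∀ Z : Matrix n n ℂ, Vᴴ * Z * V = T⁻¹ * (F * (S * Z * S) * Fᴴ) * T⁻¹ := fun Z => by
    simp only [hV, conjTranspose_mul, conjTranspose_conjTranspose, hTi, hSh, Matrix.mul_assoc]
  have hconj : ∀ Z : Matrix m m ℂ, T⁻¹ * (T * Z * T) * T⁻¹ = Z := fun Z => by
    simp only [Matrix.mul_assoc, Matrix.mul_nonsing_inv _ hu, Matrix.mul_one]
    rw [← Matrix.mul_assoc, Matrix.nonsing_inv_mul _ hu, Matrix.one_mul]
  have key : ∀ (Z : Matrix n n ℂ) (Z' : Matrix m m ℂ),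
      (T⁻¹)ᴴ * (T * Z' * T - F * (S * Z * S) * Fᴴ) * T⁻¹ = Z' - Vᴴ * Z * V := fun Z Z' => by
    rw [hVV, hTi, Matrix.mul_sub, Matrix.sub_mul, hconj]
  have g1 : (1 - Vᴴ * V).PosSemidef := by
    have := key 1 1
    simp only [Matrix.mul_one] at this
    rw [← this]
    exact h1.conjTranspose_mul_mul_same _
  have g2 : (Y - Vᴴ * X * V).PosSemidef := by
    rw [← key]; exact h2.conjTranspose_mul_mul_same _
  have g3 := (hf.hansen hX hY g1 g2).conjTranspose_mul_mul_same T
  rw [← key, hTh, hTi] at g3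
  have hback : ∀ Z : Matrix m m ℂ, T * (T⁻¹ * Z * T⁻¹) * T = Z := fun Z => by
    simp only [Matrix.mul_assoc, Matrix.nonsing_inv_mul _ hu, Matrix.mul_one]
    rw [← Matrix.mul_assoc, Matrix.mul_nonsing_inv _ hu, Matrix.one_mul]
  rwa [hback] at g3

/-- Inequalities `F J Fᴴ ≤ K` dualise to `Fᴴ K⁻¹ F ≤ J⁻¹`. -/
theorem posSemidef_inv_sub_of_posSemidef {J : Matrix n n ℂ} (hJ : J.PosDef) {K : Matrix m m ℂ}
    (hK : K.PosDef) {F : Matrix m n ℂ} (h : (K - F * J * Fᴴ).PosSemidef) :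
    (J⁻¹ - Fᴴ * K⁻¹ * F).PosSemidef := by
  have huJ : IsUnit J.det := (Matrix.isUnit_iff_isUnit_det _).1 hJ.isUnit
  have huK : IsUnit K.det := (Matrix.isUnit_iff_isUnit_det _).1 hK.isUnit
  have hKi : (K⁻¹)ᴴ = K⁻¹ := hK.inv.isHermitian
  have hJh : Jᴴ = J := hJ.isHermitian
  -- Completing the square: the difference is a congruence of `J⁻¹` plus a congruence of `K - F J
  -- Fᴴ`.
  set R := 1 - J * Fᴴ * K⁻¹ * F with hR
  have e : J⁻¹ - Fᴴ * K⁻¹ * F = Rᴴ * J⁻¹ * R + (K⁻¹ * F)ᴴ * (K - F * J * Fᴴ) * (K⁻¹ * F) := by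
    simp only [hR, conjTranspose_sub, conjTranspose_mul, conjTranspose_conjTranspose, hKi, hJh,
      conjTranspose_one, Matrix.sub_mul, Matrix.mul_sub, Matrix.mul_one, Matrix.one_mul,
      Matrix.mul_assoc]
    have c2 : ∀ Z : Matrix n n ℂ, J⁻¹ * (J * Z) = Z := fun Z => by
      rw [← Matrix.mul_assoc, Matrix.nonsing_inv_mul _ huJ, Matrix.one_mul]
    have c3 : ∀ Z : Matrix m n ℂ, K * (K⁻¹ * Z) = Z := fun Z => by
      rw [← Matrix.mul_assoc, Matrix.mul_nonsing_inv _ huK, Matrix.one_mul]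
    simp only [c2, c3, Matrix.mul_nonsing_inv _ huJ, Matrix.mul_one]
    abel
  rw [e]
  exact (hJ.inv.posSemidef.conjTranspose_mul_mul_same R).add (h.conjTranspose_mul_mul_same _)

end Hansen

/-! ### Standard monotones are concave and of class `C¹`. -/

section Smoothness

theorem IsStandardMonotone.concaveOn {f : ℝ → ℝ} (hf : IsStandardMonotone f) :
    ConcaveOn ℝ (Ioi 0) f := by
  refine ⟨convex_Ioi 0, fun x hx y hy p q hp hq hpq => ?_⟩
  simp only [mem_Ioi] at hx hy
  simp only [smul_eq_mul]
  -- A unit column with squared weights `p, q` compresses `diag(x, y)` to `p x + q y`, so Hansen's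
  -- inequality becomes concavity.
  set V : Matrix (Fin 2) Unit ℂ := Matrix.of fun i _ => ((![√p, √q] i : ℝ) : ℂ) with hV
  have hz : 0 < p * x + q * y := by
    rcases hp.eq_or_lt with rfl | hp0
    · have : q = 1 := by linarith
      subst this; simpa using hy
    · have := mul_pos hp0 hx
      have := mul_nonneg hq hy.le
      linarith
  have key : ∀ a : Fin 2 → ℝ, Vᴴ * diagonal (fun i => (a i : ℂ)) * V =
      Matrix.diagonal fun _ : Unit => ((p * a 0 + q * a 1 : ℝ) : ℂ) := by
    intro a
    ext i j
    rw [Matrix.mul_apply, Fin.sum_univ_two, Matrix.mul_diagonal, Matrix.mul_diagonal,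
      Matrix.diagonal_apply_eq]
    simp only [hV, conjTranspose_apply, Matrix.of_apply, RCLike.star_def, Complex.conj_ofReal,
      Matrix.cons_val_zero, Matrix.cons_val_one]
    rw [← Complex.ofReal_mul, ← Complex.ofReal_mul, ← Complex.ofReal_mul, ← Complex.ofReal_mul,
      ← Complex.ofReal_add]
    congr 1
    have h1 := Real.mul_self_sqrt hp
    have h2 := Real.mul_self_sqrt hq
    linear_combination a 0 * h1 + a 1 * h2
  have h1 := key (fun _ => 1)
  have h2 := key ![x, y]
  have h3 := key (fun i => f (![x, y] i))
  have hd1 : diagonal (fun _ : Fin 2 => ((1 : ℝ) : ℂ)) = 1 := by simp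
  have h := hf.hansen (X := diagonal (fun i => ((![x, y] i : ℝ) : ℂ)))
    (Y := diagonal fun _ => ((p * x + q * y : ℝ) : ℂ)) (V := V)
    (PosDef.diagonal fun i => by fin_cases i <;> simp [hx, hy])
    (PosDef.diagonal fun i => by exact_mod_cast hz)
    (by
      rw [hd1, Matrix.mul_one] at h1
      simp [h1, hpq, PosSemidef.zero])
    (by
      rw [h2]
      simp [PosSemidef.zero])
  rw [cfc_diagonal f (fun _ => p * x + q * y), cfc_diagonal f ![x, y], h3, Matrix.diagonal_sub,
    posSemidef_diagonal_iff] at h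
  have := h ()
  rw [← Complex.ofReal_sub, Complex.zero_le_real] at this
  simpa using this

/-- Up to the scale `√c`, `W` is a Hermitian unitary that diagonalises the argument; keeping `c`
outside avoids square roots in the entries. -/
theorem smul_cfc_eq {n : Type*} [Fintype n] [DecidableEq n] (f : ℝ → ℝ) {W : Matrix n n ℂ}
    (hW : W.IsHermitian) {c : ℝ} (hc : c ≠ 0) (hWW : W * W = c • (1 : Matrix n n ℂ)) (x : n → ℝ) :
    cfc f (c⁻¹ • (W * diagonal (fun i => (x i : ℂ)) * W)) =
      c⁻¹ • (W * diagonal (fun i => (f (x i) : ℂ)) * W) := by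
  set D := diagonal (fun i => (x i : ℂ))
  have hD : D.IsHermitian := by
    rw [Matrix.isHermitian_diagonal_iff]
    intro i
    simp [IsSelfAdjoint]
  have hA : (c⁻¹ • (W * D * W)).IsHermitian := by
    rw [Matrix.IsHermitian, conjTranspose_smul, conjTranspose_mul, conjTranspose_mul, hW.eq, hD.eq,
      Matrix.mul_assoc]
    simp
  have h := cfc_mul_of_intertwines f hA hD (W := W) (by
    rw [Matrix.smul_mul, Matrix.mul_assoc _ W W, hWW, Matrix.mul_smul, smul_smul,
      inv_mul_cancel₀ hc, one_smul, Matrix.mul_one])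
  rw [cfc_diagonal] at h
  rw [← h, Matrix.mul_assoc (cfc f _), hWW, Matrix.mul_smul, smul_smul, inv_mul_cancel₀ hc, one_smul,
    Matrix.mul_one]

/-- A four-point inequality for matrix monotone functions, which excludes kinks. -/
theorem IsStandardMonotone.four_point {f : ℝ → ℝ} (hf : IsStandardMonotone f) {x h : ℝ}
    (hh : 0 < h) (hx : 2 * h < x) :
    4 / 5 * f (x + h / 2) + 1 / 5 * f (x - 2 * h) ≤ 1 / 2 * (f (x + h) + f (x - h)) := by
  set W : Matrix (Fin 2) (Fin 2) ℂ := !![1, 2; 2, -1] with hW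
  set V : Matrix (Fin 2) (Fin 2) ℂ := !![1, 1; 1, -1] with hV
  have hWh : W.IsHermitian := by
    ext i j; fin_cases i <;> fin_cases j <;> simp [hW]
  have hVh : V.IsHermitian := by
    ext i j; fin_cases i <;> fin_cases j <;> simp [hV]
  have hWW : W * W = (5 : ℝ) • (1 : Matrix (Fin 2) (Fin 2) ℂ) := by
    ext i j; fin_cases i <;> fin_cases j <;> simp [hW, Matrix.mul_apply] <;> norm_num
  have hVV : V * V = (2 : ℝ) • (1 : Matrix (Fin 2) (Fin 2) ℂ) := by
    ext i j; fin_cases i <;> fin_cases j <;> simp [hV, Matrix.mul_apply] <;> norm_num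
  -- In matrix form `A = x + h !![-3/2, 1; 1, 0]` and `B = x + h !![0, 1; 1, 0]`, written through
  -- their eigenvectors. Then `B - A = diag(3h/2, 0) ≥ 0`, and the claim is the lower right entry of
  -- `f(B) - f(A) ≥ 0`.
  set a : Fin 2 → ℝ := ![x + h / 2, x - 2 * h] with ha
  set b : Fin 2 → ℝ := ![x + h, x - h] with hb
  set A : Matrix (Fin 2) (Fin 2) ℂ := (5 : ℝ)⁻¹ • (W * diagonal (fun i => (a i : ℂ)) * W) with hA
  set B : Matrix (Fin 2) (Fin 2) ℂ := (2 : ℝ)⁻¹ • (V * diagonal (fun i => (b i : ℂ)) * V) with hB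
  have hApd : A.PosDef := by
    refine PosDef.smul ?_ (by norm_num)
    have hD : (diagonal (fun i => (a i : ℂ))).PosDef := PosDef.diagonal fun i => by
      rw [Complex.zero_lt_real]
      fin_cases i <;> simp [ha] <;> linarith
    have := hD.conjTranspose_mul_mul_same (B := W) (fun u v huv => by
      have := congrArg (fun z => W *ᵥ z) huv
      simp only [Matrix.mulVec_mulVec, hWW, Matrix.smul_mulVec, Matrix.one_mulVec] at this
      exact smul_right_injective _ (by norm_num : (5 : ℝ) ≠ 0) this)
    rwa [hWh.eq] at this
  have entry : ∀ (c : ℝ) (U : Matrix (Fin 2) (Fin 2) ℂ) (p : Fin 2 → ℂ) (i j : Fin 2),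
      (c • (U * diagonal p * U)) i j = c * (U i 0 * p 0 * U 0 j + U i 1 * p 1 * U 1 j) :=
    fun c U p i j => by
      rw [Matrix.smul_apply, Matrix.mul_apply, Fin.sum_univ_two, Matrix.mul_diagonal,
        Matrix.mul_diagonal, Complex.real_smul]
  have hAB : B - A = diagonal (fun i => ((![3 / 2 * h, 0] i : ℝ) : ℂ)) := by
    ext i j
    rw [Matrix.sub_apply, hA, hB, entry, entry]
    fin_cases i <;> fin_cases j <;> simp [hW, hV, ha, hb] <;> ring
  have key := hf.monotone_fintype hApd (B := B) (by
    rw [hAB]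
    refine PosSemidef.diagonal fun i => ?_
    refine Complex.zero_le_real.2 ?_
    fin_cases i <;> simp [hh.le])
  rw [hA, hB, smul_cfc_eq f hWh (by norm_num) hWW, smul_cfc_eq f hVh (by norm_num) hVV] at key
  have k2 := key.diag_nonneg (i := 1)
  rw [Matrix.sub_apply, entry, entry] at k2
  simp only [hV, hW, ha, hb, Matrix.of_apply, Matrix.cons_val_zero, Matrix.cons_val_one,
    Matrix.cons_val', Matrix.cons_val_fin_one] at k2
  have k3 : (0 : ℂ) ≤ (((2 : ℝ)⁻¹ * (1 * f (x + h) * 1 + -1 * f (x - h) * -1) -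
      (5 : ℝ)⁻¹ * (2 * f (x + h / 2) * 2 + -1 * f (x - 2 * h) * -1) : ℝ) : ℂ) := by
    push_cast
    push_cast at k2
    exact k2
  rw [Complex.zero_le_real] at k3
  linarith

theorem IsStandardMonotone.differentiableAt {f : ℝ → ℝ} (hf : IsStandardMonotone f) {x : ℝ}
    (hx : 0 < x) : DifferentiableAt ℝ f x := by
  have hcv := hf.concaveOn.neg
  have hint : x ∈ interior (Ioi (0 : ℝ)) := by rw [interior_Ioi]; exact hx
  obtain ⟨R, hR⟩ : ∃ R, HasDerivWithinAt f R (Ioi x) x :=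
    ⟨_, by simpa using (hcv.hasDerivWithinAt_rightDeriv_of_mem_interior hint).neg⟩
  obtain ⟨L, hL⟩ : ∃ L, HasDerivWithinAt f L (Iio x) x :=
    ⟨_, by simpa using (hcv.hasDerivWithinAt_leftDeriv_of_mem_interior hint).neg⟩
  have hRL : R ≤ L := by
    have h := hcv.leftDeriv_le_rightDeriv_of_mem_interior hint
    rw [hL.neg.derivWithin (uniqueDiffWithinAt_Iio x),
      hR.neg.derivWithin (uniqueDiffWithinAt_Ioi x)] at h
    linarith
  -- Both sides of the four-point inequality agree at `h = 0`. Comparing their right derivatives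
  -- there gives `(R - L) / 10 ≥ 0`, while concavity gives `R ≤ L`.
  have hLR : L ≤ R := by
    have comp : ∀ (c D : ℝ) (s : Set ℝ), HasDerivWithinAt f D s x →
        (∀ h : ℝ, 0 < h → x + c * h ∈ s) →
        HasDerivWithinAt (fun h => f (x + c * h)) (D * c) (Ioi 0) 0 := by
      intro c D s hD hs
      have hin : HasDerivWithinAt (fun h : ℝ => x + c * h) c (Ioi 0) 0 := by
        simpa using ((hasDerivAt_id (0 : ℝ)).const_mul c).const_add x |>.hasDerivWithinAt
      exact HasDerivWithinAt.comp (h₂ := f) (0 : ℝ) (by simpa using hD) hin fun h hh => hs h hh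
    have h1 := comp 1 R _ hR fun h hh => by simpa using hh
    have h2 := comp (-1) L _ hL fun h hh => by simpa using hh
    have h3 := comp (1 / 2) R _ hR fun h hh => by simpa using hh
    have h4 := comp (-2) L _ hL fun h hh => by simpa using hh
    have hd := (((h1.add h2).const_mul (1 / 2)).sub (h3.const_mul (4 / 5))).sub
      (h4.const_mul (1 / 5))
    have hs := hasDerivWithinAt_iff_tendsto_slope.1 hd
    rw [sdiff_singleton_eq_self (by simp)] at hs
    have hge := ge_of_tendsto hs (b := 0) (by
      have hsmall : ∀ᶠ h in 𝓝[Ioi (0 : ℝ)] 0, 2 * h < x := by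
        have hc : ContinuousAt (fun h : ℝ => 2 * h) 0 := by fun_prop
        exact (hc.eventually_lt_const (by simpa using hx)).filter_mono nhdsWithin_le_nhds
      filter_upwards [hsmall, self_mem_nhdsWithin] with h hhx hh
      have hh0 : 0 < h := hh
      have := hf.four_point hh0 hhx
      rw [slope_def_field, sub_zero]
      refine div_nonneg ?_ hh0.le
      simp only [Pi.add_apply, Pi.sub_apply, mul_zero, add_zero]
      have e1 : x + 1 * h = x + h := by ring
      have e2 : x + -1 * h = x - h := by ring
      have e3 : x + 1 / 2 * h = x + h / 2 := by ring
      have e4 : x + -2 * h = x - 2 * h := by ring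
      rw [e1, e2, e3, e4]
      linarith)
    linarith
  obtain rfl : R = L := le_antisymm hRL hLR
  have hu := hR.Ici_of_Ioi.union hL.Iic_of_Iio
  rw [Ici_union_Iic, hasDerivWithinAt_univ] at hu
  exact hu.differentiableAt

/-- Chord slopes bound the derivative, from below by chords to the right and from above by chords to
the left. A chord slope is continuous in its moving endpoint. -/
theorem ConcaveOn.continuousAt_deriv {f : ℝ → ℝ} (hc : ConcaveOn ℝ (Ioi 0) f)
    (hd : ∀ x, 0 < x → DifferentiableAt ℝ f x) {x : ℝ} (hx : 0 < x) :
    ContinuousAt (deriv f) x := by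
  have hslope := hasDerivAt_iff_tendsto_slope.1 (hd x hx).hasDerivAt
  have hcont : ∀ z, z ≠ x → ContinuousAt (fun y => (f z - f y) / (z - y)) x := fun z hz =>
    (continuousAt_const.sub (hd x hx).continuousAt).div (continuousAt_const.sub continuousAt_id)
      (sub_ne_zero.2 hz)
  refine tendsto_order.2 ⟨fun c hlt => ?_, fun c hlt => ?_⟩
  · have h1 : ∀ᶠ z in 𝓝[>] x, c < slope f x z :=
      (hslope.eventually_const_lt hlt).filter_mono (nhdsWithin_mono _ fun z hz => ne_of_gt hz)
    obtain ⟨z, hz, hxz⟩ := (h1.and self_mem_nhdsWithin).exists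
    change x < z at hxz
    rw [slope_def_field] at hz
    filter_upwards [(hcont z hxz.ne').eventually_const_lt hz, Ioo_mem_nhds hx hxz] with y hy hy2
    have := hc.slope_le_deriv (x := y) (y := z) hy2.1 (hx.trans hxz) hy2.2 (hd y hy2.1)
    rw [slope_def_field] at this
    exact hy.trans_le this
  · have h1 : ∀ᶠ z in 𝓝[<] x, slope f x z < c :=
      (hslope.eventually_lt_const hlt).filter_mono (nhdsWithin_mono _ fun z hz => ne_of_lt hz)
    obtain ⟨z, ⟨hz, hzx⟩, hz0⟩ := ((h1.and self_mem_nhdsWithin).and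
      (nhdsWithin_le_nhds (Ioi_mem_nhds hx))).exists
    change z < x at hzx
    change 0 < z at hz0
    rw [slope_def_field] at hz
    filter_upwards [(hcont z hzx.ne).eventually_lt_const hz, Ioi_mem_nhds hzx] with y hy hy2
    have := hc.deriv_le_slope (x := z) (y := y) hz0 (hz0.trans hy2) hy2 (hd y (hz0.trans hy2))
    rw [slope_comm, slope_def_field] at this
    exact this.trans_lt hy

theorem IsStandardMonotone.contDiffOn {f : ℝ → ℝ} (hf : IsStandardMonotone f) :
    ContDiffOn ℝ 1 f (Ioi 0) := by
  have h := (contDiffOn_succ_iff_deriv_of_isOpen (𝕜 := ℝ) (f := f) (n := 0)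
    (isOpen_Ioi (a := (0 : ℝ)))).2
    ⟨fun x hx => (hf.differentiableAt hx).differentiableWithinAt, by simp,
      contDiffOn_zero.2 fun x hx => (ConcaveOn.continuousAt_deriv hf.concaveOn
        (fun y hy => hf.differentiableAt hy) hx).continuousWithinAt⟩
  simpa using h

theorem IsStandardMonotone.contDiffOn_inv {f : ℝ → ℝ} (hf : IsStandardMonotone f) :
    ContDiffOn ℝ 1 (fun x => 1 / f x) (Ioi 0) :=
  contDiffOn_const.div hf.contDiffOn fun x hx => (hf.pos x hx).ne'

end Smoothness

/-! ### Superoperators as matrices; the Fisher forms and Hermitian conjugation. -/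

section SuperMatrices

variable {d : ℕ}

/-- The coordinates of a matrix in the basis of the matrix units. -/
def vec (A : Mat d) : Fin d × Fin d → ℂ := fun p => A p.1 p.2

/-- The matrix with given coordinates. -/
def unvec (v : Fin d × Fin d → ℂ) : Mat d := Matrix.of fun i j => v (i, j)

@[simp] theorem vec_unvec (v : Fin d × Fin d → ℂ) : vec (unvec v) = v := rfl

@[simp] theorem unvec_vec (A : Mat d) : unvec (vec A) = A := rfl

theorem vec_sub (A B : Mat d) : vec (A - B) = vec A - vec B := rfl

theorem vec_smul (c : ℂ) (A : Mat d) : vec (c • A) = c • vec A := rfl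

theorem vec_injective : Function.Injective (vec : Mat d → _) := fun A B h => by
  rw [← unvec_vec A, h, unvec_vec]

theorem stdBasis_repr_eq_vec (A : Mat d) :
    ((Matrix.stdBasis ℂ (Fin d) (Fin d)).repr A : Fin d × Fin d → ℂ) = vec A := by
  ext p
  simp [Matrix.stdBasis, Pi.basis_repr, vec]

theorem superMatrix_mulVec (T : SuperOp d) (A : Mat d) : superMatrix T *ᵥ vec A = vec (T A) := by
  rw [← stdBasis_repr_eq_vec, ← stdBasis_repr_eq_vec, superMatrix, LinearMap.toMatrix_mulVec_repr]

theorem superMatrix_comp (T U : SuperOp d) : superMatrix (T ∘ₗ U) = superMatrix T * superMatrix U :=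
  LinearMap.toMatrix_mul _ T U

theorem superMatrix_ofSuperMatrix (M : Matrix (Fin d × Fin d) (Fin d × Fin d) ℂ) :
    superMatrix (ofSuperMatrix M) = M := by
  simp [superMatrix, ofSuperMatrix]

theorem superMatrix_id : superMatrix (LinearMap.id : SuperOp d) = 1 := by
  simp [superMatrix]

theorem superMatrix_superAdjoint (T : SuperOp d) :
    superMatrix (superAdjoint T) = (superMatrix T)ᴴ := superMatrix_ofSuperMatrix _

theorem superMatrix_superFun (f : ℝ → ℝ) (T : SuperOp d) :
    superMatrix (superFun f T) = cfc f (superMatrix T) := superMatrix_ofSuperMatrix _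

theorem eq_of_mulVec_vec {M N : Matrix (Fin d × Fin d) (Fin d × Fin d) ℂ}
    (h : ∀ A, M *ᵥ vec A = N *ᵥ vec A) : M = N :=
  Matrix.ext_of_mulVec_single fun i => by simpa using h (unvec (Pi.single i 1))

theorem superMatrix_leftMul (A : Mat d) : superMatrix (leftMul A) = kroneckerMap (· * ·) A 1 := by
  refine eq_of_mulVec_vec fun B => ?_
  rw [superMatrix_mulVec]
  ext ⟨i, j⟩
  simp [vec, leftMul, Matrix.mul_apply, mulVec, dotProduct, Fintype.sum_prod_type, Matrix.one_apply]

theorem superMatrix_rightMul (A : Mat d) :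
    superMatrix (rightMul A) = kroneckerMap (· * ·) 1 Aᵀ := by
  refine eq_of_mulVec_vec fun B => ?_
  rw [superMatrix_mulVec]
  ext ⟨i, j⟩
  simp only [vec, rightMul, LinearMap.mulRight_apply, Matrix.mul_apply, mulVec, dotProduct,
    Fintype.sum_prod_type, Matrix.one_apply, kroneckerMap_apply, transpose_apply]
  symm
  rw [Finset.sum_eq_single i (fun b _ hb => by simp [hb.symm]) (by simp)]
  exact Finset.sum_congr rfl fun l _ => by simp [mul_comm]

theorem kronecker_mul (A B C D : Mat d) : kroneckerMap (· * ·) A B * kroneckerMap (· * ·) C D =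
    kroneckerMap (· * ·) (A * C) (B * D) := (Matrix.mul_kronecker_mul A C B D).symm

/-- The matrix of the relative modular operator. -/
def modMat (σ ρ : Mat d) : Matrix (Fin d × Fin d) (Fin d × Fin d) ℂ :=
  kroneckerMap (· * ·) σ (ρ⁻¹)ᵀ

/-- The matrix of the right multiplication. -/
def rMat (ρ : Mat d) : Matrix (Fin d × Fin d) (Fin d × Fin d) ℂ := kroneckerMap (· * ·) 1 ρᵀ

theorem superMatrix_modularOp (σ ρ : Mat d) : superMatrix (modularOp σ ρ) = modMat σ ρ := by
  rw [modularOp, superMatrix_comp, superMatrix_leftMul, superMatrix_rightMul, kronecker_mul,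
    Matrix.mul_one, Matrix.one_mul, modMat]

theorem rMat_mul (A B : Mat d) : rMat A * rMat B = rMat (B * A) := by
  rw [rMat, rMat, kronecker_mul, Matrix.mul_one, ← Matrix.transpose_mul, rMat]

theorem rMat_mulVec (A B : Mat d) : rMat A *ᵥ vec B = vec (B * A) := by
  rw [rMat, ← superMatrix_rightMul, superMatrix_mulVec]
  rfl

theorem modMat_mulVec (σ ρ B : Mat d) : modMat σ ρ *ᵥ vec B = vec (σ * B * ρ⁻¹) := by
  rw [← superMatrix_modularOp, superMatrix_mulVec]
  simp [modularOp, leftMul, rightMul, Matrix.mul_assoc]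

theorem posDef_modMat {σ ρ : Mat d} (hσ : σ.PosDef) (hρ : ρ.PosDef) : (modMat σ ρ).PosDef :=
  hσ.kronecker hρ.inv.transpose

theorem posDef_rMat {ρ : Mat d} (hρ : ρ.PosDef) : (rMat ρ).PosDef :=
  PosDef.one.kronecker hρ.transpose

theorem isHermitian_kronecker {A B : Mat d} (hA : A.IsHermitian) (hB : B.IsHermitian) :
    (kroneckerMap (· * ·) A B).IsHermitian := by
  ext p q
  simp only [conjTranspose_apply, kroneckerMap_apply, star_mul']
  rw [hA.apply, hB.apply]

theorem isHermitian_modMat {σ ρ : Mat d} (hσ : σ.IsHermitian) (hρ : ρ.IsHermitian) :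
    (modMat σ ρ).IsHermitian := isHermitian_kronecker hσ hρ.inv.transpose

theorem commute_rMat_modMat {σ ρ A : Mat d} (h : Commute A ρ⁻¹) :
    Commute (rMat A) (modMat σ ρ) := by
  rw [Commute, SemiconjBy, rMat, modMat, kronecker_mul, kronecker_mul, Matrix.one_mul,
    Matrix.mul_one, ← Matrix.transpose_mul, ← Matrix.transpose_mul, h.eq]

theorem commute_rMat_cfc_modMat {σ ρ A : Mat d} (hσ : σ.IsHermitian) (hρ : ρ.IsHermitian)
    (h : Commute A ρ⁻¹) (f : ℝ → ℝ) : Commute (rMat A) (cfc f (modMat σ ρ)) :=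
  (cfc_mul_of_intertwines f (isHermitian_modMat hσ hρ) (isHermitian_modMat hσ hρ)
    (commute_rMat_modMat h).eq.symm).symm

theorem commute_inv_right {ρ : Mat d} (hρ : ρ.PosDef) : Commute ρ ρ⁻¹ := by
  have hu : IsUnit ρ.det := (Matrix.isUnit_iff_isUnit_det _).1 hρ.isUnit
  rw [Commute, SemiconjBy, Matrix.mul_nonsing_inv _ hu, Matrix.nonsing_inv_mul _ hu]

/-- The matrix of `R_ρ⁻¹ h(L_σ R_ρ⁻¹)`. -/
def formMat (h : ℝ → ℝ) (σ ρ : Mat d) : Matrix (Fin d × Fin d) (Fin d × Fin d) ℂ :=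
  rMat ρ⁻¹ * cfc h (modMat σ ρ)

theorem superMatrix_fisherOpInv (f : ℝ → ℝ) (π : Mat d) :
    superMatrix (fisherOpInv f π) = formMat (fun x => 1 / f x) π π := by
  rw [fisherOpInv, superMatrix_comp, superMatrix_rightMul, superMatrix_superFun,
    superMatrix_modularOp, formMat, rMat]

theorem superMatrix_fisherOp (f : ℝ → ℝ) (π : Mat d) :
    superMatrix (fisherOp f π) = rMat π * cfc f (modMat π π) := by
  rw [fisherOp, superMatrix_comp, superMatrix_rightMul, superMatrix_superFun,
    superMatrix_modularOp, rMat]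

theorem posDef_formMat {h : ℝ → ℝ} (hh : ∀ x, 0 < x → 0 < h x) {σ ρ : Mat d} (hσ : σ.PosDef)
    (hρ : ρ.PosDef) : (formMat h σ ρ).PosDef :=
  posDef_mul_of_commute (posDef_rMat hρ.inv) (posDef_cfc (posDef_modMat hσ hρ) hh)
    (commute_rMat_cfc_modMat hσ.isHermitian hρ.isHermitian (Commute.refl _) h)

theorem posDef_formMat_inv {f : ℝ → ℝ} (hf : ∀ x, 0 < x → 0 < f x) {π : Mat d} (hπ : π.PosDef) :
    (formMat (fun x => 1 / f x) π π).PosDef :=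
  posDef_formMat (fun x hx => one_div_pos.2 (hf x hx)) hπ hπ

theorem formMat_mul_fisher {f : ℝ → ℝ} (hf : ∀ x, 0 < x → 0 < f x) {π : Mat d} (hπ : π.PosDef) :
    formMat (fun x => 1 / f x) π π * superMatrix (fisherOp f π) = 1 := by
  rw [← superMatrix_fisherOpInv, ← superMatrix_comp, fisherOpInv_comp_fisherOp f hf π hπ,
    superMatrix_id]

theorem superMatrix_fisherOp_eq_inv {f : ℝ → ℝ} (hf : ∀ x, 0 < x → 0 < f x) {π : Mat d}
    (hπ : π.PosDef) : superMatrix (fisherOp f π) = (formMat (fun x => 1 / f x) π π)⁻¹ :=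
  (Matrix.inv_eq_right_inv (formMat_mul_fisher hf hπ)).symm

theorem formMat_le {f₀ f : ℝ → ℝ} (hf₀ : ∀ x, 0 < x → 0 < f₀ x)
    (hle : ∀ x, 0 < x → f₀ x ≤ f x) {π : Mat d} (hπ : π.PosDef) :
    (formMat (fun x => 1 / f₀ x) π π - formMat (fun x => 1 / f x) π π).PosSemidef := by
  rw [formMat, formMat, ← Matrix.mul_sub]
  refine posSemidef_mul_of_commute (posDef_rMat hπ.inv)
    (posSemidef_cfc_sub (posDef_modMat hπ hπ) fun x hx => one_div_le_one_div_of_le (hf₀ x hx)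
      (hle x hx)) ?_
  have h := fun g => commute_rMat_cfc_modMat hπ.isHermitian hπ.isHermitian (Commute.refl π⁻¹) g
  exact (h _).sub_right (h _)

theorem trace_conjTranspose_mul (A B : Mat d) : (Aᴴ * B).trace = star (vec A) ⬝ᵥ vec B := by
  simp only [dotProduct, Matrix.trace, Matrix.diag, Matrix.mul_apply, Fintype.sum_prod_type,
    Pi.star_apply, vec, Matrix.conjTranspose_apply]
  exact Finset.sum_comm

theorem fisherInfo_eq (f : ℝ → ℝ) (π : Mat d) {A : Mat d} (hA : A.IsHermitian) :
    fisherInfo f π A = (star (vec A) ⬝ᵥ formMat (fun x => 1 / f x) π π *ᵥ vec A).re := by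
  rw [fisherInfo]
  nth_rw 1 [← hA.eq]
  rw [trace_conjTranspose_mul, ← superMatrix_mulVec, superMatrix_fisherOpInv]

/-- The conjugation of superoperators by the Hermitian conjugation, on matrices. -/
def conjMat : Matrix (Fin d × Fin d) (Fin d × Fin d) ℂ →ₐ[ℝ]
    Matrix (Fin d × Fin d) (Fin d × Fin d) ℂ :=
  ((reindexAlgEquiv ℝ ℂ (Equiv.prodComm (Fin d) (Fin d))).toAlgHom).comp
    (AlgHom.mapMatrix (Complex.conjAe : ℂ →ₐ[ℝ] ℂ))

theorem conjMat_apply (M : Matrix (Fin d × Fin d) (Fin d × Fin d) ℂ) (p q : Fin d × Fin d) :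
    conjMat M p q = star (M p.swap q.swap) := rfl

theorem vec_conjTranspose (A : Mat d) (p : Fin d × Fin d) : vec Aᴴ p = star (vec A p.swap) := rfl

/-- Thus `conjMat` of the matrix of `T` represents `A ↦ (T Aᴴ)ᴴ`, and its fixed points are the
Hermiticity-preserving maps. -/
theorem conjMat_mulVec (M : Matrix (Fin d × Fin d) (Fin d × Fin d) ℂ) (A : Mat d) :
    conjMat M *ᵥ vec Aᴴ = vec (unvec (M *ᵥ vec A))ᴴ := by
  ext p
  rw [vec_conjTranspose, vec_unvec]
  simp only [mulVec, dotProduct, conjMat_apply, vec_conjTranspose, star_sum, star_mul']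
  exact Fintype.sum_equiv (Equiv.prodComm _ _) _ _ fun q => rfl

theorem dotProduct_vec_conjTranspose (A B : Mat d) :
    star (vec Aᴴ) ⬝ᵥ vec Bᴴ = star (star (vec A) ⬝ᵥ vec B) := by
  simp only [dotProduct, Pi.star_apply, vec_conjTranspose, star_sum, star_mul']
  exact Fintype.sum_equiv (Equiv.prodComm _ _) _ _ fun q => rfl

theorem conjMat_eq_iff (T : SuperOp d) :
    conjMat (superMatrix T) = superMatrix T ↔ ∀ A, T Aᴴ = (T A)ᴴ := by
  constructor
  · intro h A
    have := conjMat_mulVec (superMatrix T) A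
    rw [h, superMatrix_mulVec, superMatrix_mulVec, unvec_vec] at this
    exact vec_injective this
  · intro h
    refine eq_of_mulVec_vec fun A => ?_
    have := conjMat_mulVec (superMatrix T) Aᴴ
    rw [conjTranspose_conjTranspose, superMatrix_mulVec, unvec_vec, h, conjTranspose_conjTranspose]
      at this
    rw [this, superMatrix_mulVec]

theorem re_dotProduct_conjMat (M : Matrix (Fin d × Fin d) (Fin d × Fin d) ℂ) {A : Mat d}
    (hA : A.IsHermitian) :
    (star (vec A) ⬝ᵥ conjMat M *ᵥ vec A).re = (star (vec A) ⬝ᵥ M *ᵥ vec A).re := by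
  have h := dotProduct_vec_conjTranspose A (unvec (M *ᵥ vec A))
  rw [← conjMat_mulVec, hA.eq, vec_unvec] at h
  rw [h]
  simp

theorem cfc_inv_eq {n : Type*} [Fintype n] [DecidableEq n] {A : Matrix n n ℂ} (hA : A.PosDef) :
    cfc (fun x : ℝ => x⁻¹) A = A⁻¹ := by
  refine (Matrix.inv_eq_left_inv ?_).symm
  have hs := hA.isHermitian.isSelfAdjoint
  conv_lhs => rw [← cfc_id' ℝ A hs]
  rw [cfc_id' ℝ A hs]
  nth_rw 2 [← cfc_id' ℝ A hs]
  rw [← cfc_mul _ _ A (continuousOn_spectrum _ _) (continuousOn_spectrum _ _),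
    cfc_congr (g := fun _ => 1), cfc_const_one ℝ A hs]
  exact fun x hx => inv_mul_cancel₀ (spectrum_pos hA hx).ne'

theorem cfc_inv_arg {n : Type*} [Fintype n] [DecidableEq n] (f : ℝ → ℝ) {A : Matrix n n ℂ}
    (hA : A.PosDef) : cfc f A⁻¹ = cfc (fun x => f x⁻¹) A := by
  rw [← cfc_inv_eq hA, ← cfc_comp' f (fun x => x⁻¹) A
    ((Matrix.finite_real_spectrum.image _).continuousOn _) (continuousOn_spectrum _ _)
    hA.isHermitian.isSelfAdjoint]

theorem modMat_inv {π : Mat d} (hπ : π.PosDef) :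
    (modMat π π)⁻¹ = kroneckerMap (· * ·) π⁻¹ πᵀ := by
  have hu : IsUnit π.det := (Matrix.isUnit_iff_isUnit_det _).1 hπ.isUnit
  refine Matrix.inv_eq_right_inv ?_
  rw [modMat, kronecker_mul, Matrix.mul_nonsing_inv _ hu, ← Matrix.transpose_mul,
    Matrix.mul_nonsing_inv _ hu, Matrix.transpose_one]
  exact Matrix.one_kronecker_one

theorem conjMat_kronecker {A B : Mat d} (hA : A.IsHermitian) (hB : B.IsHermitian) :
    conjMat (kroneckerMap (· * ·) A Bᵀ) = kroneckerMap (· * ·) B Aᵀ := by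
  ext p q
  simp only [conjMat_apply, kroneckerMap_apply, star_mul', transpose_apply, Prod.fst_swap,
    Prod.snd_swap]
  rw [hA.apply, hB.apply, mul_comm]

/-- Conjugation exchanges left and right multiplication: it inverts `X = L_π R_π⁻¹` and sends
`R_π⁻¹` to `L_π⁻¹ = R_π⁻¹ X⁻¹`. Being a homomorphism of real algebras, it passes through real
polynomials and so through the functional calculus. -/
theorem conjMat_formMat (h : ℝ → ℝ) {π : Mat d} (hπ : π.PosDef) :
    conjMat (formMat h π π) = formMat (fun x => x⁻¹ * h x⁻¹) π π := by
  have hX := posDef_modMat hπ hπ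
  have hκ : conjMat (modMat π π) = (modMat π π)⁻¹ := by
    rw [modMat_inv hπ, modMat, conjMat_kronecker hπ.isHermitian hπ.inv.isHermitian]
  have hcfc : conjMat (cfc h (modMat π π)) = cfc (fun x => h x⁻¹) (modMat π π) := by
    rw [← cfc_inv_arg h hX]
    obtain ⟨p, h1, h2⟩ := exists_polynomial_cfc h hX.isHermitian hX.inv.isHermitian
    rw [h1, h2, ← hκ, Polynomial.aeval_algHom_apply]
  have hR : conjMat (rMat π⁻¹) = rMat π⁻¹ * cfc (fun x : ℝ => x⁻¹) (modMat π π) := by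
    have hu : IsUnit π.det := (Matrix.isUnit_iff_isUnit_det _).1 hπ.isUnit
    rw [cfc_inv_eq hX, modMat_inv hπ, rMat, kronecker_mul, Matrix.one_mul, ← Matrix.transpose_mul,
      Matrix.mul_nonsing_inv _ hu, conjMat_kronecker isHermitian_one hπ.inv.isHermitian]
  rw [formMat, map_mul, hcfc, hR, Matrix.mul_assoc,
    ← cfc_mul _ _ _ (continuousOn_spectrum _ _) (continuousOn_spectrum _ _), formMat]

theorem formMat_congr {h k : ℝ → ℝ} {σ ρ : Mat d} (hσ : σ.PosDef) (hρ : ρ.PosDef)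
    (hhk : ∀ x, 0 < x → h x = k x) : formMat h σ ρ = formMat k σ ρ := by
  rw [formMat, formMat, cfc_congr fun x hx => hhk x (spectrum_pos (posDef_modMat hσ hρ) hx)]

theorem formMat_add (h k : ℝ → ℝ) (σ ρ : Mat d) :
    formMat (fun x => h x + k x) σ ρ = formMat h σ ρ + formMat k σ ρ := by
  rw [formMat, cfc_add _ _ _ (continuousOn_spectrum _ _) (continuousOn_spectrum _ _),
    Matrix.mul_add, formMat, formMat]

/-- The symmetry `f(x) = x f(1/x)` is exactly what makes the Fisher operators preserve Hermiticity.
-/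
theorem IsStandardMonotone.conjMat_formMat {f : ℝ → ℝ} (hf : IsStandardMonotone f) {π : Mat d}
    (hπ : π.PosDef) :
    QFisher.conjMat (formMat (fun x => 1 / f x) π π) = formMat (fun x => 1 / f x) π π := by
  rw [QFisher.conjMat_formMat _ hπ]
  refine formMat_congr hπ hπ fun x hx => ?_
  rw [hf.symm x hx, one_div, one_div, mul_inv]

theorem conjMat_inv {M : Matrix (Fin d × Fin d) (Fin d × Fin d) ℂ} (hM : M.PosDef)
    (h : conjMat M = M) : conjMat M⁻¹ = M⁻¹ := by
  have hu : IsUnit M.det := (Matrix.isUnit_iff_isUnit_det _).1 hM.isUnit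
  refine (Matrix.inv_eq_right_inv ?_).symm
  nth_rw 1 [← h]
  rw [← map_mul, Matrix.mul_nonsing_inv _ hu, map_one]

theorem conjMat_conjTranspose {M : Matrix (Fin d × Fin d) (Fin d × Fin d) ℂ} (h : conjMat M = M) :
    conjMat Mᴴ = Mᴴ := by
  conv_rhs => rw [← h]
  rfl

end SuperMatrices

/-! ### Contraction of the quantum Fisher information under channels. -/

section Channels

variable {d : ℕ}

/-- Complete positivity is applied to `Fᴴ π F`, where `F` is the row of blocks `E a`. -/
theorem IsCompletelyPositive.posSemidef_block {Φ : SuperOp d} (hΦ : IsCompletelyPositive Φ) {n : ℕ}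
    (E : Fin n → Mat d) {π : Mat d} (hπ : π.PosSemidef) :
    (Matrix.of fun p q : Fin n × Fin d =>
      Φ ((E p.1)ᴴ * π * E q.1) p.2 q.2).PosSemidef := by
  set F : Matrix (Fin d) (Fin n × Fin d) ℂ := Matrix.of fun i p => E p.1 i p.2 with hF
  have h := hΦ n _ (hπ.conjTranspose_mul_mul_same F)
  have hblock : ∀ a b, (Matrix.of fun i j => (Fᴴ * π * F) (a, i) (b, j)) = (E a)ᴴ * π * E b := by
    intro a b
    ext i j
    simp [hF, Matrix.mul_apply]
  simpa only [hblock] using h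

theorem IsCompletelyPositive.posSemidef_sum {Φ : SuperOp d} (hΦ : IsCompletelyPositive Φ) {n : ℕ}
    (E T : Fin n → Mat d) {π : Mat d} (hπ : π.PosSemidef) :
    (∑ a, ∑ b, (T a)ᴴ * Φ ((E a)ᴴ * π * E b) * T b).PosSemidef := by
  set U : Matrix (Fin n × Fin d) (Fin d) ℂ := Matrix.of fun p j => T p.1 p.2 j with hU
  convert (hΦ.posSemidef_block E hπ).conjTranspose_mul_mul_same U using 1
  ext i j
  simp only [Matrix.sum_apply]
  simp only [Matrix.mul_apply (n := Fin d), Matrix.mul_apply (m := Fin n × Fin d),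
    Fintype.sum_prod_type, conjTranspose_apply, hU, Matrix.of_apply, Finset.sum_mul]
  rw [Finset.sum_comm]
  refine Finset.sum_congr rfl fun b _ => ?_
  rw [Finset.sum_comm]

theorem IsCompletelyPositive.map_conjTranspose {Φ : SuperOp d} (hΦ : IsCompletelyPositive Φ)
    (X : Mat d) : Φ Xᴴ = (Φ X)ᴴ := by
  have h := (hΦ.posSemidef_block ![1, X] PosSemidef.one).isHermitian
  ext i j
  have := h.apply (1, i) (0, j)
  simpa using this.symm

theorem IsChannel.superAdjoint_conjTranspose {Φ : SuperOp d} (hΦ : IsCompletelyPositive Φ)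
    (A : Mat d) : superAdjoint Φ Aᴴ = (superAdjoint Φ A)ᴴ := by
  refine (conjMat_eq_iff _).1 ?_ A
  rw [superMatrix_superAdjoint]
  exact conjMat_conjTranspose ((conjMat_eq_iff Φ).2 hΦ.map_conjTranspose)

/-- The Kadison-Schwarz inequality, in the dual form `Φ L_π Φ† ≤ L_{Φ(π)}`. -/
theorem IsChannel.trace_le {Φ : SuperOp d} (hΦ : IsChannel Φ) {π : Mat d} (hπ : π.PosSemidef)
    (A : Mat d) : 0 ≤ (Aᴴ * Φ π * A).trace -
      ((superAdjoint Φ A)ᴴ * π * superAdjoint Φ A).trace := by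
  set X := superAdjoint Φ A with hX
  -- With `X = Φ†(A)`, both cross terms and, by trace preservation, the last term have trace `± Tr
  -- (Xᴴ π X)`; in total one negative copy remains.
  have h := (hΦ.cp.posSemidef_sum ![1, X] ![A, -1] hπ).trace_nonneg
  simp only [Fin.sum_univ_two, Matrix.cons_val_zero, Matrix.cons_val_one, conjTranspose_one,
    Matrix.mul_one, Matrix.one_mul, conjTranspose_neg, Matrix.neg_mul, Matrix.mul_neg, neg_neg,
    Matrix.trace_add, Matrix.trace_neg, hΦ.tp] at h
  have h1 : (Aᴴ * Φ (π * X)).trace = (Xᴴ * π * X).trace := by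
    rw [← trace_superAdjoint, ← hX, Matrix.mul_assoc]
  have h2 : (Φ (Xᴴ * π) * A).trace = (Xᴴ * π * X).trace := by
    have e1 : Φ (Xᴴ * π) = (Φ (π * X))ᴴ := by
      rw [← hΦ.cp.map_conjTranspose, conjTranspose_mul, hπ.isHermitian.eq]
    have e2 : (Xᴴ * π * X)ᴴ = Xᴴ * π * X :=
      (isHermitian_conjTranspose_mul_mul X hπ.isHermitian).eq
    rw [e1, ← e2, Matrix.trace_conjTranspose, ← h1, ← Matrix.trace_conjTranspose,
      conjTranspose_mul, conjTranspose_conjTranspose]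
  rw [h1, h2] at h
  convert h using 1
  ring

theorem posSemidef_of_vec {M : Matrix (Fin d × Fin d) (Fin d × Fin d) ℂ} (hM : M.IsHermitian)
    (h : ∀ A : Mat d, 0 ≤ star (vec A) ⬝ᵥ M *ᵥ vec A) : M.PosSemidef :=
  PosSemidef.of_dotProduct_mulVec_nonneg hM fun x => h (unvec x)

theorem star_vec_dotProduct_mul_mul_conjTranspose (Φ : SuperOp d)
    (M : Matrix (Fin d × Fin d) (Fin d × Fin d) ℂ) (A : Mat d) :
    star (vec A) ⬝ᵥ (superMatrix Φ * M * (superMatrix Φ)ᴴ) *ᵥ vec A =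
      star (vec (superAdjoint Φ A)) ⬝ᵥ M *ᵥ vec (superAdjoint Φ A) := by
  rw [← superMatrix_mulVec, superMatrix_superAdjoint, Matrix.star_mulVec,
    conjTranspose_conjTranspose, ← Matrix.dotProduct_mulVec, Matrix.mulVec_mulVec,
    Matrix.mulVec_mulVec]

theorem IsChannel.leftMul_le {Φ : SuperOp d} (hΦ : IsChannel Φ) {π : Mat d} (hπ : π.PosSemidef)
    (hσ : (Φ π).PosSemidef) : (superMatrix (leftMul (Φ π)) -
      superMatrix Φ * superMatrix (leftMul π) * (superMatrix Φ)ᴴ).PosSemidef := by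
  have hh : ∀ {ρ : Mat d}, ρ.PosSemidef → (superMatrix (leftMul ρ)).IsHermitian := fun h => by
    rw [superMatrix_leftMul]
    exact isHermitian_kronecker h.isHermitian isHermitian_one
  refine posSemidef_of_vec ((hh hσ).sub (isHermitian_mul_mul_conjTranspose _ (hh hπ))) fun A => ?_
  rw [Matrix.sub_mulVec, dotProduct_sub, star_vec_dotProduct_mul_mul_conjTranspose,
    superMatrix_mulVec, superMatrix_mulVec, ← trace_conjTranspose_mul, ← trace_conjTranspose_mul]
  simpa [leftMul, Matrix.mul_assoc] using hΦ.trace_le hπ A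

theorem IsChannel.rMat_le {Φ : SuperOp d} (hΦ : IsChannel Φ) {π : Mat d} (hπ : π.PosSemidef)
    (hσ : (Φ π).PosSemidef) :
    (rMat (Φ π) - superMatrix Φ * rMat π * (superMatrix Φ)ᴴ).PosSemidef := by
  have hh : ∀ {ρ : Mat d}, ρ.PosSemidef → (rMat ρ).IsHermitian := fun h =>
    isHermitian_kronecker isHermitian_one h.isHermitian.transpose
  refine posSemidef_of_vec ((hh hσ).sub (isHermitian_mul_mul_conjTranspose _ (hh hπ))) fun A => ?_
  rw [Matrix.sub_mulVec, dotProduct_sub, star_vec_dotProduct_mul_mul_conjTranspose,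
    rMat_mulVec, rMat_mulVec, ← trace_conjTranspose_mul, ← trace_conjTranspose_mul]
  -- Hermitian conjugation turns the bound for left multiplications into the one for right
  -- multiplications.
  have h := hΦ.trace_le hπ Aᴴ
  rw [IsChannel.superAdjoint_conjTranspose hΦ.cp, conjTranspose_conjTranspose,
    conjTranspose_conjTranspose, Matrix.trace_mul_comm, Matrix.trace_mul_comm (_ * π)] at h
  exact h

/-- Monotonicity of the quantum Fisher information under channels. -/
theorem IsChannel.formMat_le {Φ : SuperOp d} (hΦ : IsChannel Φ) {f : ℝ → ℝ}
    (hf : IsStandardMonotone f) {π : Mat d} (hπ : π.PosDef) (hσ : (Φ π).PosDef) :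
    (formMat (fun x => 1 / f x) π π - (superMatrix Φ)ᴴ *
      formMat (fun x => 1 / f x) (Φ π) (Φ π) * superMatrix Φ).PosSemidef := by
  -- The root is `S = R_{√ρ}`. It presents `J_f|_ρ = S f(X) S` as the operator mean of `S² = R_ρ`
  -- and `S X S = L_ρ`, both of which contract under `Φ · Φ†`. The mean then contracts too, and
  -- inversion dualises this to the Fisher form.
  have sqrt_spec : ∀ {ρ : Mat d}, ρ.PosDef → ∃ S : Matrix (Fin d × Fin d) (Fin d × Fin d) ℂ,
      S.PosDef ∧ S * S = rMat ρ ∧ S * modMat ρ ρ * S = superMatrix (leftMul ρ) ∧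
      S * cfc f (modMat ρ ρ) * S = (formMat (fun x => 1 / f x) ρ ρ)⁻¹ := by
    intro ρ hρ
    set s := cfc Real.sqrt ρ with hs
    have hspd : s.PosDef := posDef_cfc hρ fun x hx => Real.sqrt_pos.2 hx
    have hss : s * s = ρ := cfc_sqrt_mul_self hρ.posSemidef
    have hcom : Commute s ρ⁻¹ := cfc_mul_of_intertwines Real.sqrt hρ.isHermitian hρ.isHermitian
      (commute_inv_right hρ).eq
    have hu : IsUnit ρ.det := (Matrix.isUnit_iff_isUnit_det _).1 hρ.isUnit
    have hSS : rMat s * rMat s = rMat ρ := by rw [rMat_mul, hss]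
    refine ⟨rMat s, posDef_rMat hspd, hSS, ?_, ?_⟩
    · rw [(commute_rMat_modMat hcom).eq, Matrix.mul_assoc, hSS, modMat, rMat, kronecker_mul,
        Matrix.mul_one, ← Matrix.transpose_mul, Matrix.mul_nonsing_inv _ hu, Matrix.transpose_one,
        superMatrix_leftMul]
    · rw [← superMatrix_fisherOp_eq_inv hf.pos hρ, superMatrix_fisherOp,
        (commute_rMat_cfc_modMat hρ.isHermitian hρ.isHermitian hcom f).eq, Matrix.mul_assoc, hSS,
        (commute_rMat_cfc_modMat hρ.isHermitian hρ.isHermitian (commute_inv_right hρ) f).eq]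
  obtain ⟨S, hS, hS1, hS2, hS3⟩ := sqrt_spec hπ
  obtain ⟨T, hT, hT1, hT2, hT3⟩ := sqrt_spec hσ
  have h := hf.mean_mono (posDef_modMat hπ hπ) hS (posDef_modMat hσ hσ) hT (F := superMatrix Φ)
    (by rw [hS1, hT1]; exact hΦ.rMat_le hπ.posSemidef hσ.posSemidef)
    (by rw [hS2, hT2]; exact hΦ.leftMul_le hπ.posSemidef hσ.posSemidef)
  rw [hS3, hT3] at h
  have hG := posDef_formMat_inv hf.pos hπ
  have hK := posDef_formMat_inv hf.pos hσ
  have := posSemidef_inv_sub_of_posSemidef hG.inv hK.inv h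
  rwa [Matrix.nonsing_inv_nonsing_inv _ ((Matrix.isUnit_iff_isUnit_det _).1 hG.isUnit),
    Matrix.nonsing_inv_nonsing_inv _ ((Matrix.isUnit_iff_isUnit_det _).1 hK.isUnit)] at this

end Channels

/-! ### The contrast function as a quadratic form with a `C¹` kernel. -/

section Contrast

theorem tendsto_div_sq {u u' : ℝ → ℝ} {w x₀ : ℝ} (hu : ∀ᶠ x in 𝓝 x₀, HasDerivAt u (u' x) x)
    (hu' : HasDerivAt u' w x₀) (h0 : u x₀ = 0) (h0' : u' x₀ = 0) :
    Tendsto (fun x => u x / (x - x₀) ^ 2) (𝓝[≠] x₀) (𝓝 (w / 2)) := by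
  have hu0 := hu.self_of_nhds
  refine HasDerivAt.lhopital_zero_nhdsNE (f' := u') (g' := fun x => 2 * (x - x₀))
    (hu.filter_mono nhdsWithin_le_nhds) (Eventually.of_forall fun x => ?_)
    (eventually_nhdsWithin_of_forall fun x hx => ?_) ?_ ?_ ?_
  · simpa using ((hasDerivAt_id' x).sub_const x₀).fun_pow 2
  · exact mul_ne_zero two_ne_zero (sub_ne_zero.2 hx)
  · rw [← h0]; exact hu0.continuousAt.tendsto.mono_left nhdsWithin_le_nhds
  · have : ContinuousAt (fun x => (x - x₀) ^ 2) x₀ := by fun_prop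
    simpa using this.tendsto.mono_left (nhdsWithin_le_nhds (s := {x₀}ᶜ))
  · have h := (hasDerivAt_iff_tendsto_slope.1 hu').div_const 2
    refine h.congr fun x => ?_
    rw [slope_def_field, h0', sub_zero, div_div, mul_comm 2]

/-- Taylor's formula of order two with a `C¹` quotient. -/
theorem exists_quotient {g : ℝ → ℝ} (hg : ContDiffOn ℝ ∞ g (Ioi 0)) (h1 : g 1 = 0) :
    ∃ (c : ℝ) (k : ℝ → ℝ), ContDiffOn ℝ 1 k (Ioi 0) ∧
      ∀ x, 0 < x → g x = c * (x - 1) + (x - 1) ^ 2 * k x := by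
  have hdiff : ∀ F : ℝ → ℝ, ContDiffOn ℝ ∞ F (Ioi 0) →
      ContDiffOn ℝ ∞ (deriv F) (Ioi 0) ∧ ∀ x, 0 < x → HasDerivAt F (deriv F x) x := fun F hF =>
    ⟨((contDiffOn_infty_iff_deriv_of_isOpen isOpen_Ioi).1 hF).2, fun x hx =>
      ((hF.differentiableOn (by simp)).differentiableAt (Ioi_mem_nhds hx)).hasDerivAt⟩
  obtain ⟨s1, d0⟩ := hdiff g hg
  obtain ⟨s2, d1⟩ := hdiff _ s1
  obtain ⟨s3, d2⟩ := hdiff _ s2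
  set g1 := deriv g
  set g2 := deriv g1
  set g3 := deriv g2
  have hev : ∀ᶠ x : ℝ in 𝓝 1, 0 < x := Ioi_mem_nhds one_pos
  set h : ℝ → ℝ := fun x => g x - g1 1 * (x - 1) with hh
  have dh : ∀ x, 0 < x → HasDerivAt h (g1 x - g1 1) x := fun x hx => by
    simpa using (d0 x hx).fun_sub (((hasDerivAt_id' x).sub_const 1).const_mul (g1 1))
  have dh' : ∀ x, 0 < x → HasDerivAt (fun x => g1 x - g1 1) (g2 x) x := fun x hx =>
    (d1 x hx).sub_const _
  have lim0 : Tendsto (fun x => h x / (x - 1) ^ 2) (𝓝[≠] 1) (𝓝 (g2 1 / 2)) :=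
    tendsto_div_sq (hev.mono dh) (dh' 1 one_pos) (by simp [hh, h1]) (by simp)
  have lim1 : Tendsto (fun x => (g1 x - g1 1 - g2 1 * (x - 1)) / (x - 1) ^ 2) (𝓝[≠] 1)
      (𝓝 (g3 1 / 2)) := by
    refine tendsto_div_sq (u' := fun x => g2 x - g2 1) (hev.mono fun x hx => ?_)
      ((d2 1 one_pos).sub_const _) (by simp) (by simp)
    simpa using (dh' x hx).fun_sub (((hasDerivAt_id' x).sub_const 1).const_mul (g2 1))
  -- The fraction is the derivative of `h / (x - 1)²` away from `1`; its limit is the candidate for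
  -- the derivative of `k` at `1`.
  have lim2 : Tendsto (fun x => ((g1 x - g1 1) * (x - 1) - 2 * h x) / (x - 1) ^ 3) (𝓝[≠] 1)
      (𝓝 (g3 1 / 6)) := by
    have dN : ∀ x, 0 < x → HasDerivAt (fun x => (g1 x - g1 1) * (x - 1) - 2 * h x)
        (g2 x * (x - 1) - (g1 x - g1 1)) x := fun x hx => by
      refine (((dh' x hx).fun_mul ((hasDerivAt_id' x).sub_const 1)).fun_sub
        ((dh x hx).const_mul 2)).congr_deriv ?_
      ring
    refine HasDerivAt.lhopital_zero_nhdsNE (f' := fun x => g2 x * (x - 1) - (g1 x - g1 1))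
      (g' := fun x => 3 * (x - 1) ^ 2) ((hev.filter_mono nhdsWithin_le_nhds).mono dN)
      (Eventually.of_forall fun x => ?_)
      (eventually_nhdsWithin_of_forall fun x hx => ?_) ?_ ?_ ?_
    · simpa using ((hasDerivAt_id' x).sub_const 1).fun_pow 3
    · exact mul_ne_zero three_ne_zero (pow_ne_zero 2 (sub_ne_zero.2 hx))
    · have := (dN 1 one_pos).continuousAt.tendsto.mono_left (nhdsWithin_le_nhds (s := {1}ᶜ))
      simpa [hh, h1] using this
    · have : ContinuousAt (fun x : ℝ => (x - 1) ^ 3) 1 := by fun_prop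
      simpa using this.tendsto.mono_left (nhdsWithin_le_nhds (s := {1}ᶜ))
    · have e : g3 1 / 6 = g3 1 / 3 - g3 1 / 2 / 3 := by ring
      rw [e]
      refine (((hasDerivAt_iff_tendsto_slope.1 (d2 1 one_pos)).div_const 3).sub
        (lim1.div_const 3)).congr' (eventually_nhdsWithin_of_forall fun x hx => ?_)
      have hx' : x - 1 ≠ 0 := sub_ne_zero.2 hx
      rw [slope_def_field]
      field_simp
      ring
  set k : ℝ → ℝ := Function.update (fun x => h x / (x - 1) ^ 2) 1 (g2 1 / 2) with hk
  set k' : ℝ → ℝ := Function.update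
    (fun x => ((g1 x - g1 1) * (x - 1) - 2 * h x) / (x - 1) ^ 3) 1 (g3 1 / 6) with hk'
  have kne : ∀ x, x ≠ 1 → HasDerivAt (fun x => h x / (x - 1) ^ 2) (k' x) x → HasDerivAt k (k' x) x :=
    fun x hx hd => hd.congr_of_eventuallyEq (Filter.eventually_of_mem (isOpen_ne.mem_nhds hx) fun y hy => by
      rw [hk, Function.update_of_ne hy])
  have dk_ne : ∀ x, 0 < x → x ≠ 1 → HasDerivAt k (k' x) x := fun x hx hx1 => by
    have hx' : x - 1 ≠ 0 := sub_ne_zero.2 hx1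
    refine kne x hx1 (((dh x hx).fun_div (((hasDerivAt_id' x).sub_const 1).fun_pow 2)
      (pow_ne_zero 2 hx')).congr_deriv ?_)
    rw [hk', Function.update_of_ne hx1]
    field_simp
    ring
  have ck : ContinuousAt k 1 := continuousAt_update_same.2 lim0
  have ck' : ContinuousAt k' 1 := continuousAt_update_same.2 lim2
  have dk : ∀ x, 0 < x → HasDerivAt k (k' x) x := fun x hx => by
    by_cases hx1 : x = 1
    · subst hx1
      have tl : ∀ S : Set ℝ, S ⊆ {1}ᶜ → S ∈ 𝓝 1 ⊓ 𝓟 S → Tendsto (fun x => deriv k x) (𝓝[S] 1) (𝓝 (k' 1)) :=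
        fun S hS hS' => (ck'.tendsto.mono_left nhdsWithin_le_nhds).congr' (by
          filter_upwards [hS', nhdsWithin_le_nhds hev] with y hy hy0
          exact (dk_ne y hy0 (hS hy)).deriv.symm)
      have A := hasDerivWithinAt_Ici_of_tendsto_deriv (s := Ioi 1)
        (fun y hy => (dk_ne y (one_pos.trans hy) (ne_of_gt hy)).differentiableAt.differentiableWithinAt)
        ck.continuousWithinAt self_mem_nhdsWithin
        (tl _ (fun y hy => ne_of_gt hy) self_mem_nhdsWithin)
      have B := hasDerivWithinAt_Iic_of_tendsto_deriv (s := Ioo 0 1)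
        (fun y hy => (dk_ne y hy.1 (ne_of_lt hy.2)).differentiableAt.differentiableWithinAt)
        ck.continuousWithinAt (Ioo_mem_nhdsLT one_pos)
        (tl _ (fun y hy => ne_of_lt hy) self_mem_nhdsWithin)
      simpa using B.union A
    · exact dk_ne x hx hx1
  have ck'_all : ContinuousOn k' (Ioi 0) := fun x hx => by
    by_cases hx1 : x = 1
    · subst hx1; exact ck'.continuousWithinAt
    · refine ContinuousAt.continuousWithinAt ?_
      refine continuousAt_update_of_ne hx1 |>.2 ?_
      have c1 : ContinuousAt g1 x := (d1 x hx).continuousAt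
      have c2 : ContinuousAt h x := (dh x hx).continuousAt
      have hx' : x - 1 ≠ 0 := sub_ne_zero.2 hx1
      exact (((c1.sub continuousAt_const).mul (by fun_prop)).sub (c2.const_mul 2)).div (by fun_prop)
        (pow_ne_zero 3 hx')
  refine ⟨g1 1, k, ?_, fun x hx => ?_⟩
  · have := (contDiffOn_succ_iff_deriv_of_isOpen (𝕜 := ℝ) (f := k) (n := 0)
      (isOpen_Ioi (a := (0 : ℝ)))).2
      ⟨fun x hx => (dk x hx).differentiableAt.differentiableWithinAt, by simp,
        contDiffOn_zero.2 (ck'_all.congr fun x hx => (dk x hx).deriv)⟩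
    simpa using this
  · by_cases hx1 : x = 1
    · subst hx1; simp [h1]
    · have hx' : x - 1 ≠ 0 := sub_ne_zero.2 hx1
      rw [hk, Function.update_of_ne hx1, hh]
      field_simp
      ring

variable {d : ℕ}

/-- For `X = L_σ R_ρ⁻¹` one has `(X - 1) ρ = σ - ρ` and `(X - 1) 1 = R_ρ⁻¹ (σ - ρ)`. In `⟨1, (X - 1)
k(X) (X - 1) ρ⟩` one factor acts on each side. -/
theorem contrast_eq {g k : ℝ → ℝ} {c : ℝ}
    (hgk : ∀ x, 0 < x → g x = c * (x - 1) + (x - 1) ^ 2 * k x) {ρ σ : Mat d} (hρ : ρ.PosDef)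
    (hσ : σ.PosDef) : contrast g ρ σ = c * (σ - ρ).trace.re +
      (star (vec (σ - ρ)) ⬝ᵥ formMat k σ ρ *ᵥ vec (σ - ρ)).re := by
  have hu : IsUnit ρ.det := (Matrix.isUnit_iff_isUnit_det _).1 hρ.isUnit
  have hX := posDef_modMat hσ hρ
  have hs := hX.isHermitian.isSelfAdjoint
  set X := modMat σ ρ with hXdef
  have hcont : ∀ u : ℝ → ℝ, ContinuousOn u (spectrum ℝ X) := fun u => continuousOn_spectrum u X
  have hX1 : cfc (fun x : ℝ => x - 1) X = X - 1 := by
    rw [cfc_sub _ _ X (hcont _) (hcont _), cfc_id' ℝ X hs, cfc_const_one ℝ X hs]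
  have hcfc : cfc g X = (c : ℂ) • (X - 1) + (X - 1) * cfc k X * (X - 1) := by
    rw [cfc_congr (g := fun x => c * (x - 1) + (x - 1) * k x * (x - 1)) (fun x hx => by
      rw [hgk x (spectrum_pos hX hx)]; ring), cfc_add X _ _ (hcont _) (hcont _),
      cfc_const_mul c _ X (hcont _), cfc_mul _ _ X (hcont _) (hcont _),
      cfc_mul _ _ X (hcont _) (hcont _), hX1, Complex.coe_smul]
  have hv : (X - 1) *ᵥ vec ρ = vec (σ - ρ) := by
    rw [Matrix.sub_mulVec, Matrix.one_mulVec, hXdef, modMat_mulVec, Matrix.mul_assoc,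
      Matrix.mul_nonsing_inv _ hu, Matrix.mul_one, vec_sub]
  have hv1 : (X - 1) *ᵥ vec 1 = rMat ρ⁻¹ *ᵥ vec (σ - ρ) := by
    rw [Matrix.sub_mulVec, Matrix.one_mulVec, hXdef, modMat_mulVec, Matrix.mul_one, rMat_mulVec,
      Matrix.sub_mul, Matrix.mul_nonsing_inv _ hu, vec_sub]
  have hleft : ∀ (M : Matrix (Fin d × Fin d) (Fin d × Fin d) ℂ) (a b : Fin d × Fin d → ℂ),
      M.IsHermitian → star a ⬝ᵥ M *ᵥ b = star (M *ᵥ a) ⬝ᵥ b := fun M a b hM => by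
    rw [Matrix.star_mulVec, hM.eq, ← Matrix.dotProduct_mulVec]
  have hX1h : (X - 1).IsHermitian := hX.isHermitian.sub isHermitian_one
  have htr : ∀ A : Mat d, A.trace = star (vec (1 : Mat d)) ⬝ᵥ vec A := fun A => by
    rw [← trace_conjTranspose_mul]; simp
  rw [contrast, htr, ← superMatrix_mulVec, superMatrix_superFun, superMatrix_modularOp, hcfc,
    Matrix.add_mulVec, Matrix.smul_mulVec, hv, dotProduct_add, dotProduct_smul, ← htr,
    Matrix.mul_assoc, ← Matrix.mulVec_mulVec, ← Matrix.mulVec_mulVec, hv, hleft _ _ _ hX1h, hv1,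
    ← hleft _ _ _ (posDef_rMat hρ.inv).isHermitian, Matrix.mulVec_mulVec, formMat,
    ← hXdef]
  simp

/-- The linear terms cancel in `g(x) + x g(1/x)`, which leaves `(x - 1)²` times the right-hand side.
The relation `Corresponds` is void at `x = 1`, so that point is reached by continuity. -/
theorem Corresponds.one_div_eq {g f k : ℝ → ℝ} {c : ℝ} (hgf : Corresponds g f)
    (hf : IsStandardMonotone f) (hk : ContDiffOn ℝ 1 k (Ioi 0))
    (hgk : ∀ x, 0 < x → g x = c * (x - 1) + (x - 1) ^ 2 * k x) {x : ℝ} (hx : 0 < x) :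
    1 / f x = k x + x⁻¹ * k x⁻¹ := by
  have hne : ∀ y, 0 < y → y ≠ 1 → 1 / f y = k y + y⁻¹ * k y⁻¹ := fun y hy hy1 => by
    have h1 := hgf y hy
    rw [hgk y hy, hgk _ (inv_pos.2 hy)] at h1
    have h2 : (y - 1) ^ 2 * (f y * (k y + y⁻¹ * k y⁻¹)) = (y - 1) ^ 2 * 1 := by
      rw [mul_one]
      refine Eq.trans ?_ h1
      field_simp
      ring
    have h3 := mul_left_cancel₀ (pow_ne_zero 2 (sub_ne_zero.2 hy1)) h2
    rw [one_div]
    exact (eq_inv_of_mul_eq_one_right h3).symm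
  by_cases hx1 : x = 1
  · subst hx1
    have kc : ∀ y, 0 < y → ContinuousAt k y := fun y hy =>
      hk.continuousOn.continuousAt (Ioi_mem_nhds hy)
    have c1 : ContinuousAt (fun y => 1 / f y) 1 :=
      hf.contDiffOn_inv.continuousOn.continuousAt (Ioi_mem_nhds one_pos)
    have ci : ContinuousAt (fun y : ℝ => y⁻¹) 1 := continuousAt_inv₀ one_ne_zero
    have c2 : ContinuousAt (fun y => k y + y⁻¹ * k y⁻¹) 1 :=
      (kc 1 one_pos).add (ci.mul (ContinuousAt.comp (g := k) (kc _ (by norm_num)) ci))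
    refine tendsto_nhds_unique (c1.tendsto.mono_left (nhdsWithin_le_nhds (s := {1}ᶜ)))
      ((c2.tendsto.mono_left (nhdsWithin_le_nhds (s := {1}ᶜ))).congr' ?_)
    filter_upwards [self_mem_nhdsWithin, nhdsWithin_le_nhds (Ioi_mem_nhds one_pos)] with y hy hy0
    exact (hne y hy0 hy).symm
  · exact hne x hx hx1

/-- The second order form of the contrast function is half the Fisher information. -/
theorem re_formMat_eq_fisherInfo {g f k : ℝ → ℝ} {c : ℝ} (hgf : Corresponds g f)
    (hf : IsStandardMonotone f) (hk : ContDiffOn ℝ 1 k (Ioi 0))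
    (hgk : ∀ x, 0 < x → g x = c * (x - 1) + (x - 1) ^ 2 * k x) {π A : Mat d} (hπ : π.PosDef)
    (hA : A.IsHermitian) :
    (star (vec A) ⬝ᵥ formMat k π π *ᵥ vec A).re = 1 / 2 * fisherInfo f π A := by
  rw [fisherInfo_eq f π hA, formMat_congr hπ hπ fun x hx => hgf.one_div_eq hf hk hgk hx,
    formMat_add, ← conjMat_formMat k hπ, Matrix.add_mulVec, dotProduct_add, Complex.add_re,
    re_dotProduct_conjMat _ hA]
  ring

end Contrast

/-! ### Expansion in `ε` of the time derivative of the contrast function. -/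

section Expansion

theorem timeDeriv_eq {F : ℝ → ℝ} {F' t : ℝ} (ht : 0 ≤ t) (h : HasDerivWithinAt F F' (Ici 0) t) :
    timeDeriv F t = F' := h.derivWithin (uniqueDiffOn_Ici 0 t ht)

theorem eventually_posDef {n α : Type*} [Fintype n] [DecidableEq n] {l : Filter α}
    {M : α → Matrix n n ℂ} {M₀ : Matrix n n ℂ} (h : Tendsto M l (𝓝 M₀)) (h0 : M₀.PosDef)
    (hM : ∀ᶠ x in l, (M x).IsHermitian) : ∀ᶠ x in l, (M x).PosDef := by
  obtain ⟨a, b, ha, -, hab⟩ := exists_spectrum_subset_Ioo h0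
  filter_upwards [eventually_spectrum_subset h h0.isHermitian hM hab, hM] with x hx hxh
  rw [hxh.posDef_iff_eigenvalues_pos]
  intro i
  have : hxh.eigenvalues i ∈ spectrum ℝ (M x) := by
    rw [hxh.spectrum_real_eq_range_eigenvalues]
    exact mem_range_self i
  exact ha.trans (hx this).1

theorem isBigO_dotProduct_mulVec {n m : Type*} [Fintype n] [Fintype m] {M : ℝ → Matrix m n ℂ}
    {e : ℝ → ℝ} {l : Filter ℝ} (h : ∀ i j, (fun ε => M ε i j) =O[l] e) (v : m → ℂ) (w : n → ℂ) :
    (fun ε => (v ⬝ᵥ M ε *ᵥ w).re) =O[l] e := by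
  refine IsBigO.trans (IsBigO.of_bound 1 (Eventually.of_forall fun ε => ?_))
    (g := fun ε => v ⬝ᵥ M ε *ᵥ w) ?_
  · rw [one_mul]
    exact Complex.abs_re_le_norm _
  · simp only [dotProduct, mulVec]
    refine IsBigO.fun_sum fun i _ => IsBigO.const_mul_left ?_ (v i)
    refine IsBigO.fun_sum fun j _ => ?_
    simp only [mul_comm _ (w j)]
    exact (h i j).const_mul_left _

theorem isBigO_mul_apply {n m k : Type*} [Fintype n] {M : ℝ → Matrix m n ℂ} {N : ℝ → Matrix n k ℂ}
    {e : ℝ → ℝ} {l : Filter ℝ} (hM : ∀ i j, (fun ε => M ε i j) =O[l] (fun _ => (1 : ℝ)))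
    (hN : ∀ i j, (fun ε => N ε i j) =O[l] e) (i : m) (j : k) :
    (fun ε => (M ε * N ε) i j) =O[l] e := by
  simp only [Matrix.mul_apply]
  refine IsBigO.fun_sum fun a _ => ?_
  simpa using (hM i a).mul (hN a j)

theorem frobSq_smul {n m : Type*} [Fintype n] [Fintype m] (c : ℂ) (A : Matrix m n ℂ) :
    frobSq (c • A) = ‖c‖ ^ 2 * frobSq A := by
  simp only [frobSq, Matrix.smul_apply, smul_eq_mul, norm_mul, mul_pow, Finset.mul_sum]

theorem continuous_frobSq {n m : Type*} [Fintype n] [Fintype m] :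
    Continuous (frobSq : Matrix m n ℂ → ℝ) := by
  unfold frobSq
  exact continuous_finsetSum _ fun i _ => continuous_finsetSum _ fun j _ =>
    (continuous_apply_apply i j).norm.pow 2

theorem HasMatDeriv.isBigO {n m : Type*} [Fintype n] [DecidableEq n] [Fintype m] [DecidableEq m]
    {M : ℝ → Matrix m n ℂ} {M' : Matrix m n ℂ} (h : HasMatDeriv M M' univ 0) (i : m) (j : n) :
    (fun ε => (M ε - M 0) i j) =O[𝓝 0] (fun ε : ℝ => ε) := by
  simpa using ((hasDerivWithinAt_univ.1 (h i j)).isBigO_sub)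

variable {d : ℕ}

/-- The segment `ε ↦ π + ε A`. -/
theorem hasMatDeriv_segment (π A : Mat d) (ε : ℝ) :
    HasMatDeriv (fun ε : ℝ => π + (ε : ℂ) • A) A univ ε := fun i j => by
  have h : HasDerivWithinAt (fun ε : ℝ => (ε : ℂ)) 1 univ ε :=
    (Complex.ofRealCLM.hasDerivAt (x := ε)).hasDerivWithinAt
  simpa using (h.mul_const (A i j)).const_add (π i j)

theorem isHermitian_segment {π A : Mat d} (hπ : π.IsHermitian) (hA : A.IsHermitian) (ε : ℝ) :
    (π + (ε : ℂ) • A).IsHermitian := by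
  refine hπ.add ?_
  rw [IsHermitian, conjTranspose_smul, hA.eq]
  simp

theorem eventually_posDef_segment {π A : Mat d} (hπ : π.PosDef) (hA : A.IsHermitian) :
    ∀ᶠ ε : ℝ in 𝓝 0, (π + (ε : ℂ) • A).PosDef := by
  have h := (hasMatDeriv_segment π A 0).tendsto
  simp only [nhdsWithin_univ, Complex.ofReal_zero, zero_smul, add_zero] at h
  exact eventually_posDef h hπ (Eventually.of_forall fun ε => isHermitian_segment hπ.isHermitian hA ε)

/-- No time is isolated on the axis, so bounds on slopes pass to derivatives. -/
instance neBot_nhdsWithin_Ici_diff (t : ℝ) [ht : Fact (0 ≤ t)] : NeBot (𝓝[Ici 0 \ {t}] t) :=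
  (inferInstance : NeBot (𝓝[>] t)).mono
    (nhdsWithin_mono _ fun _ hx => ⟨ht.out.trans (le_of_lt hx), ne_of_gt hx⟩)

variable {k : ℝ → ℝ} {π A : Mat d} {B : ℝ → Mat d} {B' : Mat d} {t : ℝ}

theorem hasMatDeriv_modMat (hB : HasMatDeriv B B' (Ici 0) t) (ρ : Mat d) (ε : ℝ) :
    HasMatDeriv (fun s => modMat (π + (ε : ℂ) • B s) ρ)
      ((ε : ℂ) • kroneckerMap (· * ·) B' (ρ⁻¹)ᵀ) (Ici 0) t := by
  have h := ((hasMatDeriv_const π _ _).add (hB.const_smul (ε : ℂ))).kronecker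
    (hasMatDeriv_const (ρ⁻¹)ᵀ _ _)
  have e : (ε : ℂ) • kroneckerMap (· * ·) B' (ρ⁻¹)ᵀ =
      kroneckerMap (· * ·) (0 + (ε : ℂ) • B') (ρ⁻¹)ᵀ +
        kroneckerMap (· * ·) (π + (ε : ℂ) • B t) 0 := by
    ext p q
    simp [mul_assoc]
  rw [e]
  exact h

/-- The derivative of `cfc k (modMat …)` along a curve with small velocity is small. -/
theorem exists_hasMatDeriv_cfc_modMat (hk : ContDiffOn ℝ 1 k (Ioi 0)) (hπ : π.PosDef)
    (hA : A.IsHermitian) (ht : 0 ≤ t) (hB : HasMatDeriv B B' (Ici 0) t)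
    (hBh : ∀ᶠ s in 𝓝[Ici 0] t, (B s).IsHermitian) :
    ∃ N : ℝ → Matrix (Fin d × Fin d) (Fin d × Fin d) ℂ,
      (∀ᶠ ε : ℝ in 𝓝 0, HasMatDeriv
        (fun s => cfc k (modMat (π + (ε : ℂ) • B s) (π + (ε : ℂ) • A))) (N ε) (Ici 0) t) ∧
      ∀ i j, (fun ε => N ε i j) =O[𝓝 0] (fun ε : ℝ => ε) := by
  have : Fact (0 ≤ t) := ⟨ht⟩
  have hBt : (B t).IsHermitian := hBh.self_of_nhdsWithin ht
  have hX0 := posDef_modMat hπ hπ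
  obtain ⟨a, b, ha, -, hab⟩ := exists_spectrum_subset_Ioo hX0
  obtain ⟨L, hL, hLip⟩ := exists_lipschitz hk (b := b) ha
  set R : ℝ → Mat d := fun ε => ((π + (ε : ℂ) • A)⁻¹)ᵀ with hR
  have hdet : (π + ((0 : ℝ) : ℂ) • A).det ≠ 0 := by
    simpa using ((Matrix.isUnit_iff_isUnit_det _).1 hπ.isUnit).ne_zero
  obtain ⟨R', hR'⟩ := (hasMatDeriv_segment π A 0).inv hdet
  have hRd : HasMatDeriv R R'ᵀ univ 0 := hR'.transpose
  have hXt : Tendsto (fun ε : ℝ => modMat (π + (ε : ℂ) • B t) (π + (ε : ℂ) • A)) (𝓝 0)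
      (𝓝 (modMat π π)) := by
    have := ((hasMatDeriv_segment π (B t) 0).kronecker hRd).tendsto
    simpa [modMat, hR] using this
  have hXh : ∀ ε : ℝ, (modMat (π + (ε : ℂ) • B t) (π + (ε : ℂ) • A)).IsHermitian := fun ε =>
    isHermitian_modMat (isHermitian_segment hπ.isHermitian hBt ε)
      (isHermitian_segment hπ.isHermitian hA ε)
  have hspec := eventually_spectrum_subset hXt hX0.isHermitian (Eventually.of_forall hXh) hab
  have hpd := eventually_posDef hXt hX0 (Eventually.of_forall hXh)
  have hsh : ∀ ε : ℝ, ∀ᶠ s in 𝓝[Ici 0] t,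
      (modMat (π + (ε : ℂ) • B s) (π + (ε : ℂ) • A)).IsHermitian := fun ε =>
    hBh.mono fun s hs => isHermitian_modMat (isHermitian_segment hπ.isHermitian hs ε)
      (isHermitian_segment hπ.isHermitian hA ε)
  have hex : ∀ ε : ℝ, ∃ N : Matrix (Fin d × Fin d) (Fin d × Fin d) ℂ,
      (modMat (π + (ε : ℂ) • B t) (π + (ε : ℂ) • A)).PosDef → HasMatDeriv
        (fun s => cfc k (modMat (π + (ε : ℂ) • B s) (π + (ε : ℂ) • A))) N (Ici 0) t := fun ε => by
    by_cases h : (modMat (π + (ε : ℂ) • B t) (π + (ε : ℂ) • A)).PosDef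
    · obtain ⟨N, hN⟩ := (hasMatDeriv_modMat (π := π) hB (π + (ε : ℂ) • A) ε).cfc h (hsh ε) hk
      exact ⟨N, fun _ => hN⟩
    · exact ⟨0, fun h' => absurd h' h⟩
  choose N hN using hex
  refine ⟨N, hpd.mono fun ε h => hN ε h, fun i j => ?_⟩
  -- The velocity of the curve is `ε` times `B' ⊗ R(ε)`. The Lipschitz bound is therefore `ψ(ε)
  -- |ε|`, and `ψ` is bounded near `0` by continuity.
  set ψ : ℝ → ℝ := fun ε => L * √(frobSq (kroneckerMap (· * ·) B' (R ε)))
  have hψ : Tendsto ψ (𝓝 0) (𝓝 (ψ 0)) := by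
    have h1 := ((hasMatDeriv_const B' univ 0).kronecker hRd).tendsto
    rw [nhdsWithin_univ] at h1
    exact ((Real.continuous_sqrt.comp continuous_frobSq).tendsto _ |>.comp h1).const_mul L
  have hb : (fun ε => N ε i j) =O[𝓝 0] (fun ε : ℝ => ψ ε * ε) := by
    refine IsBigO.of_bound 1 ?_
    filter_upwards [hspec, hpd] with ε h1 h2
    refine ((hasMatDeriv_modMat (π := π) hB (π + (ε : ℂ) • A) ε).norm_cfc_le h2 (hsh ε) (hN ε h2) hL
      h1 hLip i j).trans_eq ?_
    rw [frobSq_smul, Real.sqrt_mul (sq_nonneg _), Real.sqrt_sq (norm_nonneg _), one_mul, norm_mul,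
      Complex.norm_real, Real.norm_of_nonneg (by positivity : 0 ≤ ψ ε)]
    ring
  refine hb.trans ?_
  simpa using (hψ.isBigO_one ℝ).mul (isBigO_refl (fun ε : ℝ => ε) (𝓝 0))

/-- Equal traces remove the linear term, and the factor `ε²` comes out exactly; the only other
dependence on `ε` is through the base points. -/
theorem contrast_segment {g : ℝ → ℝ} {c : ℝ}
    (hgk : ∀ x, 0 < x → g x = c * (x - 1) + (x - 1) ^ 2 * k x) {C : Mat d} {ε : ℝ}
    (hA : (π + (ε : ℂ) • A).PosDef) (hC : (π + (ε : ℂ) • C).PosDef) (htr : C.trace = A.trace) :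
    contrast g (π + (ε : ℂ) • A) (π + (ε : ℂ) • C) = ε ^ 2 *
      (star (vec (A - C)) ⬝ᵥ formMat k (π + (ε : ℂ) • C) (π + (ε : ℂ) • A) *ᵥ vec (A - C)).re := by
  have e : π + (ε : ℂ) • C - (π + (ε : ℂ) • A) = (-ε : ℂ) • (A - C) := by
    rw [smul_sub, neg_smul, neg_smul]
    abel
  rw [contrast_eq hgk hA hC, e, trace_smul, trace_sub, htr, vec_smul]
  simp only [sub_self, Complex.zero_re, mul_zero, zero_add, star_smul,
    mulVec_smul, dotProduct_smul, smul_dotProduct, smul_eq_mul, star_neg]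
  rw [← mul_assoc, Complex.star_def, Complex.conj_ofReal, neg_mul_neg, ← Complex.ofReal_mul,
    Complex.re_ofReal_mul, sq]

/-- Second order expansion of the time derivative of a contrast function. -/
theorem isBigO_timeDeriv_contrast {g : ℝ → ℝ} {c : ℝ} (hk : ContDiffOn ℝ 1 k (Ioi 0))
    (hgk : ∀ x, 0 < x → g x = c * (x - 1) + (x - 1) ^ 2 * k x) (hπ : π.PosDef)
    (hA : A.IsHermitian) (ht : 0 ≤ t) (hB : HasMatDeriv B B' (Ici 0) t)
    (hBh : ∀ᶠ s in 𝓝[Ici 0] t, (B s).IsHermitian)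
    (hBtr : ∀ᶠ s in 𝓝[Ici 0] t, (B s).trace = A.trace) :
    (fun ε : ℝ => timeDeriv (fun s => contrast g (π + (ε : ℂ) • A) (π + (ε : ℂ) • B s)) t - ε ^ 2 *
      timeDeriv (fun s => (star (vec (A - B s)) ⬝ᵥ formMat k π π *ᵥ vec (A - B s)).re) t)
      =O[𝓝 0] (fun ε : ℝ => ε ^ 3) := by
  have hBt : (B t).IsHermitian := hBh.self_of_nhdsWithin ht
  obtain ⟨N, hN, hNO⟩ := exists_hasMatDeriv_cfc_modMat hk hπ hA ht hB hBh
  set v : ℝ → Fin d × Fin d → ℂ := fun s => vec (A - B s) with hv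
  set Q : ℝ → Matrix (Fin d × Fin d) (Fin d × Fin d) ℂ := fun ε =>
    formMat k (π + (ε : ℂ) • B t) (π + (ε : ℂ) • A) with hQ
  set ρ : ℝ → Mat d := fun ε => π + (ε : ℂ) • A with hρ
  have hQ0 : Q 0 = formMat k π π := by simp [hQ]
  have hdv : ∀ p, HasDerivWithinAt (fun s => v s p) (vec (-B') p) (Ici 0) t := fun p => by
    have := ((hasMatDeriv_const A _ _).sub hB) p.1 p.2
    rwa [zero_sub] at this
  set w := vec (-B')
  have hq : timeDeriv (fun s => (star (v s) ⬝ᵥ formMat k π π *ᵥ v s).re) t =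
      (star w ⬝ᵥ Q 0 *ᵥ v t + star (v t) ⬝ᵥ (0 : Matrix _ _ ℂ) *ᵥ v t +
        star (v t) ⬝ᵥ Q 0 *ᵥ w).re := by
    rw [hQ0]
    exact timeDeriv_eq ht (hasDerivWithinAt_dotProduct_mulVec hdv (hasMatDeriv_const _ _ _) hdv)
  have hdet : (ρ 0).det ≠ 0 := by
    simpa [hρ] using ((Matrix.isUnit_iff_isUnit_det _).1 hπ.isUnit).ne_zero
  obtain ⟨R', hR'⟩ := (hasMatDeriv_segment π A 0).inv hdet
  have hrd := (hasMatDeriv_const (1 : Mat d) univ 0).kronecker hR'.transpose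
  have hQO : ∀ i j, (fun ε => (Q ε - Q 0) i j) =O[𝓝 0] (fun ε : ℝ => ε) := by
    have hX := (hasMatDeriv_segment π (B t) 0).kronecker hR'.transpose
    have hX0 : (kroneckerMap (· * ·) (π + ((0 : ℝ) : ℂ) • B t)
        ((π + ((0 : ℝ) : ℂ) • A)⁻¹)ᵀ).PosDef := by
      simpa [modMat] using posDef_modMat hπ hπ
    obtain ⟨K', hK'⟩ := hX.cfc hX0 (Eventually.of_forall fun ε => isHermitian_modMat
      (isHermitian_segment hπ.isHermitian hBt ε) (isHermitian_segment hπ.isHermitian hA ε)) hk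
    exact fun i j => (hrd.mul hK').isBigO i j
  have hr1 : ∀ i j, (fun ε => rMat (ρ ε)⁻¹ i j) =O[𝓝 0] (fun _ : ℝ => (1 : ℝ)) := fun i j => by
    have := (hasDerivWithinAt_univ.1 (hrd i j)).continuousAt.tendsto
    exact this.isBigO_one ℝ
  -- The product rule for the form: the outer terms differ from their values at `ε = 0` by `O(ε)`,
  -- and the middle term, from the moving base point, is `O(ε)` itself.
  have hmain : ∀ᶠ ε : ℝ in 𝓝 0,
      timeDeriv (fun s => contrast g (ρ ε) (π + (ε : ℂ) • B s)) t = ε ^ 2 *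
        (star w ⬝ᵥ Q ε *ᵥ v t + star (v t) ⬝ᵥ (rMat (ρ ε)⁻¹ * N ε) *ᵥ v t +
          star (v t) ⬝ᵥ Q ε *ᵥ w).re := by
    filter_upwards [hN, eventually_posDef_segment hπ hA, eventually_posDef_segment hπ hBt]
      with ε h1 h2 h3
    have hF : HasMatDeriv (fun s => formMat k (π + (ε : ℂ) • B s) (ρ ε)) (rMat (ρ ε)⁻¹ * N ε)
        (Ici 0) t := by
      have := (hasMatDeriv_const (rMat (ρ ε)⁻¹) _ _).mul h1
      rwa [Matrix.zero_mul, zero_add] at this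
    have hd := (hasDerivWithinAt_dotProduct_mulVec hdv hF hdv).const_mul (ε ^ 2)
    refine timeDeriv_eq ht (hd.congr_of_eventuallyEq ?_ ?_)
    · have hpd : ∀ᶠ s in 𝓝[Ici 0] t, (π + (ε : ℂ) • B s).PosDef :=
        eventually_posDef ((hasMatDeriv_const π _ _).add (hB.const_smul (ε : ℂ))).tendsto h3
          (hBh.mono fun s hs => isHermitian_segment hπ.isHermitian hs ε)
      filter_upwards [hpd, hBtr] with s hs htr using contrast_segment hgk h2 hs htr
    · exact contrast_segment hgk h2 h3 (hBtr.self_of_nhdsWithin ht)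
  have hO : (fun ε : ℝ => ε ^ 2 * ((star w ⬝ᵥ (Q ε - Q 0) *ᵥ v t).re +
      (star (v t) ⬝ᵥ (rMat (ρ ε)⁻¹ * N ε) *ᵥ v t).re + (star (v t) ⬝ᵥ (Q ε - Q 0) *ᵥ w).re))
      =O[𝓝 0] (fun ε : ℝ => ε ^ 3) := by
    have := (isBigO_refl (fun ε : ℝ => ε ^ 2) (𝓝 0)).mul
      (((isBigO_dotProduct_mulVec hQO (star w) (v t)).add
      (isBigO_dotProduct_mulVec (isBigO_mul_apply hr1 hNO) (star (v t)) (v t))).add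
      (isBigO_dotProduct_mulVec hQO (star (v t)) w))
    simpa only [← pow_succ] using this
  refine hO.congr' ?_ EventuallyEq.rfl
  filter_upwards [hmain] with ε h
  rw [h, hq]
  simp only [Matrix.sub_mulVec, dotProduct_sub, Complex.add_re, Complex.sub_re, zero_mulVec,
    dotProduct_zero, Complex.zero_re]
  ring

end Expansion

/-! ### Extremal directions and the structure of the Petz map. -/

section Retrodiction

theorem HasMatDeriv.mulVec {n m : Type*} [Fintype n] {M : ℝ → Matrix m n ℂ}
    {M' : Matrix m n ℂ} {S : Set ℝ} {t : ℝ} (h : ∀ i j, HasDerivWithinAt (fun s => M s i j) (M' i j) S t)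
    (v : n → ℂ) (i : m) : HasDerivWithinAt (fun s => (M s *ᵥ v) i) ((M' *ᵥ v) i) S t :=
  HasDerivWithinAt.fun_sum fun j _ => (h i j).mul_const (v j)

theorem HasMatDeriv.isHermitian {n : Type*} {M : ℝ → Matrix n n ℂ}
    {M' : Matrix n n ℂ} {S : Set ℝ} {t : ℝ} (h : ∀ i j, HasDerivWithinAt (fun s => M s i j) (M' i j) S t)
    (hM : ∀ s ∈ S, (M s).IsHermitian) (hS : UniqueDiffWithinAt ℝ S t) (ht : t ∈ S) :
    M'.IsHermitian := by
  ext i j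
  rw [conjTranspose_apply]
  refine hS.eq_deriv S ?_ (h i j)
  exact (h j i).star.congr (fun s hs => ((hM s hs).apply i j).symm) ((hM t ht).apply i j).symm

/-- A positive right derivative excludes that a function decreases to the right. -/
theorem HasDerivWithinAt.nonpos_of_eventually_le {F : ℝ → ℝ} {F' t : ℝ} (ht : 0 ≤ t)
    (h : HasDerivWithinAt F F' (Ici 0) t) (hle : ∀ᶠ s in 𝓝[>] t, F s ≤ F t) : F' ≤ 0 := by
  have h1 := (hasDerivWithinAt_iff_tendsto_slope.1
    (h.mono (fun x hx => ht.trans (le_of_lt hx) : Ioi t ⊆ Ici 0)))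
  rw [sdiff_singleton_eq_self (by simp)] at h1
  refine le_of_tendsto h1 ?_
  filter_upwards [hle, self_mem_nhdsWithin] with s hs hst
  rw [slope_def_field]
  exact div_nonpos_of_nonpos_of_nonneg (sub_nonpos.2 hs) (sub_nonneg.2 (le_of_lt hst))

section Rayleigh

variable {n : Type*} [Fintype n]

theorem continuous_re_form (M : Matrix n n ℂ) :
    Continuous fun x : n → ℂ => (star x ⬝ᵥ M *ᵥ x).re := by
  simp only [dotProduct, mulVec, Pi.star_apply]
  fun_prop

theorem re_form_symm {M : Matrix n n ℂ} (hM : M.IsHermitian) (x y : n → ℂ) :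
    (star x ⬝ᵥ M *ᵥ y).re = (star y ⬝ᵥ M *ᵥ x).re := by
  have h : star x ⬝ᵥ M *ᵥ y = star (star y ⬝ᵥ M *ᵥ x) := by
    rw [← Matrix.star_dotProduct_star, star_star, Matrix.star_mulVec, hM.eq,
      ← Matrix.dotProduct_mulVec]
  rw [h]
  rfl

/-- The critical point equation for the maximum of a generalised Rayleigh quotient on a real
subspace. -/
theorem exists_max_rayleigh {N G : Matrix n n ℂ} (hN : N.IsHermitian) (hG : G.PosDef)
    (V : Submodule ℝ (n → ℂ)) {x₀ : n → ℂ} (hx₀ : x₀ ∈ V) (hpos : 0 < (star x₀ ⬝ᵥ N *ᵥ x₀).re) :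
    ∃ v ∈ V, v ≠ 0 ∧ ∃ r : ℝ, 0 < r ∧
      ∀ x ∈ V, (star x ⬝ᵥ N *ᵥ v).re = r * (star x ⬝ᵥ G *ᵥ v).re := by
  have hGpos : ∀ x : n → ℂ, x ≠ 0 → 0 < (star x ⬝ᵥ G *ᵥ x).re := fun x hx =>
    (Complex.lt_def.1 (hG.dotProduct_mulVec_pos hx)).1
  have hsc : ∀ (M : Matrix n n ℂ) (c : ℝ) (x : n → ℂ), (star (c • x) ⬝ᵥ M *ᵥ (c • x)).re =
      c ^ 2 * (star x ⬝ᵥ M *ᵥ x).re := fun M c x => by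
    rw [star_smul, mulVec_smul, smul_dotProduct, dotProduct_smul, smul_smul, Complex.smul_re]
    simp [sq]
  have hx0 : x₀ ≠ 0 := by
    rintro rfl
    simp at hpos
  set K : Set (n → ℂ) := (V : Set (n → ℂ)) ∩ Metric.sphere 0 1 with hK
  have hKc : IsCompact K := (isCompact_sphere _ _).inter_left V.closed_of_finiteDimensional
  have hK0 : ∀ x ∈ K, x ≠ 0 := fun x hx h0 => by
    have := hx.2
    simp [h0] at this
  have hKn : ∀ x ∈ V, x ≠ 0 → (‖x‖⁻¹ : ℝ) • x ∈ K := fun x hx h0 =>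
    ⟨V.smul_mem _ hx, by simp [norm_smul, h0]⟩
  obtain ⟨v, hv, hmax⟩ := hKc.exists_isMaxOn ⟨_, hKn x₀ hx₀ hx0⟩
    (f := fun x => (star x ⬝ᵥ N *ᵥ x).re / (star x ⬝ᵥ G *ᵥ x).re)
    ((continuous_re_form N).continuousOn.div (continuous_re_form G).continuousOn
      fun x hx => (hGpos x (hK0 x hx)).ne')
  set r := (star v ⬝ᵥ N *ᵥ v).re / (star v ⬝ᵥ G *ᵥ v).re with hr
  have hle : ∀ x ∈ V, x ≠ 0 → (star x ⬝ᵥ N *ᵥ x).re / (star x ⬝ᵥ G *ᵥ x).re ≤ r :=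
    fun x hx h0 => by
    have h := hmax (hKn x hx h0)
    simp only [mem_ofPred_eq, hsc] at h
    rwa [mul_div_mul_left _ _ (pow_ne_zero 2 (inv_ne_zero (norm_ne_zero_iff.2 h0)))] at h
  have hv0 := hK0 v hv
  refine ⟨v, hv.1, hv0, r, (div_pos hpos (hGpos x₀ hx0)).trans_le (hle x₀ hx₀ hx0),
    fun x hx => ?_⟩
  have hnn : ∀ y ∈ V, 0 ≤ r * (star y ⬝ᵥ G *ᵥ y).re - (star y ⬝ᵥ N *ᵥ y).re := fun y hy => by
    by_cases h0 : y = 0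
    · simp [h0]
    · exact sub_nonneg.2 ((div_le_iff₀ (hGpos y h0)).1 (hle y hy h0))
  have hexp : ∀ (M : Matrix n n ℂ), M.IsHermitian → ∀ s : ℝ,
      (star (v + s • x) ⬝ᵥ M *ᵥ (v + s • x)).re = (star v ⬝ᵥ M *ᵥ v).re +
        2 * s * (star x ⬝ᵥ M *ᵥ v).re + s ^ 2 * (star x ⬝ᵥ M *ᵥ x).re := fun M hM s => by
    rw [mulVec_add, dotProduct_add, star_add, add_dotProduct, add_dotProduct, Complex.add_re,
      Complex.add_re, Complex.add_re, hsc]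
    have h1 : (star (s • x) ⬝ᵥ M *ᵥ v).re = s * (star x ⬝ᵥ M *ᵥ v).re := by
      rw [star_smul, smul_dotProduct, Complex.smul_re]
      simp
    rw [re_form_symm hM v (s • x), h1]
    ring
  have hrv : r * (star v ⬝ᵥ G *ᵥ v).re = (star v ⬝ᵥ N *ᵥ v).re :=
    div_mul_cancel₀ _ (hGpos v hv0).ne'
  -- The form `r G - N` is nonnegative on `V` and vanishes at `v`. Along `v + s x` it is a
  -- nonnegative quadratic in `s` without constant term, hence without linear term.
  have hd := discrim_le_zero (a := r * (star x ⬝ᵥ G *ᵥ x).re - (star x ⬝ᵥ N *ᵥ x).re)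
    (b := 2 * (r * (star x ⬝ᵥ G *ᵥ v).re - (star x ⬝ᵥ N *ᵥ v).re)) (c := 0) fun s => by
    have := hnn _ (V.add_mem hv.1 (V.smul_mem s hx))
    rw [hexp G hG.isHermitian, hexp N hN] at this
    linarith
  rw [discrim, mul_zero, sub_zero] at hd
  have h0 := pow_eq_zero_iff two_ne_zero |>.1 (le_antisymm hd (sq_nonneg _))
  linarith

end Rayleigh

variable {d : ℕ}

/-- The real vector space of the traceless Hermitian matrices. -/
def tracelessHermitian (d : ℕ) : Submodule ℝ (Fin d × Fin d → ℂ) where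
  carrier := {v | (unvec v).IsHermitian ∧ (unvec v).trace = 0}
  zero_mem' := ⟨isHermitian_zero, trace_zero _ _⟩
  add_mem' := fun {v w} hv hw => ⟨hv.1.add hw.1, (trace_add (unvec v) (unvec w)).trans (by
    rw [hv.2, hw.2, add_zero])⟩
  smul_mem' := fun c v hv => ⟨hv.1.smul (IsSelfAdjoint.all c), (trace_smul c (unvec v)).trans (by
    rw [hv.2, smul_zero])⟩

/-- The matrix of the Fisher form at `Φ π`, pulled back along `Φ`. -/
def pullMat (f : ℝ → ℝ) (Φ : SuperOp d) (π : Mat d) :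
    Matrix (Fin d × Fin d) (Fin d × Fin d) ℂ :=
  (superMatrix Φ)ᴴ * formMat (fun x => 1 / f x) (Φ π) (Φ π) * superMatrix Φ

variable {f f₀ : ℝ → ℝ} {Φ : SuperOp d} {π : Mat d}

/-- This factorisation puts all the time dependence of retrodiction into the self-adjoint matrix
`pullMat`. -/
theorem superMatrix_petzMap_comp (hf₀ : IsStandardMonotone f₀) (hπ : π.PosDef) :
    superMatrix (petzMap f₀ f Φ π ∘ₗ Φ) =
      (formMat (fun x => 1 / f₀ x) π π)⁻¹ * pullMat f Φ π := by
  rw [petzMap, superMatrix_comp, superMatrix_comp, superMatrix_comp, superMatrix_superAdjoint,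
    superMatrix_fisherOp_eq_inv hf₀.pos hπ, superMatrix_fisherOpInv, pullMat]
  simp only [Matrix.mul_assoc]

theorem isHermitian_formMat {h : ℝ → ℝ} {σ ρ : Mat d} (hσ : σ.IsHermitian) (hρ : ρ.IsHermitian) :
    (formMat h σ ρ).IsHermitian := by
  have hr : (rMat ρ⁻¹).IsHermitian := isHermitian_kronecker isHermitian_one hρ.inv.transpose
  rw [IsHermitian, formMat, conjTranspose_mul, (isHermitian_cfc _ _).eq, hr.eq]
  exact (commute_rMat_cfc_modMat hσ hρ (Commute.refl _) h).eq.symm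

theorem IsChannel.isHermitian_map (hΦ : IsChannel Φ) {A : Mat d} (hA : A.IsHermitian) :
    (Φ A).IsHermitian := by
  rw [IsHermitian, ← hΦ.cp.map_conjTranspose, hA.eq]

theorem isHermitian_pullMat (hΦ : IsChannel Φ) (hπ : π.IsHermitian) :
    (pullMat f Φ π).IsHermitian :=
  isHermitian_conjTranspose_mul_mul _
    (isHermitian_formMat (hΦ.isHermitian_map hπ) (hΦ.isHermitian_map hπ))

theorem star_dotProduct_conjTranspose_mul_mul {n : Type*} [Fintype n] (F M : Matrix n n ℂ)
    (v : n → ℂ) : star v ⬝ᵥ (Fᴴ * M * F) *ᵥ v = star (F *ᵥ v) ⬝ᵥ M *ᵥ (F *ᵥ v) := by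
  rw [Matrix.mul_assoc, ← Matrix.mulVec_mulVec, ← Matrix.mulVec_mulVec, Matrix.star_mulVec,
    ← Matrix.dotProduct_mulVec]

theorem fisherInfo_map_eq (hΦ : IsChannel Φ) {A : Mat d} (hA : A.IsHermitian) :
    fisherInfo f (Φ π) (Φ A) = (star (vec A) ⬝ᵥ pullMat f Φ π *ᵥ vec A).re := by
  rw [fisherInfo_eq f _ (hΦ.isHermitian_map hA), pullMat, star_dotProduct_conjTranspose_mul_mul,
    superMatrix_mulVec]

theorem petzMap_conjTranspose (hf₀ : IsStandardMonotone f₀) (hf : IsStandardMonotone f)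
    (hΦ : IsChannel Φ) (hπ : π.PosDef) (hσ : (Φ π).PosDef) (A : Mat d) :
    petzMap f₀ f Φ π (Φ Aᴴ) = (petzMap f₀ f Φ π (Φ A))ᴴ := by
  have hF := (conjMat_eq_iff Φ).2 hΦ.cp.map_conjTranspose
  have h : conjMat (superMatrix (petzMap f₀ f Φ π ∘ₗ Φ)) =
      superMatrix (petzMap f₀ f Φ π ∘ₗ Φ) := by
    rw [superMatrix_petzMap_comp hf₀ hπ, pullMat, map_mul, map_mul, map_mul,
      conjMat_inv (posDef_formMat_inv hf₀.pos hπ) (hf₀.conjMat_formMat hπ),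
      conjMat_conjTranspose hF, hf.conjMat_formMat hσ, hF]
  have e : ∀ X, (petzMap f₀ f Φ π ∘ₗ Φ) X = petzMap f₀ f Φ π (Φ X) := fun X => by
    rw [← LinearMap.comp_apply]
  exact (e Aᴴ).symm.trans (((conjMat_eq_iff _).1 h A).trans (congrArg conjTranspose (e A)))

theorem cfc_mulVec_of_mulVec_eq {n : Type*} [Fintype n] [DecidableEq n] {X : Matrix n n ℂ}
    (hX : X.IsHermitian) (h : ℝ → ℝ) {v : n → ℂ} (hv : X *ᵥ v = v) :
    cfc h X *ᵥ v = (h 1 : ℂ) • v := by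
  have e : ∀ M : Matrix n n ℂ, M * replicateCol Unit v = replicateCol Unit (M *ᵥ v) := fun M =>
    (replicateCol_mulVec M v).symm
  have h1 := cfc_mul_of_intertwines h hX (isHermitian_one (n := Unit) (α := ℂ))
    (W := replicateCol Unit v) (by rw [e, hv, Matrix.mul_one])
  have h0 : cfc h (1 : Matrix Unit Unit ℂ) = algebraMap ℝ _ (h 1) := by
    rw [← map_one (algebraMap ℝ (Matrix Unit Unit ℂ)), cfc_algebraMap]
  rw [e, h0] at h1
  ext i
  have h2 := congrFun (congrFun h1 i) ()
  simpa [Algebra.algebraMap_eq_smul_one] using h2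

theorem formMat_mulVec_self {h : ℝ → ℝ} (h1 : h 1 = 1) {ρ : Mat d} (hρ : ρ.PosDef) :
    formMat h ρ ρ *ᵥ vec ρ = vec 1 := by
  have hu : IsUnit ρ.det := (Matrix.isUnit_iff_isUnit_det _).1 hρ.isUnit
  have hv : modMat ρ ρ *ᵥ vec ρ = vec ρ := by
    rw [modMat_mulVec, Matrix.mul_assoc, Matrix.mul_nonsing_inv _ hu, Matrix.mul_one]
  rw [formMat, ← Matrix.mulVec_mulVec,
    cfc_mulVec_of_mulVec_eq (posDef_modMat hρ hρ).isHermitian h hv, h1, Complex.ofReal_one, one_smul,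
    rMat_mulVec, Matrix.mul_nonsing_inv _ hu]

theorem IsChannel.superAdjoint_one (hΦ : IsChannel Φ) : superAdjoint Φ 1 = 1 := by
  have h : star (vec (superAdjoint Φ 1)) = star (vec (1 : Mat d)) := by
    refine dotProduct_eq _ _ fun u => ?_
    have := trace_superAdjoint Φ 1 (unvec u)
    rw [trace_conjTranspose_mul, vec_unvec, conjTranspose_one, Matrix.one_mul, hΦ.tp] at this
    rw [this, ← vec_unvec u, ← trace_conjTranspose_mul, conjTranspose_one, Matrix.one_mul,
      vec_unvec]
  exact vec_injective (star_injective h)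

/-- The state is the eigenvector with eigenvalue `1` of its modular operator and `f 1 = 1`, so
`J_f⁻¹` sends `Φ π` to `1`; the adjoint of a channel is unital. -/
theorem pullMat_mulVec_self (hf : IsStandardMonotone f) (hΦ : IsChannel Φ)
    (hσ : (Φ π).PosDef) : pullMat f Φ π *ᵥ vec π = vec 1 := by
  rw [pullMat, Matrix.mul_assoc, ← Matrix.mulVec_mulVec, ← Matrix.mulVec_mulVec, superMatrix_mulVec,
    formMat_mulVec_self (by rw [hf.normalized, div_one]) hσ, ← superMatrix_superAdjoint,
    superMatrix_mulVec, hΦ.superAdjoint_one]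

theorem formMat_inv_mulVec_one (hf₀ : IsStandardMonotone f₀) (hπ : π.PosDef) :
    (formMat (fun x => 1 / f₀ x) π π)⁻¹ *ᵥ vec 1 = vec π := by
  have hu := (Matrix.isUnit_iff_isUnit_det _).1 (posDef_formMat_inv hf₀.pos hπ).isUnit
  rw [← formMat_mulVec_self (h := fun x => 1 / f₀ x) (by simp [hf₀.normalized]) hπ,
    Matrix.mulVec_mulVec, Matrix.nonsing_inv_mul _ hu, Matrix.one_mulVec]

theorem petzMap_apply_self (hf₀ : IsStandardMonotone f₀) (hf : IsStandardMonotone f)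
    (hΦ : IsChannel Φ) (hπ : π.PosDef) (hσ : (Φ π).PosDef) : petzMap f₀ f Φ π (Φ π) = π := by
  refine vec_injective ?_
  rw [← LinearMap.comp_apply, ← superMatrix_mulVec, superMatrix_petzMap_comp hf₀ hπ,
    ← Matrix.mulVec_mulVec, pullMat_mulVec_self hf hΦ hσ, formMat_inv_mulVec_one hf₀ hπ]

/-- With `G` and `N` as above, `⟨1, G⁻¹ N A⟩ = ⟨N G⁻¹ 1, A⟩ = ⟨N π, A⟩ = ⟨1, A⟩`. -/
theorem trace_petzMap (hf₀ : IsStandardMonotone f₀) (hf : IsStandardMonotone f)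
    (hΦ : IsChannel Φ) (hπ : π.PosDef) (hσ : (Φ π).PosDef) (A : Mat d) :
    (petzMap f₀ f Φ π (Φ A)).trace = A.trace := by
  have htr : ∀ A : Mat d, A.trace = star (vec (1 : Mat d)) ⬝ᵥ vec A := fun A => by
    rw [← trace_conjTranspose_mul]; simp
  have hleft : ∀ (M : Matrix (Fin d × Fin d) (Fin d × Fin d) ℂ) (a b : Fin d × Fin d → ℂ),
      M.IsHermitian → star a ⬝ᵥ M *ᵥ b = star (M *ᵥ a) ⬝ᵥ b := fun M a b hM => by
    rw [Matrix.star_mulVec, hM.eq, ← Matrix.dotProduct_mulVec]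
  rw [htr, htr, ← LinearMap.comp_apply, ← superMatrix_mulVec, superMatrix_petzMap_comp hf₀ hπ,
    ← Matrix.mulVec_mulVec, hleft _ _ _ (posDef_formMat_inv hf₀.pos hπ).isHermitian.inv,
    formMat_inv_mulVec_one hf₀ hπ, hleft _ _ _ (isHermitian_pullMat hΦ hπ.isHermitian),
    pullMat_mulVec_self hf hΦ hσ]

/-- Two steps: `1 / f ≤ 1 / f₀` compares the forms at `π`, and contraction under `Φ` compares the
form of `f` at `π` with its pullback. -/
theorem pullMat_le (hf₀ : IsStandardMonotone f₀) (hf : IsStandardMonotone f)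
    (hle : ∀ x : ℝ, 0 < x → f₀ x ≤ f x) (hΦ : IsChannel Φ) (hπ : π.PosDef) (hσ : (Φ π).PosDef) :
    (formMat (fun x => 1 / f₀ x) π π - pullMat f Φ π).PosSemidef := by
  have h := (formMat_le hf₀.pos hle hπ).add (hΦ.formMat_le hf hπ hσ)
  rwa [sub_add_sub_cancel] at h

theorem pullMat_comp_le (hf : IsStandardMonotone f) {Λ : SuperOp d} (hΛ : IsChannel Λ)
    (hσ : (Φ π).PosDef) (hσ' : (Λ (Φ π)).PosDef) :
    (pullMat f Φ π - pullMat f (Λ ∘ₗ Φ) π).PosSemidef := by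
  have h := (hΛ.formMat_le hf hσ hσ').conjTranspose_mul_mul_same (superMatrix Φ)
  convert h using 1
  rw [pullMat, pullMat, superMatrix_comp, conjTranspose_mul, Matrix.mul_sub, Matrix.sub_mul]
  simp only [Matrix.mul_assoc, LinearMap.comp_apply]

theorem HasMatDeriv.formMat_self {M : ℝ → Mat d} {M' : Mat d} {S : Set ℝ} {t : ℝ} {h : ℝ → ℝ}
    (hM : HasMatDeriv M M' S t) (hpd : (M t).PosDef) (hh : ∀ᶠ s in 𝓝[S] t, (M s).IsHermitian)
    (hf : ContDiffOn ℝ 1 h (Ioi 0)) :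
    ∃ N', HasMatDeriv (fun s => formMat h (M s) (M s)) N' S t := by
  obtain ⟨R, hR⟩ := hM.inv ((Matrix.isUnit_iff_isUnit_det _).1 hpd.isUnit).ne_zero
  obtain ⟨K, hK⟩ := (hM.kronecker hR.transpose).cfc (posDef_modMat hpd hpd)
    (hh.mono fun s hs => isHermitian_modMat hs hs) hf
  exact ⟨_, ((hasMatDeriv_const (1 : Mat d) S t).kronecker hR.transpose).mul hK⟩

variable {Ψ : ℝ → SuperOp d} {t : ℝ}

theorem IsDivisible.exists_hasMatDeriv (hΨ : IsDivisible Ψ) (ht : 0 ≤ t) (A : Mat d) :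
    ∃ A', HasMatDeriv (fun s => Ψ s A) A' (Ici 0) t :=
  HasMatDeriv.of_differentiable fun i j => (hΨ.smooth A i j).differentiableOn (by simp) t ht

theorem IsDivisible.exists_hasMatDeriv_superMatrix (hΨ : IsDivisible Ψ) (ht : 0 ≤ t) :
    ∃ F', HasMatDeriv (fun s => superMatrix (Ψ s)) F' (Ici 0) t := by
  refine HasMatDeriv.of_differentiable fun p q => ?_
  have h := (hΨ.smooth (unvec (Pi.single q 1)) p.1 p.2).differentiableOn (by simp) t ht
  have e : ∀ s, superMatrix (Ψ s) p q = Ψ s (unvec (Pi.single q 1)) p.1 p.2 := fun s => by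
    have e := congrFun (superMatrix_mulVec (Ψ s) (unvec (Pi.single q 1))) p
    rw [vec_unvec, Matrix.mulVec_single_one] at e
    exact e
  exact h.congr (fun s _ => e s) (e t)

theorem IsDivisible.exists_hasMatDeriv_pullMat (hΨ : IsDivisible Ψ) (hf : IsStandardMonotone f)
    (hπ : π.PosDef) (ht : 0 ≤ t) (hσ : (Ψ t π).PosDef) :
    ∃ N', HasMatDeriv (fun s => pullMat f (Ψ s) π) N' (Ici 0) t := by
  obtain ⟨F', hF⟩ := hΨ.exists_hasMatDeriv_superMatrix ht
  obtain ⟨σ', hσ'⟩ := hΨ.exists_hasMatDeriv ht π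
  obtain ⟨J', hJ⟩ := hσ'.formMat_self hσ (eventually_nhdsWithin_of_forall fun s hs =>
    (hΨ.channel s hs).isHermitian_map hπ.isHermitian) hf.contDiffOn_inv
  exact ⟨_, (hF.conjTranspose.mul hJ).mul hF⟩

theorem IsDivisible.eventually_posDef (hΨ : IsDivisible Ψ) (hπ : π.PosDef) (ht : 0 ≤ t)
    (hσ : (Ψ t π).PosDef) : ∀ᶠ s in 𝓝[Ici 0] t, (Ψ s π).PosDef := by
  obtain ⟨σ', hσ'⟩ := hΨ.exists_hasMatDeriv ht π
  exact QFisher.eventually_posDef hσ'.tendsto hσ (eventually_nhdsWithin_of_forall fun s hs =>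
    (hΨ.channel s hs).isHermitian_map hπ.isHermitian)

theorem timeDeriv_congr {F G : ℝ → ℝ} (ht : 0 ≤ t) (h : ∀ᶠ s in 𝓝[Ici 0] t, F s = G s) :
    timeDeriv F t = timeDeriv G t :=
  Filter.EventuallyEq.derivWithin_eq h (h.self_of_nhdsWithin ht)

theorem eventually_neg_of_isBigO {D : ℝ → ℝ} {q : ℝ} (hq : q < 0)
    (h : (fun ε : ℝ => D ε - ε ^ 2 * q) =O[𝓝 0] (fun ε : ℝ => ε ^ 3)) :
    ∀ᶠ ε : ℝ in 𝓝[≠] 0, D ε < 0 := by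
  obtain ⟨C, hC⟩ := h.bound
  have hlim : Tendsto (fun ε : ℝ => C * |ε|) (𝓝 0) (𝓝 0) := by
    have : Continuous fun ε : ℝ => C * |ε| := by fun_prop
    simpa using this.tendsto 0
  filter_upwards [nhdsWithin_le_nhds hC,
    nhdsWithin_le_nhds (hlim.eventually (gt_mem_nhds (neg_pos.2 hq))), self_mem_nhdsWithin]
    with ε h1 h2 h3
  rw [Real.norm_eq_abs, Real.norm_eq_abs, abs_pow] at h1
  have h4 := (le_abs_self _).trans h1
  have h5 : 0 < ε ^ 2 := by
    have : ε ≠ 0 := h3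
    positivity
  have h6 : C * |ε| ^ 3 = ε ^ 2 * (C * |ε|) := by
    rw [pow_succ, sq_abs]; ring
  nlinarith

end Retrodiction

/-! ### The flow of Fisher information against the retrodiction error. -/

section Flow

variable {d : ℕ} {f f₀ : ℝ → ℝ} {π : Mat d} {Ψ : ℝ → SuperOp d} {t : ℝ}

theorem mem_tracelessHermitian {A : Mat d} (hA : A.IsHermitian) (htr : A.trace = 0) :
    vec A ∈ tracelessHermitian d := ⟨hA, htr⟩

theorem hasDerivWithinAt_pull {N' : Matrix (Fin d × Fin d) (Fin d × Fin d) ℂ}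
    (hN : HasMatDeriv (fun s => pullMat f (Ψ s) π) N' (Ici 0) t) (v : Fin d × Fin d → ℂ) :
    HasDerivWithinAt (fun s => (star v ⬝ᵥ pullMat f (Ψ s) π *ᵥ v).re) (star v ⬝ᵥ N' *ᵥ v).re
      (Ici 0) t := by
  have hc : ∀ i, HasDerivWithinAt (fun _ : ℝ => v i) ((0 : Fin d × Fin d → ℂ) i) (Ici 0) t :=
    fun i => hasDerivWithinAt_const _ _ _
  simpa using hasDerivWithinAt_dotProduct_mulVec hc hN hc

theorem IsDivisible.timeDeriv_fisherInfo (hΨ : IsDivisible Ψ) (ht : 0 ≤ t)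
    {N' : Matrix (Fin d × Fin d) (Fin d × Fin d) ℂ}
    (hN : HasMatDeriv (fun s => pullMat f (Ψ s) π) N' (Ici 0) t) {A : Mat d} (hA : A.IsHermitian) :
    timeDeriv (fun s => fisherInfo f (Ψ s π) (Ψ s A)) t = (star (vec A) ⬝ᵥ N' *ᵥ vec A).re := by
  rw [← timeDeriv_eq ht (hasDerivWithinAt_pull hN (vec A))]
  exact timeDeriv_congr ht (eventually_nhdsWithin_of_forall fun s hs =>
    fisherInfo_map_eq (hΨ.channel s hs) hA)

theorem nhdsGT_le_nhdsWithin_Ici (ht : 0 ≤ t) : 𝓝[>] t ≤ 𝓝[Ici 0] t :=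
  nhdsWithin_mono _ fun _ hx => ht.trans (le_of_lt hx)

/-- An increasing Fisher information excludes Markovianity. -/
theorem IsDivisible.not_isMarkovianAfter (hΨ : IsDivisible Ψ) (hf : IsStandardMonotone f)
    (hπ : π.PosDef) (ht : 0 ≤ t) (hσ : (Ψ t π).PosDef)
    {N' : Matrix (Fin d × Fin d) (Fin d × Fin d) ℂ}
    (hN : HasMatDeriv (fun s => pullMat f (Ψ s) π) N' (Ici 0) t) {v : Fin d × Fin d → ℂ}
    (hv : 0 < (star v ⬝ᵥ N' *ᵥ v).re) : ¬ IsMarkovianAfter Ψ t := by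
  rintro ⟨η, hη, h⟩
  refine not_le.2 hv (HasDerivWithinAt.nonpos_of_eventually_le ht (hasDerivWithinAt_pull hN v) ?_)
  filter_upwards [nhdsGT_le_nhdsWithin_Ici ht (hΨ.eventually_posDef hπ ht hσ),
    Ioo_mem_nhdsGT (by linarith : t < t + η)] with u hu hu'
  obtain ⟨Λ, hΛ, e⟩ := h u hu'.1 hu'.2
  have h1 := (pullMat_comp_le hf hΛ hσ (by rwa [← LinearMap.comp_apply, ← e])).dotProduct_mulVec_nonneg v
  rw [← e, Matrix.sub_mulVec, dotProduct_sub] at h1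
  exact sub_nonneg.1 (Complex.le_def.1 h1).1

variable {A : Mat d} {N' : Matrix (Fin d × Fin d) (Fin d × Fin d) ℂ}

/-- A perturbation with increasing Fisher information is not perfectly retrodicted. -/
theorem IsDivisible.form_lt (hΨ : IsDivisible Ψ) (hf₀ : IsStandardMonotone f₀)
    (hf : IsStandardMonotone f) (hle : ∀ x : ℝ, 0 < x → f₀ x ≤ f x)
    (hπ : π.PosDef) (ht : 0 ≤ t) (hσ : (Ψ t π).PosDef)
    (hN : HasMatDeriv (fun s => pullMat f (Ψ s) π) N' (Ici 0) t) {v : Fin d × Fin d → ℂ}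
    (hv : 0 < (star v ⬝ᵥ N' *ᵥ v).re) : (star v ⬝ᵥ pullMat f (Ψ t) π *ᵥ v).re <
      (star v ⬝ᵥ formMat (fun x => 1 / f₀ x) π π *ᵥ v).re := by
  have key : ∀ s, 0 ≤ s → (Ψ s π).PosDef → (star v ⬝ᵥ pullMat f (Ψ s) π *ᵥ v).re ≤
      (star v ⬝ᵥ formMat (fun x => 1 / f₀ x) π π *ᵥ v).re := fun s hs hp => by
    have h1 := (pullMat_le hf₀ hf hle (hΨ.channel s hs) hπ hp).dotProduct_mulVec_nonneg v
    rw [Matrix.sub_mulVec, dotProduct_sub] at h1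
    exact sub_nonneg.1 (Complex.le_def.1 h1).1
  -- Equality at `t` would make the upper bound attained there, so the form could not grow to the
  -- right of `t`.
  refine lt_of_le_of_ne (key t ht hσ) fun heq => ?_
  refine not_le.2 hv (HasDerivWithinAt.nonpos_of_eventually_le ht (hasDerivWithinAt_pull hN v) ?_)
  filter_upwards [nhdsGT_le_nhdsWithin_Ici ht (hΨ.eventually_posDef hπ ht hσ),
    self_mem_nhdsWithin] with u hu hu'
  rw [heq]
  exact key u (ht.trans (le_of_lt hu')) hu

theorem vec_petzMap_apply (hf₀ : IsStandardMonotone f₀) (hπ : π.PosDef) (s : ℝ) :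
    vec (petzMap f₀ f (Ψ s) π (Ψ s A)) =
      ((formMat (fun x => 1 / f₀ x) π π)⁻¹ * pullMat f (Ψ s) π) *ᵥ vec A := by
  rw [← superMatrix_petzMap_comp hf₀ hπ, superMatrix_mulVec, LinearMap.comp_apply]

theorem hasMatDeriv_petzMap (hf₀ : IsStandardMonotone f₀) (hπ : π.PosDef)
    (hN : HasMatDeriv (fun s => pullMat f (Ψ s) π) N' (Ici 0) t) :
    HasMatDeriv (fun s => petzMap f₀ f (Ψ s) π (Ψ s A))
      (unvec (((formMat (fun x => 1 / f₀ x) π π)⁻¹ * N') *ᵥ vec A)) (Ici 0) t := fun i j => by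
  have h := (hasMatDeriv_const (formMat (fun x => 1 / f₀ x) π π)⁻¹ (Ici 0) t).mul hN
  rw [Matrix.zero_mul, zero_add] at h
  refine (HasMatDeriv.mulVec h (vec A) (i, j)).congr (fun s _ => ?_) ?_
  · exact congrFun (vec_petzMap_apply hf₀ hπ s) (i, j)
  · exact congrFun (vec_petzMap_apply hf₀ hπ t) (i, j)

/-- These properties need `Ψ s π` to have full rank, which persists only near `t`; that is enough
for time derivatives at `t`. -/
theorem IsDivisible.eventually_petzMap (hΨ : IsDivisible Ψ) (hf₀ : IsStandardMonotone f₀)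
    (hf : IsStandardMonotone f) (hπ : π.PosDef) (ht : 0 ≤ t) (hσ : (Ψ t π).PosDef)
    (hA : A.IsHermitian) : ∀ᶠ s in 𝓝[Ici 0] t, (petzMap f₀ f (Ψ s) π (Ψ s A)).IsHermitian ∧
      (petzMap f₀ f (Ψ s) π (Ψ s A)).trace = A.trace ∧ petzMap f₀ f (Ψ s) π (Ψ s π) = π := by
  filter_upwards [hΨ.eventually_posDef hπ ht hσ, self_mem_nhdsWithin] with s hp hs
  refine ⟨?_, trace_petzMap hf₀ hf (hΨ.channel s hs) hπ hp A,
    petzMap_apply_self hf₀ hf (hΨ.channel s hs) hπ hp⟩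
  rw [IsHermitian, ← petzMap_conjTranspose hf₀ hf (hΨ.channel s hs) hπ hp, hA.eq]

/-- The rate of change of the retrodiction error of an eigenvector of the Fisher flow. -/
theorem IsDivisible.timeDeriv_retrodiction (hΨ : IsDivisible Ψ) (hf₀ : IsStandardMonotone f₀)
    (hf : IsStandardMonotone f) (hπ : π.PosDef) (ht : 0 ≤ t) (hσ : (Ψ t π).PosDef)
    (hN : HasMatDeriv (fun s => pullMat f (Ψ s) π) N' (Ici 0) t) {r : ℝ}
    (hA : A.IsHermitian)
    (hr : ∀ x ∈ tracelessHermitian d, (star x ⬝ᵥ N' *ᵥ vec A).re =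
      r * (star x ⬝ᵥ formMat (fun x => 1 / f₀ x) π π *ᵥ vec A).re) :
    timeDeriv (fun s => 1 / 2 * fisherInfo f₀ π (A - petzMap f₀ f (Ψ s) π (Ψ s A))) t =
      -r * ((star (vec A) ⬝ᵥ formMat (fun x => 1 / f₀ x) π π *ᵥ vec A).re -
        (star (vec A) ⬝ᵥ pullMat f (Ψ t) π *ᵥ vec A).re) := by
  set G := formMat (fun x => 1 / f₀ x) π π with hG
  have hGp : G.PosDef := posDef_formMat_inv hf₀.pos hπ
  have hGu := (Matrix.isUnit_iff_isUnit_det _).1 hGp.isUnit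
  set B : ℝ → Mat d := fun s => petzMap f₀ f (Ψ s) π (Ψ s A) with hB
  set B' := unvec ((G⁻¹ * N') *ᵥ vec A) with hB'
  have hBd : HasMatDeriv B B' (Ici 0) t := hasMatDeriv_petzMap hf₀ hπ hN
  have hev := hΨ.eventually_petzMap hf₀ hf hπ ht hσ hA
  obtain ⟨hBt, hBtr, -⟩ := hev.self_of_nhdsWithin ht
  have hdv : ∀ p, HasDerivWithinAt (fun s => vec (A - B s) p) (vec (-B') p) (Ici 0) t := fun p => by
    have := ((hasMatDeriv_const A _ _).sub hBd) p.1 p.2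
    rwa [zero_sub] at this
  have hd := (hasDerivWithinAt_dotProduct_mulVec hdv (hasMatDeriv_const G _ _) hdv).const_mul (1 / 2)
  have hc := timeDeriv_congr (F := fun s => 1 / 2 * fisherInfo f₀ π (A - B s))
    (G := fun s => 1 / 2 * (star (vec (A - B s)) ⬝ᵥ G *ᵥ vec (A - B s)).re) ht
    (hev.mono fun s hs => by rw [fisherInfo_eq f₀ π (hA.sub hs.1)])
  rw [hc, timeDeriv_eq ht hd]
  set u := vec (A - B t) with hu
  -- The inverse `G⁻¹` in the Petz map cancels the weight `G` of the error, which leaves the bare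
  -- `N'`.
  have hGB : G *ᵥ vec (-B') = -(N' *ᵥ vec A) := by
    have : vec (-B') = -((G⁻¹ * N') *ᵥ vec A) := rfl
    rw [this, mulVec_neg, Matrix.mulVec_mulVec, ← Matrix.mul_assoc, Matrix.mul_nonsing_inv _ hGu,
      Matrix.one_mul]
  -- The error is again traceless and Hermitian, so the critical point equation on that real
  -- subspace can be tested on it.
  have hmem : u ∈ tracelessHermitian d :=
    mem_tracelessHermitian (hA.sub hBt) (by rw [trace_sub, hBtr, sub_self])
  have h1 : (star u ⬝ᵥ G *ᵥ vec (-B')).re = -(r * (star u ⬝ᵥ G *ᵥ vec A).re) := by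
    rw [hGB, dotProduct_neg, Complex.neg_re, hr u hmem]
  have h2 : (star u ⬝ᵥ G *ᵥ vec A).re = (star (vec A) ⬝ᵥ G *ᵥ vec A).re -
      (star (vec A) ⬝ᵥ pullMat f (Ψ t) π *ᵥ vec A).re := by
    have h3 : G *ᵥ vec (B t) = pullMat f (Ψ t) π *ᵥ vec A := by
      rw [hB, vec_petzMap_apply hf₀ hπ, Matrix.mulVec_mulVec, ← Matrix.mul_assoc,
        Matrix.mul_nonsing_inv _ hGu, Matrix.one_mul]
    rw [re_form_symm hGp.isHermitian, hu, vec_sub, mulVec_sub, dotProduct_sub, h3, Complex.sub_re]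
  have h4 := re_form_symm hGp.isHermitian (vec (-B')) u
  rw [Complex.add_re, Complex.add_re, h4, h1, h2]
  simp only [zero_mulVec, dotProduct_zero, Complex.zero_re]
  ring

/-- Existence of a perturbation whose Fisher information increases and whose retrodiction
improves. -/
theorem IsDivisible.exists_improving (hΨ : IsDivisible Ψ) (hf₀ : IsStandardMonotone f₀)
    (hf : IsStandardMonotone f) (hle : ∀ x : ℝ, 0 < x → f₀ x ≤ f x) (hπ : π.PosDef) (ht : 0 ≤ t)
    (hσ : (Ψ t π).PosDef) (hN : HasMatDeriv (fun s => pullMat f (Ψ s) π) N' (Ici 0) t)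
    (hA : A.IsHermitian) (htr : A.trace = 0) (hpos : 0 < (star (vec A) ⬝ᵥ N' *ᵥ vec A).re) :
    ∃ δρ : Mat d, δρ.IsHermitian ∧ δρ.trace = 0 ∧ 0 < (star (vec δρ) ⬝ᵥ N' *ᵥ vec δρ).re ∧
      timeDeriv (fun s => 1 / 2 * fisherInfo f₀ π (δρ - petzMap f₀ f (Ψ s) π (Ψ s δρ))) t < 0 := by
  have hGp : (formMat (fun x => 1 / f₀ x) π π).PosDef := posDef_formMat_inv hf₀.pos hπ
  have hNh : N'.IsHermitian := HasMatDeriv.isHermitian hN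
    (fun s hs => isHermitian_pullMat (hΨ.channel s hs) hπ.isHermitian) (uniqueDiffOn_Ici 0 t ht) ht
  obtain ⟨v, hv, hv0, r, hr, hcrit⟩ := exists_max_rayleigh hNh hGp (tracelessHermitian d)
    (mem_tracelessHermitian hA htr) hpos
  have hvpos : 0 < (star v ⬝ᵥ N' *ᵥ v).re := by
    rw [hcrit v hv]
    exact mul_pos hr (Complex.lt_def.1 (hGp.dotProduct_mulVec_pos hv0)).1
  refine ⟨unvec v, hv.1, hv.2, hvpos, ?_⟩
  rw [hΨ.timeDeriv_retrodiction hf₀ hf hπ ht hσ hN hv.1 hcrit, neg_mul, neg_lt_zero]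
  exact mul_pos hr (sub_pos.2 (hΨ.form_lt hf₀ hf hle hπ ht hσ hN hvpos))

theorem IsDivisible.isBigO_timeDeriv_retrodiction (hΨ : IsDivisible Ψ)
    (hf₀ : IsStandardMonotone f₀) (hf : IsStandardMonotone f) (hπ : π.PosDef) (ht : 0 ≤ t)
    (hσ : (Ψ t π).PosDef) (hN : HasMatDeriv (fun s => pullMat f (Ψ s) π) N' (Ici 0) t)
    {g : ℝ → ℝ} (hg : IsContrastGenerator g) (hgf₀ : Corresponds g f₀) (hA : A.IsHermitian) :
    (fun ε : ℝ => timeDeriv (fun s => contrast g (π + (ε : ℂ) • A)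
      (petzMap f₀ f (Ψ s) π (Ψ s (π + (ε : ℂ) • A)))) t - ε ^ 2 * timeDeriv (fun s =>
        1 / 2 * fisherInfo f₀ π (A - petzMap f₀ f (Ψ s) π (Ψ s A))) t)
      =O[𝓝 0] (fun ε : ℝ => ε ^ 3) := by
  obtain ⟨c, k, hk, hgk⟩ := exists_quotient hg.smooth hg.map_one
  have hev := hΨ.eventually_petzMap hf₀ hf hπ ht hσ hA
  have hO := isBigO_timeDeriv_contrast hk hgk hπ hA ht
    (hasMatDeriv_petzMap (f := f) (Ψ := Ψ) (A := A) hf₀ hπ hN)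
    (hev.mono fun s hs => hs.1) (hev.mono fun s hs => hs.2.1)
  have h1 : ∀ ε : ℝ, timeDeriv (fun s => contrast g (π + (ε : ℂ) • A)
      (petzMap f₀ f (Ψ s) π (Ψ s (π + (ε : ℂ) • A)))) t =
      timeDeriv (fun s => contrast g (π + (ε : ℂ) • A)
        (π + (ε : ℂ) • petzMap f₀ f (Ψ s) π (Ψ s A))) t := fun ε =>
    timeDeriv_congr ht (hev.mono fun s hs => by
      rw [map_add, map_smul, map_add, map_smul, hs.2.2])
  have h2 : timeDeriv (fun s =>
      1 / 2 * fisherInfo f₀ π (A - petzMap f₀ f (Ψ s) π (Ψ s A))) t =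
      timeDeriv (fun s => (star (vec (A - petzMap f₀ f (Ψ s) π (Ψ s A))) ⬝ᵥ
        formMat k π π *ᵥ vec (A - petzMap f₀ f (Ψ s) π (Ψ s A))).re) t :=
    timeDeriv_congr ht (hev.mono fun s hs =>
      (re_formMat_eq_fisherInfo hgf₀ hf₀ hk hgk hπ (hA.sub hs.1)).symm)
  simp only [h1, h2]
  exact hO

end Flow

end QFisher

end

open QFisher in
theorem mainTheorem5 {d : ℕ} (Φ : ℝ → SuperOp d) (hΦ : IsDivisible Φ)
    (π : Mat d) (hπ : π.PosDef) (hπ_trace : π.trace = 1)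
    (f₀ f : ℝ → ℝ) (hf₀ : IsStandardMonotone f₀) (hf : IsStandardMonotone f)
    (hle : ∀ x : ℝ, 0 < x → f₀ x ≤ f x)
    (g : ℝ → ℝ) (hg : IsContrastGenerator g) (hgf₀ : Corresponds g f₀)
    (t : ℝ) (ht : 0 ≤ t) (hΦπ : (Φ t π).PosDef)
    (hflow : ∃ δρ : Mat d, δρ.IsHermitian ∧ δρ.trace = 0 ∧
      0 < timeDeriv (fun s => fisherInfo f (Φ s π) (Φ s δρ)) t) :
    (∃ δρ : Mat d, δρ.IsHermitian ∧ δρ.trace = 0 ∧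
      0 < timeDeriv (fun s => fisherInfo f (Φ s π) (Φ s δρ)) t ∧
      (∀ᶠ ε : ℝ in 𝓝[≠] 0,
        timeDeriv (fun s => contrast g (π + (ε : ℂ) • δρ)
          (petzMap f₀ f (Φ s) π (Φ s (π + (ε : ℂ) • δρ)))) t < 0) ∧
      ∃ q : ℝ, q < 0 ∧
        q = timeDeriv (fun s =>
          1 / 2 * fisherInfo f₀ π (δρ - petzMap f₀ f (Φ s) π (Φ s δρ))) t ∧
        (fun ε : ℝ => timeDeriv (fun s => contrast g (π + (ε : ℂ) • δρ)
          (petzMap f₀ f (Φ s) π (Φ s (π + (ε : ℂ) • δρ)))) t - ε ^ 2 * q)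
          =O[𝓝 0] (fun ε : ℝ => ε ^ 3)) ∧
    ¬ IsMarkovian Φ ∧ ¬ IsMarkovianAfter Φ t := by
  obtain ⟨N', hN⟩ := hΦ.exists_hasMatDeriv_pullMat hf hπ ht hΦπ
  obtain ⟨A, hA, htr, hpos⟩ := hflow
  rw [hΦ.timeDeriv_fisherInfo ht hN hA] at hpos
  -- The given perturbation already excludes Markovianity; the extremal one is needed only for the
  -- improvement of retrodiction.
  have hM := hΦ.not_isMarkovianAfter hf hπ ht hΦπ hN hpos
  refine ⟨?_, fun h => hM (h.after ht), hM⟩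
  obtain ⟨δρ, hδ, hδtr, hδpos, hq⟩ := hΦ.exists_improving hf₀ hf hle hπ ht hΦπ hN hA htr hpos
  have hO := hΦ.isBigO_timeDeriv_retrodiction hf₀ hf hπ ht hΦπ hN hg hgf₀ hδ
  refine ⟨δρ, hδ, hδtr, ?_, eventually_neg_of_isBigO hq hO, _, hq, rfl, hO⟩
  rwa [hΦ.timeDeriv_fisherInfo ht hN hδ]
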